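/- **Proposition (smooth stacking risk).** Let $(m_n)$, $(p_n)$ be nondecreasing sequences of integers with $0\le m_n<n$, $p_n\ge 1$, let $(\beta_n)$ be a nondecreasing sequence of positive reals, and let $d_n\ge 0$, $d'_n\ge 1$ be integers; write $N_n:=n-m_n$. For each $n$ let $X^n=(X^n_1,\dots,X^n_n)$ be i.i.d. random vectors in $\mathbb R^{d_n}$, let $\mathcal L_n:\mathbb R^{d_n}\times\mathbb R^{d'_n}\to\mathbb R$ be a smooth ($C^\infty$) loss, and let $\hat\theta^1_n,\dots,\hat\theta^{p_n}_n$ be estimators: $\hat\theta^k_n(x_{1:m_n})$ is a function $\mathbb R^{d_n}\to\mathbb R^{d'_n}$, and $(x_{1:m_n},z)\mapsto\hat\theta^k_n(x_{1:m_n})(z)$ is measurable. Put $$\mathcal R^k_n(x_{1:n})=\frac1{N_n}\sum_{i=m_n+1}^n\mathcal L_n\big(x_i,\hat\theta^k_n(x_{1:m_n})(x_i)\big),\qquad \hat\Theta_n(x_{1:n})=\sum_{k\le p_n}\hat\theta^k_n(x_{1:m_n})\frac{e^{-\beta_n\mathcal R^k_n(x_{1:n})}}{\sum_{k'\le p_n}e^{-\beta_n\mathcal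 R^{k'}_n(x_{1:n})}},$$ $\hat\Theta_n:=\hat\Theta_n(X^n)$ and, for a function $\Theta$ and a sample $w=(w_1,\dots,w_{N_n})$, $\mathcal R^{\rm s}_\Theta(w):=N_n^{-1/2}\sum_{i}\mathcal L_n(w_i,\Theta(w_i))$. Put $$T_n:=\sup_{\ell\le d'_n}\Big\|\sup_{k\le p_n}\big|\hat\theta^k_{n,\ell}(X^n_{1:m_n})(X^n_n)\big|\Big\|_{L_\infty}\vee 1,$$ $$L_n:=\Big\|\sup_{k\le p_n}\big|\mathcal L_n(X^n_n,\hat\theta^k_n(X^n_{1:m_n})(X^n_n))\big|\Big\|_{L_\infty}\vee\ \sup_{\ell\le d'_n}\Big\|\sup_{\theta}\big|\partial_{y_\ell}\mathcal L_n(X^n_n,\theta(X^n_n))\big|\Big\|_{L_\infty}\vee 1,$$ where $\theta$ runs over the convex combinations of $\hat\theta^1_n(X^n_{1:m_n}),\dots,\hat\theta^{p_n}_n(X^n_{1:m_n})$. Assume that $T_n,L_n<\infty$ for all $n$ and that $$\frac{\beta_n d'_n}{\sqrt{n-m_n}}\,L_nT_n\,e^{\frac{\beta_n}{n-m_n}L_n}\longrightarrow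 0 .\tag{$H_1^{\rm stacked}$}$$ Let $Z^n=(Z^n_1,\dots,Z^n_{N_n})$ be a bootstrap sample of $(X^n_{m_n+1},\dots,X^n_n)$ (conditionally on $X^n$ its entries are i.i.d. uniform on $X^n_{m_n+1},\dots,X^n_n$), and let $Y^n$ be a copy of $(X^n_{m_n+1},\dots,X^n_n)$ that is independent of $X^n$. Set $$B_n:=\mathcal R^{\rm s}_{\hat\Theta_n}(Z^n)-\mathbb E\big[\mathcal R^{\rm s}_{\hat\Theta_n}(Z^n)\mid X^n\big],\qquad C_n:=\mathcal R^{\rm s}_{\hat\Theta_n}(Y^n)-\mathbb E\big[\mathcal R^{\rm s}_{\hat\Theta_n}(Y^n)\mid\hat\Theta_n\big].$$ Let $\mathcal F=\{h\in C^3(\mathbb R):\ |h^{(i)}|\le 1,\ i=1,2,3\}$ and $d_{\mathcal F}(U,V\mid X^n):=\sup_{h\in\mathcal F}\mathbb E[h(U)-h(V)\mid X^n]$, computed with the regular conditional laws given $X^n$. Then: 1. $\big\|d_{\mathcal F}(B_n,C_n\mid X^n)\big\|_{L_1}\to 0$. 2. Let $\alpha\in\mathbb R$ and let $t_{n,\alpha}$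 be measurable functions with $P\big(|B_n|\ge t_{n,\alpha}(X^n)\mid X^n\big)\le\alpha$ a.s. for every $n$. Then for every $\delta>0$ $$\limsup_{n\to\infty}P\big(|C_n|\ge t_{n,\alpha}(X^n)+\delta\ \big|\ \hat\Theta_n\big)\le\alpha\quad\text{in probability},$$ that is, $P\big\{P(|C_n|\ge t_{n,\alpha}(X^n)+\delta\mid\hat\Theta_n)>\alpha+\varepsilon\big\}\to 0$ for every $\varepsilon>0$; and also $\limsup_{n\to\infty}P\big(|C_n|\ge t_{n,\alpha}(X^n)+\delta\big)\le\alpha$. -/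

import Mathlib

open MeasureTheory ProbabilityTheory Filter Topology
open scoped ENNReal

namespace SmoothStacking

/-! ### The metric on laws -/

/-- Test functions: `C³` functions on the line whose first three derivatives are bounded by `1`. -/
def testFunctions : Set (ℝ → ℝ) :=
  {h | ContDiff ℝ 3 h ∧ ∀ i : ℕ, 1 ≤ i → i ≤ 3 → ∀ x : ℝ, |iteratedDeriv i h x| ≤ 1}

/-- The distance `sup_h (∫ h dμ - ∫ h dν)` over the test functions. The class is stable under
`h ↦ -h`, so cutting each term at `0` does not change the supremum. -/
noncomputable def testDist (μ ν : Measure ℝ) : ℝ≥0∞ :=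
  ⨆ h ∈ testFunctions, ENNReal.ofReal (∫ x, h x ∂μ - ∫ x, h x ∂ν)

/-- The conditional distance between the real random variables `U` and `V` given `W`: the distance
between their regular conditional laws given `W`, a random variable. -/
noncomputable def condTestDist {Ω S : Type*} [MeasurableSpace Ω] [MeasurableSpace S]
    (P : Measure Ω) [IsFiniteMeasure P] (U V : Ω → ℝ) (W : Ω → S) (ω : Ω) : ℝ≥0∞ :=
  testDist (condDistrib U W P (W ω)) (condDistrib V W P (W ω))

/-! ### Samples

A row of the array is a sequence `X : ℕ → Ω → ℝ^d`, of which only the entries `X 0, …, X (n-1)`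
are used; they stand for `X_1, …, X_n`. -/

/-- The first `n` observations `X_{1:n}`. -/
def row {Ω : Type*} {d : ℕ} (X : ℕ → Ω → (Fin d → ℝ)) (n : ℕ) : Ω → Fin n → Fin d → ℝ :=
  fun ω i => X i ω

/-- The observations `X_{m+1:n}`. -/
def heldOut {Ω : Type*} {d : ℕ} (X : ℕ → Ω → (Fin d → ℝ)) (m n : ℕ) :
    Ω → Fin (n - m) → Fin d → ℝ :=
  fun ω j => X (m + j) ω

/-- The uniform distribution on the points `v_1, …, v_N`, counted with multiplicity. -/
noncomputable def empiricalMeasure {d N : ℕ} (v : Fin N → Fin d → ℝ) : Measure (Fin d → ℝ) :=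
  (N : ℝ≥0∞)⁻¹ • ∑ j, Measure.dirac (v j)

/-- `Z` is a bootstrap sample of `X_{m+1:n}`: conditionally on `X_{1:n}` its entries are i.i.d.
and uniform on `{X_{m+1}, …, X_n}`. -/
def IsBootstrapSample {Ω : Type*} [MeasurableSpace Ω] {d : ℕ} (P : Measure Ω) [IsFiniteMeasure P]
    (X : ℕ → Ω → (Fin d → ℝ)) (m n : ℕ) (Z : Ω → Fin (n - m) → Fin d → ℝ) : Prop :=
  Measurable Z ∧ ∀ᵐ ω ∂P, condDistrib Z (row X n) P (row X n ω) =
    Measure.pi (fun _ : Fin (n - m) => empiricalMeasure (heldOut X m n ω))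

/-- `Y` is an independent copy of `X_{m+1:n}`: it has the law of `X_{m+1:n}` and is independent
of `X_{1:n}`. -/
def IsIndepCopy {Ω : Type*} [MeasurableSpace Ω] {d : ℕ} (P : Measure Ω)
    (X : ℕ → Ω → (Fin d → ℝ)) (m n : ℕ) (Y : Ω → Fin (n - m) → Fin d → ℝ) : Prop :=
  Measurable Y ∧ IdentDistrib Y (heldOut X m n) P P ∧ IndepFun Y (row X n) P

/-! ### The stacked estimator and its risk -/

/-- The mean loss of the predictor `f` on the sample `v`. -/
noncomputable def meanLoss {d d' N : ℕ} (L : (Fin d → ℝ) → (Fin d' → ℝ) → ℝ)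
    (f : (Fin d → ℝ) → (Fin d' → ℝ)) (v : Fin N → Fin d → ℝ) : ℝ :=
  1 / (N : ℝ) * ∑ i, L (v i) (f (v i))

/-- The `√N`-scaled empirical risk `N^{-1/2} ∑ L(v_i, f(v_i))` of the predictor `f`. -/
noncomputable def scaledRisk {d d' N : ℕ} (L : (Fin d → ℝ) → (Fin d' → ℝ) → ℝ)
    (f : (Fin d → ℝ) → (Fin d' → ℝ)) (v : Fin N → Fin d → ℝ) : ℝ :=
  1 / √(N : ℝ) * ∑ i, L (v i) (f (v i))

/-- The softmax weight of the `k`-th base estimator; the base estimators are fitted on `u`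
and their mean losses are evaluated on `v`. -/
noncomputable def weight {d d' m N p : ℕ} (L : (Fin d → ℝ) → (Fin d' → ℝ) → ℝ)
    (θ : Fin p → (Fin m → Fin d → ℝ) → (Fin d → ℝ) → (Fin d' → ℝ)) (β : ℝ)
    (u : Fin m → Fin d → ℝ) (v : Fin N → Fin d → ℝ) (k : Fin p) : ℝ :=
  Real.exp (-β * meanLoss L (θ k u) v) / ∑ k', Real.exp (-β * meanLoss L (θ k' u) v)

/-- The smooth-stacked predictor `∑_k w_k θ^k(u)`. -/
noncomputable def stackedPredictor {d d' m N p : ℕ} (L : (Fin d → ℝ) → (Fin d' → ℝ) → ℝ)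
    (θ : Fin p → (Fin m → Fin d → ℝ) → (Fin d → ℝ) → (Fin d' → ℝ)) (β : ℝ)
    (u : Fin m → Fin d → ℝ) (v : Fin N → Fin d → ℝ) : (Fin d → ℝ) → (Fin d' → ℝ) :=
  fun z => ∑ k, weight L θ β u v k • θ k u z

/-- The smooth-stacked ensemble built on `X_{1:n}`, a random function: the base estimators are
fitted on `X_{1:m}` and weighted through their losses on `X_{m+1:n}`. -/
noncomputable def ensemble {Ω : Type*} {d d' m p : ℕ} (L : (Fin d → ℝ) → (Fin d' → ℝ) → ℝ)
    (θ : Fin p → (Fin m → Fin d → ℝ) → (Fin d → ℝ) → (Fin d' → ℝ)) (β : ℝ)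
    (X : ℕ → Ω → (Fin d → ℝ)) (n : ℕ) : Ω → (Fin d → ℝ) → (Fin d' → ℝ) :=
  fun ω => stackedPredictor L θ β (row X m ω) (heldOut X m n ω)

/-- The scaled empirical risk of the ensemble built on `X_{1:n}`, evaluated on the sample `W`. -/
noncomputable def ensembleRisk {Ω : Type*} {d d' m p : ℕ} (L : (Fin d → ℝ) → (Fin d' → ℝ) → ℝ)
    (θ : Fin p → (Fin m → Fin d → ℝ) → (Fin d → ℝ) → (Fin d' → ℝ)) (β : ℝ)
    (X : ℕ → Ω → (Fin d → ℝ)) (n : ℕ) (W : Ω → Fin (n - m) → Fin d → ℝ) : Ω → ℝ :=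
  fun ω => scaledRisk L (ensemble L θ β X n ω) (W ω)

/-- The σ-algebra generated by `X_{1:n}`. -/
abbrev rowSigma {Ω : Type*} {d : ℕ} (X : ℕ → Ω → (Fin d → ℝ)) (n : ℕ) : MeasurableSpace Ω :=
  MeasurableSpace.comap (row X n) inferInstance

/-- The σ-algebra generated by the ensemble, i.e. by all its values `ω ↦ Θ̂(ω)(z)`. -/
noncomputable abbrev ensembleSigma {Ω : Type*} {d d' m p : ℕ}
    (L : (Fin d → ℝ) → (Fin d' → ℝ) → ℝ)
    (θ : Fin p → (Fin m → Fin d → ℝ) → (Fin d → ℝ) → (Fin d' → ℝ)) (β : ℝ)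
    (X : ℕ → Ω → (Fin d → ℝ)) (n : ℕ) : MeasurableSpace Ω :=
  MeasurableSpace.comap (ensemble L θ β X n) MeasurableSpace.pi

/-- The risk on the bootstrap sample, centered at its conditional expectation given `X_{1:n}`. -/
noncomputable def bootstrapCenteredRisk {Ω : Type*} [MeasurableSpace Ω] {d d' m p : ℕ}
    (P : Measure Ω) (L : (Fin d → ℝ) → (Fin d' → ℝ) → ℝ)
    (θ : Fin p → (Fin m → Fin d → ℝ) → (Fin d → ℝ) → (Fin d' → ℝ)) (β : ℝ)
    (X : ℕ → Ω → (Fin d → ℝ)) (n : ℕ) (Z : Ω → Fin (n - m) → Fin d → ℝ) : Ω → ℝ :=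
  fun ω => ensembleRisk L θ β X n Z ω - (P[ensembleRisk L θ β X n Z | rowSigma X n]) ω

/-- The risk on the independent copy, centered at its conditional expectation given the
ensemble. -/
noncomputable def copyCenteredRisk {Ω : Type*} [MeasurableSpace Ω] {d d' m p : ℕ}
    (P : Measure Ω) (L : (Fin d → ℝ) → (Fin d' → ℝ) → ℝ)
    (θ : Fin p → (Fin m → Fin d → ℝ) → (Fin d → ℝ) → (Fin d' → ℝ)) (β : ℝ)
    (X : ℕ → Ω → (Fin d → ℝ)) (n : ℕ) (Y : Ω → Fin (n - m) → Fin d → ℝ) : Ω → ℝ :=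
  fun ω => ensembleRisk L θ β X n Y ω -
    (P[ensembleRisk L θ β X n Y | ensembleSigma L θ β X n]) ω

/-! ### The constants `T_n` and `L_n`

Both are `L^∞` norms, with values in `[1, ∞]`. The observation `X (n - 1)` is the last one
of the row. -/

/-- `T_n`: essential bound of the coordinates of the base estimators, at least `1`. -/
noncomputable def estimatorBound {Ω : Type*} [MeasurableSpace Ω] {d d' m p : ℕ} (P : Measure Ω)
    (θ : Fin p → (Fin m → Fin d → ℝ) → (Fin d → ℝ) → (Fin d' → ℝ))
    (X : ℕ → Ω → (Fin d → ℝ)) (n : ℕ) : ℝ≥0∞ :=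
  (⨆ l : Fin d', essSup (fun ω => ⨆ k : Fin p, ‖θ k (row X m ω) (X (n - 1) ω) l‖ₑ) P) ⊔ 1

/-- The partial derivative of the loss in the `l`-th coordinate of its second argument. -/
noncomputable def partialLoss {d d' : ℕ} (L : (Fin d → ℝ) → (Fin d' → ℝ) → ℝ) (l : Fin d')
    (x : Fin d → ℝ) (y : Fin d' → ℝ) : ℝ :=
  fderiv ℝ (L x) y (Pi.single l 1)

/-- `L_n`: essential bound of the losses of the base estimators and of the partial derivatives of
the loss along all their convex combinations, at least `1`. -/
noncomputable def lossBound {Ω : Type*} [MeasurableSpace Ω] {d d' m p : ℕ} (P : Measure Ω)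
    (L : (Fin d → ℝ) → (Fin d' → ℝ) → ℝ)
    (θ : Fin p → (Fin m → Fin d → ℝ) → (Fin d → ℝ) → (Fin d' → ℝ))
    (X : ℕ → Ω → (Fin d → ℝ)) (n : ℕ) : ℝ≥0∞ :=
  essSup (fun ω => ⨆ k : Fin p, ‖L (X (n - 1) ω) (θ k (row X m ω) (X (n - 1) ω))‖ₑ) P ⊔
    (⨆ l : Fin d', essSup (fun ω => ⨆ w ∈ stdSimplex ℝ (Fin p),
      ‖partialLoss L l (X (n - 1) ω) (∑ k, w k • θ k (row X m ω) (X (n - 1) ω))‖ₑ) P) ⊔ 1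

end SmoothStacking

/-! Conditionally on $X^n$ the loss $f$ of the ensemble is a fixed function. The centred risk $B_n$
is then a normalised centred sum of $N$ independent draws from the empirical law of the held-out
points, and $C_n$ is the same sum for the law $\mu$ of one observation. Stein's method
(`normal_approximation`) puts each sum within $56M/\sqrt N$ of a centred Gaussian with the same
standard deviation, where $M$ bounds $|f|$ and the variance may be arbitrarily small. Centred
Gaussians are Lipschitz in their standard deviation. Hence the conditional distance is at most
$112M/\sqrt N$ plus the gap between the standard deviation of $f$ on the held-out sample and its
standard deviation under $\mu$ (`abs_integral_condDistrib_sub_le`).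

The difficulty is that $f$ is built from the same held-out sample. What saves it is stability.
Replacing one observation moves the softmax weights by at most $e^{4\beta\Lambda/N}-1$ in $\ell^1$,
hence the loss by at most $\varepsilon=\Lambda d'T(e^{4\beta\Lambda/N}-1)$. A stable functional
averaged over its own sample is close to its mean, by a second moment computation in which pairs of
observations are frozen (`integral_abs_average_sub_le`). To obtain an error linear in $\varepsilon$
and in $M/\sqrt N$ for standard deviations, and not only for variances, the computation is applied
to the squared centred loss divided by $s+4\varepsilon$, where $s$ is the true standard deviation
(`integral_abs_sampleStdDev_sub_stdDev_le`). The rate condition and $\beta_n\ge\beta_0>0$ send both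
errors to zero (`error_le_of_rate`).

For the tails, a smooth function squeezed between the indicators of $|x|\ge t+\delta$ and $|x|\ge t$
is a multiple of a test function, uniformly in $t$. So the tail of $C_n$ given $X^n$ is at most
$\alpha+K\psi_n$ with $\psi_n\ge 0$ of vanishing mean. Projecting on the coarser σ-algebra of the
ensemble and Markov's inequality give the statement in probability; taking expectations gives the
last one.

The risk $C_n$ is centred given the ensemble only, through the σ-algebra of its pointwise values.
`condExp_ae_eq_integral_of_section` shows that this centring is still integration against $\mu$. -/

namespace SmoothStacking

/-! ### Stein's equation for Lipschitz functions -/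

/-- The unnormalised Gaussian density. -/
noncomputable def gaussWeight (x : ℝ) : ℝ := Real.exp (-(x ^ 2 / 2))

lemma gaussWeight_eq (x : ℝ) : gaussWeight x = Real.exp (-(1 / 2) * x ^ 2) := by
  unfold gaussWeight; congr 1; ring

lemma gaussWeight_pos (x : ℝ) : 0 < gaussWeight x := Real.exp_pos _

lemma continuous_gaussWeight : Continuous gaussWeight := by unfold gaussWeight; fun_prop

lemma exp_mul_gaussWeight (x : ℝ) : Real.exp (x ^ 2 / 2) * gaussWeight x = 1 := by
  rw [gaussWeight, ← Real.exp_add]; simp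

lemma hasDerivAt_gaussWeight (x : ℝ) : HasDerivAt gaussWeight (-(x * gaussWeight x)) x := by
  have h : HasDerivAt (fun x : ℝ => -(x ^ 2 / 2)) (-x) x := by
    refine ((hasDerivAt_pow 2 x).div_const 2).fun_neg.congr_deriv ?_
    push_cast; ring
  unfold gaussWeight
  exact h.exp.congr_deriv (by ring)

lemma integrable_gaussWeight : Integrable gaussWeight := by
  have := integrable_exp_neg_mul_sq (b := 1 / 2) (by norm_num)
  refine this.congr (ae_of_all _ fun x => ?_)
  simp only [gaussWeight_eq]

lemma integrable_mul_gaussWeight : Integrable fun x => x * gaussWeight x := by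
  have := integrable_mul_exp_neg_mul_sq (b := 1 / 2) (by norm_num)
  refine this.congr (ae_of_all _ fun x => ?_)
  simp only [gaussWeight_eq]

lemma integrable_sq_mul_gaussWeight : Integrable fun x => x ^ 2 * gaussWeight x := by
  have := integrable_rpow_mul_exp_neg_mul_sq (b := 1 / 2) (by norm_num) (s := 2) (by norm_num)
  refine this.congr (ae_of_all _ fun x => ?_)
  simp only [gaussWeight_eq, Real.rpow_two]

lemma integral_gaussWeight : ∫ x, gaussWeight x = √(2 * Real.pi) := by
  simp_rw [gaussWeight_eq, integral_gaussian]
  congr 1; ring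

lemma integral_gaussianReal_eq_gaussWeight (h : ℝ → ℝ) :
    ∫ x, h x ∂gaussianReal 0 1 = (√(2 * Real.pi))⁻¹ * ∫ x, h x * gaussWeight x := by
  rw [integral_gaussianReal_eq_integral_smul one_ne_zero, ← integral_const_mul]
  congr 1; ext x
  simp [gaussianPDFReal, gaussWeight]
  ring_nf

lemma tendsto_gaussWeight_atTop : Tendsto gaussWeight atTop (𝓝 0) := by
  unfold gaussWeight
  refine Real.tendsto_exp_neg_atTop_nhds_zero.comp ?_
  exact (tendsto_pow_atTop (by norm_num)).atTop_div_const (by norm_num)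

lemma tendsto_mul_gaussWeight_atTop : Tendsto (fun x => x * gaussWeight x) atTop (𝓝 0) := by
  have h1 : Tendsto (fun x : ℝ => x * Real.exp (-x)) atTop (𝓝 0) := by
    simpa using Real.tendsto_pow_mul_exp_neg_atTop_nhds_zero 1
  refine tendsto_of_tendsto_of_tendsto_of_le_of_le' tendsto_const_nhds h1 ?_ ?_
  · filter_upwards [eventually_ge_atTop 0] with x hx
    exact mul_nonneg hx (gaussWeight_pos x).le
  · filter_upwards [eventually_ge_atTop 2] with x hx
    refine mul_le_mul_of_nonneg_left ?_ (by linarith)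
    exact Real.exp_le_exp.2 (by nlinarith)

lemma integral_Ioi_mul_gaussWeight (w : ℝ) :
    ∫ x in Set.Ioi w, x * gaussWeight x = gaussWeight w := by
  have := integral_Ioi_of_hasDerivAt_of_tendsto' (a := w) (f := fun x => -gaussWeight x)
    (f' := fun x => x * gaussWeight x) (m := 0)
    (fun x _ => by simpa using (hasDerivAt_gaussWeight x).fun_neg)
    integrable_mul_gaussWeight.integrableOn (by simpa using tendsto_gaussWeight_atTop.neg)
  simpa using this

/-- The integrand is the derivative of `-((x - w) * gaussWeight x)`, which vanishes at `w` and at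
infinity. It links the tail moments of `x - w` of orders 0, 1 and 2. -/
lemma integral_Ioi_sub_mul_mul_gaussWeight (w : ℝ) :
    ∫ x in Set.Ioi w, ((x - w) * x * gaussWeight x - gaussWeight x) = 0 := by
  have hi : Integrable fun x => (x - w) * x * gaussWeight x - gaussWeight x := by
    have := (integrable_sq_mul_gaussWeight.sub (integrable_mul_gaussWeight.const_mul w)).sub
      integrable_gaussWeight
    refine this.congr (ae_of_all _ fun x => ?_)
    simp only [Pi.sub_apply]; ring
  have := integral_Ioi_of_hasDerivAt_of_tendsto' (a := w)
    (f := fun x => -((x - w) * gaussWeight x))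
    (f' := fun x => (x - w) * x * gaussWeight x - gaussWeight x) (m := 0)
    (fun x _ => by
      refine (((hasDerivAt_id x).sub_const w).fun_mul
        (hasDerivAt_gaussWeight x)).fun_neg.congr_deriv ?_
      simp only [id]; ring)
    hi.integrableOn (by
      have := (tendsto_mul_gaussWeight_atTop.sub (tendsto_gaussWeight_atTop.const_mul w)).neg
      simp only [mul_zero, sub_zero, neg_zero] at this
      refine this.congr fun x => ?_
      ring)
  simpa using this

/-- Tail bounds for a Lipschitz function against the Gaussian weight. -/
lemma stein_tail_bound {H : ℝ → ℝ} (hl : ∀ x y, |H x - H y| ≤ |x - y|)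
    (h0 : |H 0| ≤ 1) {w : ℝ} (hw : 0 ≤ w) (hi : Integrable fun x => H x * gaussWeight x) :
    |Real.exp (w ^ 2 / 2) * ∫ x in Set.Ioi w, H x * gaussWeight x| ≤ 6 ∧
    |w * (H w - w * (Real.exp (w ^ 2 / 2) * ∫ x in Set.Ioi w, H x * gaussWeight x))| ≤ 7 := by
  set E := Real.exp (w ^ 2 / 2) with hE
  have hE0 : 0 < E := Real.exp_pos _
  have hEg : E * gaussWeight w = 1 := exp_mul_gaussWeight w
  have i0 : IntegrableOn gaussWeight (Set.Ioi w) := integrable_gaussWeight.integrableOn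
  have i1 : IntegrableOn (fun x => x * gaussWeight x) (Set.Ioi w) :=
    integrable_mul_gaussWeight.integrableOn
  have i2 : IntegrableOn (fun x => x ^ 2 * gaussWeight x) (Set.Ioi w) :=
    integrable_sq_mul_gaussWeight.integrableOn
  have j1 : IntegrableOn (fun x => (x - w) * gaussWeight x) (Set.Ioi w) := by
    refine (i1.sub (i0.const_mul w)).congr (ae_of_all _ fun x => ?_)
    simp only [Pi.sub_apply]; ring
  have j2 : IntegrableOn (fun x => (x - w) ^ 2 * gaussWeight x) (Set.Ioi w) := by
    refine ((i2.sub (i1.const_mul (2 * w))).add (i0.const_mul (w ^ 2))).congr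
      (ae_of_all _ fun x => ?_)
    simp only [Pi.sub_apply, Pi.add_apply]; ring
  -- Tail moments of `x - w`, divided by the Gaussian weight at `w`. Both claims follow from the
  -- recursions `e1` and `e2` between them.
  set A0 := E * ∫ x in Set.Ioi w, gaussWeight x with hA0
  set A1 := E * ∫ x in Set.Ioi w, (x - w) * gaussWeight x with hA1
  set A2 := E * ∫ x in Set.Ioi w, (x - w) ^ 2 * gaussWeight x with hA2
  have n0 : 0 ≤ A0 := mul_nonneg hE0.le (integral_nonneg fun x => (gaussWeight_pos x).le)
  have n1 : 0 ≤ A1 := mul_nonneg hE0.le (setIntegral_nonneg measurableSet_Ioi fun x hx =>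
    mul_nonneg (sub_nonneg.2 (le_of_lt hx)) (gaussWeight_pos x).le)
  have n2 : 0 ≤ A2 := mul_nonneg hE0.le (integral_nonneg fun x =>
    mul_nonneg (sq_nonneg _) (gaussWeight_pos x).le)
  have e1 : w * A0 + A1 = 1 := by
    rw [← hEg, ← integral_Ioi_mul_gaussWeight w, hA0, hA1]
    have : ∫ x in Set.Ioi w, x * gaussWeight x
        = (∫ x in Set.Ioi w, (x - w) * gaussWeight x) + ∫ x in Set.Ioi w, w * gaussWeight x := by
      rw [← integral_add j1 (i0.const_mul w)]
      congr 1; ext x; ring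
    rw [this, integral_const_mul]; ring
  have e2 : w * A1 + A2 = A0 := by
    have h := integral_Ioi_sub_mul_mul_gaussWeight w
    have : ∫ x in Set.Ioi w, ((x - w) * x * gaussWeight x - gaussWeight x)
        = (∫ x in Set.Ioi w, (x - w) ^ 2 * gaussWeight x)
          + w * (∫ x in Set.Ioi w, (x - w) * gaussWeight x)
          - ∫ x in Set.Ioi w, gaussWeight x := by
      rw [← integral_const_mul, ← integral_add j2 (j1.const_mul w), ← integral_sub _ i0]
      · congr 1; ext x; ring
      · exact j2.add (j1.const_mul w)
    rw [this] at h
    rw [hA0, hA1, hA2]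
    linear_combination E * h
  -- For `w ≥ 1` the identity `e1` gives `A0 ≤ 1`. For `w < 1`, `exp (1/2) ≤ 1.65` and the total
  -- mass `√(2π) ≤ 2.6` suffice.
  have b0 : A0 ≤ 5 := by
    by_cases h1 : 1 ≤ w
    · nlinarith
    · have hw1 : w < 1 := not_le.1 h1
      have hE1 : E ≤ 1.65 := by
        have : E ≤ Real.exp (1 / 2) := Real.exp_le_exp.2 (by nlinarith)
        have h2 : Real.exp (1 / 2) ^ 2 = Real.exp 1 := by
          rw [← Real.exp_nat_mul]; norm_num
        have := Real.exp_one_lt_d9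
        nlinarith [Real.exp_pos (1 / 2 : ℝ)]
      have hI : ∫ x in Set.Ioi w, gaussWeight x ≤ 2.6 := by
        have : ∫ x in Set.Ioi w, gaussWeight x ≤ ∫ x, gaussWeight x :=
          setIntegral_le_integral integrable_gaussWeight
            (ae_of_all _ fun x => (gaussWeight_pos x).le)
        rw [integral_gaussWeight] at this
        refine this.trans ?_
        rw [Real.sqrt_le_left (by norm_num)]
        have := Real.pi_lt_d2
        nlinarith
      have hI0 : 0 ≤ ∫ x in Set.Ioi w, gaussWeight x :=
        integral_nonneg fun x => (gaussWeight_pos x).le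
      rw [hA0]
      nlinarith
  set Q := E * ∫ x in Set.Ioi w, H x * gaussWeight x with hQ
  have hQR : |Q - H w * A0| ≤ A1 := by
    have : Q - H w * A0 = E * ∫ x in Set.Ioi w, (H x - H w) * gaussWeight x := by
      rw [hQ, hA0, mul_left_comm, ← mul_sub, ← integral_const_mul,
        ← integral_sub hi.integrableOn (i0.const_mul _)]
      congr 2; ext x; ring
    rw [this, abs_mul, abs_of_pos hE0, hA1]
    refine mul_le_mul_of_nonneg_left ?_ hE0.le
    rw [← Real.norm_eq_abs]
    refine norm_integral_le_of_norm_le j1 ?_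
    filter_upwards [ae_restrict_mem measurableSet_Ioi] with x hx
    rw [Real.norm_eq_abs, abs_mul, abs_of_pos (gaussWeight_pos x)]
    refine mul_le_mul_of_nonneg_right ?_ (gaussWeight_pos x).le
    have := hl x w
    rwa [abs_of_nonneg (sub_nonneg.2 (le_of_lt hx) : 0 ≤ x - w)] at this
  have hHw : |H w| ≤ 1 + w := by
    have := hl w 0
    rw [sub_zero, abs_of_nonneg hw] at this
    have h3 : |H w| ≤ |H w - H 0| + |H 0| := by
      simpa using abs_add_le (H w - H 0) (H 0)
    linarith
  clear_value A0 A1 A2 Q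
  constructor
  · have : |Q| ≤ |Q - H w * A0| + |H w * A0| := by
      simpa using abs_add_le (Q - H w * A0) (H w * A0)
    rw [abs_mul, abs_of_nonneg n0] at this
    nlinarith
  · have h4 : w * (H w - w * Q) = w * H w * A1 - w ^ 2 * (Q - H w * A0) := by
      linear_combination (w * H w) * (-e1)
    rw [h4]
    refine (abs_sub _ _).trans ?_
    rw [abs_mul, abs_mul, abs_mul, abs_of_nonneg hw, abs_of_nonneg n1,
      abs_of_nonneg (sq_nonneg w)]
    have h5 : w ^ 2 * |Q - H w * A0| ≤ w ^ 2 * A1 :=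
      mul_le_mul_of_nonneg_left hQR (sq_nonneg w)
    have h6 : w * |H w| * A1 ≤ w * (1 + w) * A1 := by gcongr
    have h7 : w * A1 ≤ A0 := by linarith
    have h8 : w * (w * A1) ≤ w * A0 := mul_le_mul_of_nonneg_left h7 hw
    nlinarith

/-- From `|x| ≤ (1 + x ^ 2) / 2` and unit variance. -/
lemma integral_abs_gaussianReal_le : ∫ x, |x| ∂gaussianReal 0 1 ≤ 1 := by
  have gi : Integrable (fun x : ℝ => x) (gaussianReal 0 1) :=
    (memLp_id_gaussianReal 1).integrable (by norm_num)
  have i2 : Integrable (fun x : ℝ => x ^ 2) (gaussianReal 0 1) :=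
    (memLp_id_gaussianReal 2).integrable_sq
  have e2 : ∫ x, x ^ 2 ∂gaussianReal 0 1 = 1 := by
    have := variance_fun_id_gaussianReal (μ := 0) (v := 1)
    rw [variance_of_integral_eq_zero (X := fun x : ℝ => x) measurable_id.aemeasurable
      integral_id_gaussianReal] at this
    simpa using this
  have : ∫ x, |x| ∂gaussianReal 0 1 ≤ ∫ x, (1 + x ^ 2) / 2 ∂gaussianReal 0 1 := by
    refine integral_mono gi.abs (((integrable_const 1).add i2).div_const 2) fun x => ?_
    nlinarith [sq_nonneg (|x| - 1), sq_abs x]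
  rw [integral_div, integral_add (integrable_const 1) i2, e2] at this
  simp at this
  linarith

/-- A solution of Stein's equation for a Lipschitz function, with bounded second derivative. -/
lemma exists_stein_solution {h h' : ℝ → ℝ} (hd : ∀ x, HasDerivAt h (h' x) x)
    (hb : ∀ x, |h' x| ≤ 1) :
    ∃ f f' f'' : ℝ → ℝ, (∀ x, HasDerivAt f (f' x) x) ∧ (∀ x, HasDerivAt f' (f'' x) x) ∧
      (∀ x, |f'' x| ≤ 14) ∧ ∀ x, f' x - x * f x = h x - ∫ y, h y ∂gaussianReal 0 1 := by
  have hcont : Continuous h := continuous_iff_continuousAt.2 fun x => (hd x).continuousAt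
  have hlip : ∀ x y, |h x - h y| ≤ |x - y| := by
    intro x y
    have := Convex.norm_image_sub_le_of_norm_hasDerivWithin_le (f := h) (f' := h') (C := 1)
      (s := Set.univ) (x := y) (y := x) (fun z _ => (hd z).hasDerivWithinAt)
      (fun z _ => hb z) convex_univ trivial trivial
    simpa using this
  set c := ∫ y, h y ∂gaussianReal 0 1 with hcdef
  set H : ℝ → ℝ := fun x => h x - c with hH
  have hHc : Continuous H := hcont.sub continuous_const
  have hHl : ∀ x y, |H x - H y| ≤ |x - y| := fun x y => by simpa [hH] using hlip x y
  have gi : Integrable (fun x : ℝ => x) (gaussianReal 0 1) :=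
    (memLp_id_gaussianReal 1).integrable (by norm_num)
  have hgi : Integrable h (gaussianReal 0 1) := by
    refine Integrable.mono' (gi.abs.add (integrable_const |h 0|)) hcont.aestronglyMeasurable
      (ae_of_all _ fun x => ?_)
    have := hlip x 0
    rw [sub_zero] at this
    have h3 : |h x| ≤ |h x - h 0| + |h 0| := by simpa using abs_add_le (h x - h 0) (h 0)
    simp only [Real.norm_eq_abs, Pi.add_apply]
    linarith
  -- `H 0` is the Gaussian mean of `h 0 - h x`, which is at most `|x|` in absolute value.
  have hH0 : |H 0| ≤ 1 := by
    have : H 0 = ∫ x, (h 0 - h x) ∂gaussianReal 0 1 := by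
      rw [integral_sub (integrable_const _) hgi]; simp [hH, hcdef]
    rw [this]
    rw [← Real.norm_eq_abs]
    refine le_trans (norm_integral_le_of_norm_le gi.abs (ae_of_all _ fun x => ?_)) integral_abs_gaussianReal_le
    simpa using hlip 0 x
  have hi : Integrable fun x => H x * gaussWeight x := by
    refine Integrable.mono' (integrable_gaussWeight.add integrable_mul_gaussWeight.abs)
      (hHc.mul continuous_gaussWeight).aestronglyMeasurable (ae_of_all _ fun x => ?_)
    have := hHl x 0
    rw [sub_zero] at this
    have h3 : |H x| ≤ |H x - H 0| + |H 0| := by simpa using abs_add_le (H x - H 0) (H 0)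
    simp only [Real.norm_eq_abs, Pi.add_apply, abs_mul, abs_of_pos (gaussWeight_pos x)]
    nlinarith [gaussWeight_pos x]
  have hz : ∫ x, H x * gaussWeight x = 0 := by
    have h2 : ∫ x, H x ∂gaussianReal 0 1 = 0 := by
      simp only [hH]
      rw [integral_sub hgi (integrable_const _)]; simp [hcdef]
    rw [integral_gaussianReal_eq_gaussWeight] at h2
    have : (√(2 * Real.pi))⁻¹ ≠ 0 := by positivity
    exact (mul_eq_zero.1 h2).resolve_left this
  -- Solution by the integrating factor. By `hz` the lower tail is minus the upper one, so for each
  -- sign of `w` the tail pointing away from the origin can be used.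
  set f : ℝ → ℝ := fun w => Real.exp (w ^ 2 / 2) * ∫ x in Set.Iic w, H x * gaussWeight x with hf
  have hfd : ∀ w, HasDerivAt f (w * f w + H w) w := by
    intro w
    have h1 : HasDerivAt (fun w => ∫ x in Set.Iic w, H x * gaussWeight x)
        (H w * gaussWeight w) w := by
      have e : (fun w => ∫ x in Set.Iic w, H x * gaussWeight x)
          = fun w => (∫ x in Set.Iic (0 : ℝ), H x * gaussWeight x)
            + ∫ x in (0 : ℝ)..w, H x * gaussWeight x := by
        ext w
        rw [← intervalIntegral.integral_Iic_sub_Iic hi.integrableOn hi.integrableOn]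
        ring
      rw [e]
      refine HasDerivAt.const_add _ ?_
      exact ((hHc.mul continuous_gaussWeight).integral_hasStrictDerivAt 0 w).hasDerivAt
    have h2 : HasDerivAt (fun w : ℝ => Real.exp (w ^ 2 / 2)) (w * Real.exp (w ^ 2 / 2)) w := by
      have : HasDerivAt (fun x : ℝ => x ^ 2 / 2) w w := by
        refine ((hasDerivAt_pow 2 w).div_const 2).congr_deriv ?_
        push_cast; ring
      exact this.exp.congr_deriv (by ring)
    refine (h2.fun_mul h1).congr_deriv ?_
    simp only [hf]
    linear_combination (H w) * exp_mul_gaussWeight w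
  have hfb : ∀ w, |f w| ≤ 6 ∧ |w * (w * f w + H w)| ≤ 7 := by
    intro w
    rcases le_or_gt 0 w with hw | hw
    · have e : f w = -(Real.exp (w ^ 2 / 2) * ∫ x in Set.Ioi w, H x * gaussWeight x) := by
        have := intervalIntegral.integral_Iic_add_Ioi (b := w) hi.integrableOn hi.integrableOn
        rw [hz] at this
        simp only [hf]
        linear_combination Real.exp (w ^ 2 / 2) * this
      obtain ⟨h1, h2⟩ := stein_tail_bound hHl hH0 hw hi
      rw [e]
      refine ⟨by rwa [abs_neg], ?_⟩
      convert h2 using 2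
      ring
    -- For `w < 0` the reflection `x ↦ -x` turns the lower tail at `w` into an upper tail at `-w`
    -- for another 1-Lipschitz function.
    · have hi' : Integrable fun x => H (-x) * gaussWeight x := by
        refine hi.comp_neg.congr (ae_of_all _ fun x => ?_)
        simp [gaussWeight]
      have e : f w = Real.exp ((-w) ^ 2 / 2) * ∫ x in Set.Ioi (-w), H (-x) * gaussWeight x := by
        have := integral_comp_neg_Ioi (-w) (fun x => H x * gaussWeight x)
        simp only [neg_neg] at this
        simp only [hf, ← this]
        simp [gaussWeight]
      obtain ⟨h1, h2⟩ := stein_tail_bound (H := fun x => H (-x)) (fun x y => by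
          have := hHl (-x) (-y)
          rwa [neg_sub_neg, abs_sub_comm y] at this) (by simpa using hH0)
        (w := -w) (by linarith) hi'
      rw [← e] at h1 h2
      refine ⟨h1, ?_⟩
      rw [← abs_neg]
      convert h2 using 2
      simp only [neg_neg]; ring
  -- The three terms of the second derivative are bounded by 6, 7 and 1, whence 14.
  refine ⟨f, fun w => w * f w + H w, fun w => f w + w * (w * f w + H w) + h' w, hfd, ?_, ?_, ?_⟩
  · intro w
    refine (((hasDerivAt_id w).fun_mul (hfd w)).fun_add ((hd w).sub_const c)).congr_deriv ?_
    simp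
  · intro w
    obtain ⟨h1, h2⟩ := hfb w
    have := abs_add_le (f w + w * (w * f w + H w)) (h' w)
    have := abs_add_le (f w) (w * (w * f w + H w))
    have := hb w
    linarith
  · intro w
    simp [hH]

/-! ### Resampling one coordinate -/

lemma abs_integral_le_of_forall {Ω : Type*} [MeasurableSpace Ω] {μ : Measure Ω}
    [IsProbabilityMeasure μ] {f : Ω → ℝ} {C : ℝ} (h : ∀ᵐ x ∂μ, |f x| ≤ C) :
    |∫ x, f x ∂μ| ≤ C := by
  simpa using norm_integral_le_of_norm_le_const (μ := μ) (f := f) h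

section Resampling

variable {E ι : Type*} [MeasurableSpace E] [Fintype ι] [DecidableEq ι]

/-- A box pulls back to a box whose `i`-th side is freed in the first factor and taken over by the
second. Averaging over one refreshed coordinate with the others frozen drives both the Stein bound
and the concentration bound. -/
lemma measurePreserving_update (μ : Measure E) [IsProbabilityMeasure μ] (i : ι) :
    MeasurePreserving (fun q : (ι → E) × E => Function.update q.1 i q.2)
      ((Measure.pi fun _ : ι => μ).prod μ) (Measure.pi fun _ : ι => μ) := by
  have hm : Measurable (fun q : (ι → E) × E => Function.update q.1 i q.2) := by
    refine measurable_pi_lambda _ fun j => ?_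
    by_cases h : j = i
    · subst h; simpa using measurable_snd
    · simpa [Function.update_of_ne h, Function.comp_def] using
        (measurable_pi_apply j).comp measurable_fst
  refine ⟨hm, (Measure.pi_eq fun s hs => ?_).symm⟩
  rw [Measure.map_apply hm (MeasurableSet.univ_pi hs)]
  have : (fun q : (ι → E) × E => Function.update q.1 i q.2) ⁻¹' Set.univ.pi s
      = (Set.univ.pi (Function.update s i Set.univ)) ×ˢ s i := by
    ext ⟨z, y⟩
    simp only [Set.mem_preimage, Set.mem_pi, Set.mem_univ, true_imp_iff, Set.mem_prod]
    constructor
    · refine fun h => ⟨fun j => ?_, by simpa using h i⟩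
      by_cases hj : j = i
      · subst hj; simp
      · simpa [Function.update_of_ne hj] using h j
    · rintro ⟨h1, h2⟩ j
      by_cases hj : j = i
      · subst hj; simpa using h2
      · simpa [Function.update_of_ne hj] using h1 j
  rw [this, Measure.prod_prod, Measure.pi_pi,
    ← Finset.mul_prod_erase Finset.univ _ (Finset.mem_univ i),
    ← Finset.mul_prod_erase Finset.univ (fun j => μ (s j)) (Finset.mem_univ i)]
  simp only [Function.update_self, measure_univ, one_mul]
  rw [mul_comm]
  congr 1
  refine Finset.prod_congr rfl fun j hj => ?_
  rw [Function.update_of_ne (Finset.ne_of_mem_erase hj)]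

lemma integrable_comp_update {μ : Measure E} [IsProbabilityMeasure μ] (i : ι) {f : (ι → E) → ℝ}
    (hf : Integrable f (Measure.pi fun _ : ι => μ)) :
    Integrable (fun q : (ι → E) × E => f (Function.update q.1 i q.2))
      ((Measure.pi fun _ : ι => μ).prod μ) :=
  (measurePreserving_update μ i).integrable_comp_of_integrable hf

lemma integral_pi_eq_integral_update {μ : Measure E} [IsProbabilityMeasure μ] (i : ι)
    {f : (ι → E) → ℝ} (hf : Integrable f (Measure.pi fun _ : ι => μ)) :
    ∫ z, f z ∂(Measure.pi fun _ : ι => μ)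
      = ∫ z, ∫ y, f (Function.update z i y) ∂μ ∂(Measure.pi fun _ : ι => μ) := by
  have h := measurePreserving_update μ i
  rw [← integral_prod _ (integrable_comp_update i hf), ← h.map_eq, integral_map]
  · rw [h.map_eq]
  · exact h.measurable.aemeasurable
  · rw [h.map_eq]; exact hf.aestronglyMeasurable

end Resampling

/-! ### A normal approximation bound for Lipschitz functions -/

/-- The standard deviation of `f` under `ν`. -/
noncomputable def stdDev {E : Type*} [MeasurableSpace E] (ν : Measure E) (f : E → ℝ) : ℝ :=
  √(∫ x, (f x - ∫ y, f y ∂ν) ^ 2 ∂ν)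

section NormalApproximation

variable {E : Type*} [MeasurableSpace E] {N : ℕ}

/-- One coordinate is resampled while the sum `c` of the others is frozen. After expanding `f` and
`f'` around `c`, the main terms cancel because `ξ` has mean zero and second moment `1 / N`. The two
remainders cost `14 * B / N` each, and there are `N` coordinates. -/
lemma stein_identity_bound {ν : Measure E} [IsProbabilityMeasure ν] {ξ : E → ℝ}
    (hξ : Measurable ξ) {B : ℝ} (hB : ∀ x, |ξ x| ≤ B) (h0 : ∫ x, ξ x ∂ν = 0)
    (h2 : ∫ x, ξ x ^ 2 ∂ν = 1 / (N : ℝ)) (hN : 0 < N) {f f' f'' : ℝ → ℝ}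
    (hf : ∀ x, HasDerivAt f (f' x) x) (hf' : ∀ x, HasDerivAt f' (f'' x) x)
    (hb : ∀ x, |f'' x| ≤ 14) :
    |∫ z, (f' (∑ i, ξ (z i)) - (∑ i, ξ (z i)) * f (∑ i, ξ (z i)))
      ∂(Measure.pi fun _ : Fin N => ν)| ≤ 28 * B := by
  have hNr : (0 : ℝ) < N := by exact_mod_cast hN
  have hfc : Continuous f := continuous_iff_continuousAt.2 fun x => (hf x).continuousAt
  have hfc' : Continuous f' := continuous_iff_continuousAt.2 fun x => (hf' x).continuousAt
  have hlip : ∀ x y, |f' x - f' y| ≤ 14 * |x - y| := by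
    intro x y
    simpa using Convex.norm_image_sub_le_of_norm_hasDerivWithin_le (f := f') (f' := f'')
      (C := 14) (s := Set.univ) (x := y) (y := x) (fun z _ => (hf' z).hasDerivWithinAt)
      (fun z _ => hb z) convex_univ trivial trivial
  -- The mean value inequality for `s ↦ f (c + s) - s * f' c` is enough; the sharp constant 7 is not
  -- needed.
  have htay : ∀ c t, |f (c + t) - f c - t * f' c| ≤ 14 * t ^ 2 := by
    intro c t
    have := Convex.norm_image_sub_le_of_norm_hasDerivWithin_le
      (f := fun s => f (c + s) - s * f' c) (f' := fun s => f' (c + s) - f' c)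
      (C := 14 * |t|) (s := Set.uIcc 0 t) (x := 0) (y := t)
      (fun z _ => by
        have h1 := (hf (c + z)).comp_const_add c z
        have h2 := ((hasDerivAt_id z).mul_const (f' c))
        exact ((h1.fun_sub h2).congr_deriv (by simp)).hasDerivWithinAt)
      (fun z hz => by
        refine (hlip _ _).trans ?_
        have : |z| ≤ |t| := by simpa using Set.abs_sub_left_of_mem_uIcc hz
        simpa using this)
      (convex_uIcc 0 t) Set.left_mem_uIcc Set.right_mem_uIcc
    simp only [Real.norm_eq_abs, add_zero, zero_mul, sub_zero] at this
    calc |f (c + t) - f c - t * f' c| = |f (c + t) - t * f' c - f c| := by ring_nf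
      _ ≤ 14 * |t| * |t| := this
      _ = 14 * t ^ 2 := by rw [mul_assoc, abs_mul_abs_self]; ring
  have hB0 : 0 ≤ B := by
    obtain ⟨x⟩ : Nonempty E := nonempty_of_isProbabilityMeasure ν
    exact (abs_nonneg _).trans (hB x)
  set T : (Fin N → E) → ℝ := fun z => ∑ i, ξ (z i) with hT
  have hTm : Measurable T :=
    Finset.measurable_sum _ fun i _ => hξ.comp (measurable_pi_apply i)
  have hTb : ∀ z, |T z| ≤ N * B := fun z => by
    refine (Finset.abs_sum_le_sum_abs _ _).trans ?_
    refine (Finset.sum_le_sum fun i _ => hB (z i)).trans ?_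
    simp
  have bdd : ∀ g : ℝ → ℝ, Continuous g → ∀ R : ℝ, ∃ K, ∀ x, |x| ≤ R → |g x| ≤ K := by
    intro g hg R
    obtain ⟨K, hK⟩ := (isCompact_Icc (a := -R) (b := R)).exists_bound_of_continuousOn
      hg.continuousOn
    exact ⟨K, fun x hx => hK x (abs_le.1 hx)⟩
  obtain ⟨K, hK⟩ := bdd f hfc (N * B)
  obtain ⟨K', hK'⟩ := bdd f' hfc' (N * B)
  have hK0 : 0 ≤ K := (abs_nonneg _).trans (hK 0 (by simpa using by positivity))
  have ib : ∀ g : (Fin N → E) → ℝ, Measurable g → (∃ C, ∀ z, |g z| ≤ C) →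
      Integrable g (Measure.pi fun _ : Fin N => ν) := fun g hg ⟨C, hC⟩ =>
    Integrable.of_bound hg.aestronglyMeasurable C (ae_of_all _ hC)
  have i1 : Integrable (fun z => f' (T z)) (Measure.pi fun _ : Fin N => ν) :=
    ib _ (hfc'.measurable.comp hTm) ⟨K', fun z => hK' _ (hTb z)⟩
  have i2 : ∀ i, Integrable (fun z => ξ (z i) * f (T z)) (Measure.pi fun _ : Fin N => ν) :=
    fun i => ib _ ((hξ.comp (measurable_pi_apply i)).mul (hfc.measurable.comp hTm))
      ⟨B * K, fun z => by
        rw [abs_mul]; exact mul_le_mul (hB _) (hK _ (hTb z)) (abs_nonneg _) hB0⟩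
  have i3 : ∀ i, Integrable (fun z => 1 / (N : ℝ) * f' (T z) - ξ (z i) * f (T z))
      (Measure.pi fun _ : Fin N => ν) := fun i => (i1.const_mul _).sub (i2 i)
  have key : ∀ i, |∫ z, (1 / (N : ℝ) * f' (T z) - ξ (z i) * f (T z))
      ∂(Measure.pi fun _ : Fin N => ν)| ≤ 1 / N * (28 * B) := by
    intro i
    rw [integral_pi_eq_integral_update i (i3 i)]
    refine abs_integral_le_of_forall (ae_of_all _ fun z => ?_)
    set c := ∑ j ∈ Finset.univ.erase i, ξ (z j) with hc
    have hTu : ∀ y, T (Function.update z i y) = c + ξ y := by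
      intro y
      simp only [hT]
      rw [← Finset.add_sum_erase _ _ (Finset.mem_univ i), Function.update_self, add_comm, hc]
      congr 1
      refine Finset.sum_congr rfl fun j hj => ?_
      rw [Function.update_of_ne (Finset.ne_of_mem_erase hj)]
    simp only [hTu, Function.update_self]
    have iξ : Integrable ξ ν := Integrable.of_bound hξ.aestronglyMeasurable B (ae_of_all _ hB)
    have iξ2 : Integrable (fun y => ξ y ^ 2) ν :=
      Integrable.of_bound (hξ.pow_const 2).aestronglyMeasurable (B ^ 2) (ae_of_all _ fun y => by
        rw [Real.norm_eq_abs, abs_pow]; exact pow_le_pow_left₀ (abs_nonneg _) (hB y) 2)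
    have hcy : ∀ y, |c + ξ y| ≤ N * B := fun y => hTu y ▸ hTb _
    have j1 : Integrable (fun y => 1 / (N : ℝ) * f' (c + ξ y) - ξ y * f (c + ξ y)) ν := by
      refine Integrable.of_bound (C := 1 / N * K' + B * K) ?_ (ae_of_all _ fun y => ?_)
      · have := hfc.measurable.comp (hξ.const_add c)
        have := hfc'.measurable.comp (hξ.const_add c)
        exact Measurable.aestronglyMeasurable (by fun_prop)
      · refine (abs_sub _ _).trans (add_le_add ?_ ?_)
        · rw [abs_mul, abs_of_pos (by positivity)]
          exact mul_le_mul_of_nonneg_left (hK' _ (hcy y)) (by positivity)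
        · rw [abs_mul]; exact mul_le_mul (hB _) (hK _ (hcy y)) (abs_nonneg _) hB0
    have j2 : Integrable (fun y => 1 / (N : ℝ) * f' c - ξ y * f c - ξ y ^ 2 * f' c) ν :=
      ((integrable_const _).sub (iξ.mul_const _)).sub (iξ2.mul_const _)
    have j0 : Integrable (fun y => 1 / (N : ℝ) * f' c - ξ y * f c) ν :=
      (integrable_const _).sub (iξ.mul_const _)
    have z2 : ∫ y, (1 / (N : ℝ) * f' c - ξ y * f c - ξ y ^ 2 * f' c) ∂ν = 0 := by
      rw [integral_sub j0 (iξ2.mul_const _),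
        integral_sub (integrable_const _) (iξ.mul_const _), integral_const,
        integral_mul_const, integral_mul_const, h0, h2]
      simp
    have e : ∫ y, (1 / (N : ℝ) * f' (c + ξ y) - ξ y * f (c + ξ y)) ∂ν
        = ∫ y, (1 / (N : ℝ) * (f' (c + ξ y) - f' c)
            - ξ y * (f (c + ξ y) - f c - ξ y * f' c)) ∂ν := by
      rw [← sub_zero (∫ y, (1 / (N : ℝ) * f' (c + ξ y) - ξ y * f (c + ξ y)) ∂ν), ← z2,
        ← integral_sub j1 j2]
      congr 1; ext y; ring
    rw [e]
    have j3 : Integrable (fun y => 1 / (N : ℝ) * (14 * B) + 14 * B * ξ y ^ 2) ν :=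
      (integrable_const _).add (iξ2.const_mul _)
    rw [← Real.norm_eq_abs]
    refine (norm_integral_le_of_norm_le j3 (ae_of_all _ fun y => ?_)).trans (le_of_eq ?_)
    · refine (abs_sub _ _).trans (add_le_add ?_ ?_)
      · rw [abs_mul, abs_of_pos (by positivity)]
        refine mul_le_mul_of_nonneg_left ?_ (by positivity)
        refine (hlip _ _).trans ?_
        simpa using hB y
      · rw [abs_mul]
        have := mul_le_mul (hB y) (htay c (ξ y)) (abs_nonneg _) hB0
        linarith
    · rw [integral_add (integrable_const _) (iξ2.const_mul _), integral_const,
        integral_const_mul, h2]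
      simp; ring
  have split : ∫ z, (f' (T z) - T z * f (T z)) ∂(Measure.pi fun _ : Fin N => ν)
      = ∑ i, ∫ z, (1 / (N : ℝ) * f' (T z) - ξ (z i) * f (T z))
          ∂(Measure.pi fun _ : Fin N => ν) := by
    rw [← integral_finsetSum _ fun i _ => i3 i]
    congr 1; ext z
    rw [Finset.sum_sub_distrib, ← Finset.sum_mul, ← Finset.sum_mul, Finset.sum_const,
      Finset.card_univ, Fintype.card_fin, nsmul_eq_mul, mul_one_div_cancel hNr.ne', one_mul]
  rw [split]
  refine (Finset.abs_sum_le_sum_abs _ _).trans ((Finset.sum_le_sum fun i _ => key i).trans ?_)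
  simp only [Finset.sum_const, Finset.card_univ, Fintype.card_fin, nsmul_eq_mul]
  rw [← mul_assoc, mul_one_div_cancel hNr.ne', one_mul]

/-- Stein's equation is solved for `h (σ * x) / σ`, which is again 1-Lipschitz. The error `28 * (2 *
M / (σ * √N))` of the standardised sum gets multiplied back by `σ`, so `σ` cancels and no lower
bound on it is needed. When `σ = 0` both integrals equal `h 0`. -/
lemma normal_approximation_of_bounded {ν : Measure E} [IsProbabilityMeasure ν] (hN : 0 < N)
    {f : E → ℝ} (hf : Measurable f) {M : ℝ} (hM : ∀ x, |f x| ≤ M) {h h' : ℝ → ℝ}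
    (hd : ∀ x, HasDerivAt h (h' x) x) (hb : ∀ x, |h' x| ≤ 1) :
    |∫ z, h (1 / √(N : ℝ) * ∑ i, (f (z i) - ∫ y, f y ∂ν)) ∂(Measure.pi fun _ : Fin N => ν)
      - ∫ x, h (stdDev ν f * x) ∂gaussianReal 0 1| ≤ 56 * M / √(N : ℝ) := by
  have hNr : (0 : ℝ) < N := by exact_mod_cast hN
  have hsN : 0 < √(N : ℝ) := Real.sqrt_pos.2 hNr
  set a := ∫ y, f y ∂ν with ha
  have hM0 : 0 ≤ M := by
    obtain ⟨x⟩ : Nonempty E := nonempty_of_isProbabilityMeasure ν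
    exact (abs_nonneg _).trans (hM x)
  have haM : |a| ≤ M := abs_integral_le_of_forall (ae_of_all _ hM)
  have hfa : ∀ x, |f x - a| ≤ 2 * M := fun x => (abs_sub _ _).trans (by linarith [hM x])
  have i2 : Integrable (fun x => (f x - a) ^ 2) ν :=
    Integrable.of_bound ((hf.sub_const a).pow_const 2).aestronglyMeasurable ((2 * M) ^ 2)
      (ae_of_all _ fun y => by
        rw [Real.norm_eq_abs, abs_pow]; exact pow_le_pow_left₀ (abs_nonneg _) (hfa y) 2)
  have hs2 : stdDev ν f ^ 2 = ∫ x, (f x - a) ^ 2 ∂ν :=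
    Real.sq_sqrt (integral_nonneg fun x => sq_nonneg _)
  have hs0 : 0 ≤ stdDev ν f := Real.sqrt_nonneg _
  rcases hs0.eq_or_lt with hs | hs
  · rw [← hs] at hs2 ⊢
    have hz : (fun x => (f x - a) ^ 2) =ᵐ[ν] 0 :=
      (integral_eq_zero_iff_of_nonneg (fun x => sq_nonneg _) i2).1 (by rw [← hs2]; norm_num)
    have hz' : ∀ᵐ z ∂(Measure.pi fun _ : Fin N => ν), ∀ i, f (z i) - a = 0 := by
      refine ae_all_iff.2 fun i => ?_
      have h1 : ∀ᵐ x ∂ν, f x - a = 0 := hz.mono fun x hx => by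
        simpa [pow_eq_zero_iff] using hx
      exact (Measure.quasiMeasurePreserving_eval (μ := fun _ : Fin N => ν) i).ae h1
    have : ∫ z, h (1 / √(N : ℝ) * ∑ i, (f (z i) - a)) ∂(Measure.pi fun _ : Fin N => ν)
        = ∫ z, h 0 ∂(Measure.pi fun _ : Fin N => ν) := by
      refine integral_congr_ae (hz'.mono fun z hz => ?_)
      simp [hz]
    rw [this]
    simp only [integral_const, probReal_univ, one_smul, zero_mul, sub_self, abs_zero]
    positivity
  · set σ := stdDev ν f with hσ
    set ξ : E → ℝ := fun x => (f x - a) / (σ * √(N : ℝ)) with hξ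
    obtain ⟨g, g', g'', h1, h2, h3, h4⟩ := exists_stein_solution
      (h := fun x => h (σ * x) / σ) (h' := fun x => h' (σ * x))
      (fun x => by
        have := ((hd (σ * x)).comp x ((hasDerivAt_id x).const_mul σ)).div_const σ
        exact this.congr_deriv (by simp [hs.ne']))
      (fun x => hb _)
    have hden : 0 < σ * √(N : ℝ) := mul_pos hs hsN
    have hfi : Integrable f ν := Integrable.of_bound hf.aestronglyMeasurable M (ae_of_all _ hM)
    have key := stein_identity_bound (N := N) (ν := ν) (ξ := ξ)
      (hf.sub_const a |>.div_const _) (B := 2 * M / (σ * √(N : ℝ)))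
      (fun x => by
        simp only [hξ]
        rw [abs_div, abs_of_pos hden]
        exact div_le_div_of_nonneg_right (hfa x) hden.le)
      (by simp only [hξ]; rw [integral_div, integral_sub hfi (integrable_const _)]; simp [ha])
      (by
        simp only [hξ, div_pow]
        rw [integral_div, ← hs2, mul_pow, Real.sq_sqrt hNr.le]
        field_simp) hN h1 h2 h3
    simp only [h4] at key
    have hT : ∀ z : Fin N → E, σ * ∑ i, ξ (z i) = 1 / √(N : ℝ) * ∑ i, (f (z i) - a) := by
      intro z
      simp only [hξ]
      rw [← Finset.sum_div]
      field_simp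
    simp only [hT] at key
    rw [integral_div] at key
    have hcont : Continuous h := continuous_iff_continuousAt.2 fun x => (hd x).continuousAt
    have hib : Integrable (fun z : Fin N → E => h (1 / √(N : ℝ) * ∑ i, (f (z i) - a)))
        (Measure.pi fun _ : Fin N => ν) := by
      obtain ⟨K, hK⟩ := (isCompact_Icc (a := -(1 / √(N : ℝ) * (N * (2 * M))))
        (b := 1 / √(N : ℝ) * (N * (2 * M)))).exists_bound_of_continuousOn hcont.continuousOn
      refine Integrable.of_bound (C := K) ?_ (ae_of_all _ fun z => hK _ (abs_le.1 ?_))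
      · exact (hcont.measurable.comp ((Finset.measurable_sum _ fun i _ =>
          (hf.comp (measurable_pi_apply i)).sub_const a).const_mul _)).aestronglyMeasurable
      · rw [abs_mul, abs_of_pos (by positivity)]
        refine mul_le_mul_of_nonneg_left ?_ (by positivity)
        refine (Finset.abs_sum_le_sum_abs _ _).trans ?_
        refine (Finset.sum_le_sum fun i _ => hfa (z i)).trans ?_
        simp
    rw [integral_sub (hib.div_const _) (integrable_const _), integral_div] at key
    simp only [integral_const, probReal_univ, one_smul, ← sub_div, abs_div, abs_of_pos hs] at key
    rw [div_le_iff₀ hs] at key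
    refine key.trans (le_of_eq ?_)
    field_simp
    ring

/-- Distance of a normalised sum of i.i.d. bounded variables to the normal law, free of any lower
bound on the variance. -/
lemma normal_approximation {ν : Measure E} [IsProbabilityMeasure ν] (hN : 0 < N)
    {f : E → ℝ} (hf : Measurable f) {M : ℝ} (hM : ∀ᵐ x ∂ν, |f x| ≤ M) {h h' : ℝ → ℝ}
    (hd : ∀ x, HasDerivAt h (h' x) x) (hb : ∀ x, |h' x| ≤ 1) :
    |∫ z, h (1 / √(N : ℝ) * ∑ i, (f (z i) - ∫ y, f y ∂ν)) ∂(Measure.pi fun _ : Fin N => ν)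
      - ∫ x, h (stdDev ν f * x) ∂gaussianReal 0 1| ≤ 56 * M / √(N : ℝ) := by
  obtain ⟨x, hx⟩ := hM.exists
  have hM0 : 0 ≤ M := (abs_nonneg _).trans hx
  -- Clipping alters `f` on a null set only and makes the bound hold everywhere.
  set g : E → ℝ := fun x => max (-M) (min (f x) M) with hg
  have hgm : Measurable g := measurable_const.max (hf.min measurable_const)
  have hgM : ∀ x, |g x| ≤ M := fun x =>
    abs_le.2 ⟨le_max_left _ _, max_le (by linarith) (min_le_right _ _)⟩
  have hfg : f =ᵐ[ν] g := hM.mono fun x hx => by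
    have := abs_le.1 hx
    simp only [hg]
    rw [min_eq_left this.2, max_eq_right this.1]
  have key := normal_approximation_of_bounded hN (ν := ν) hgm hgM hd hb
  have e1 : ∫ y, f y ∂ν = ∫ y, g y ∂ν := integral_congr_ae hfg
  have e2 : stdDev ν f = stdDev ν g := by
    unfold stdDev
    rw [e1]
    congr 1
    exact integral_congr_ae (hfg.mono fun x hx => by simp only [hx])
  have e3 : ∀ᵐ z ∂(Measure.pi fun _ : Fin N => ν), ∀ i, f (z i) = g (z i) :=
    ae_all_iff.2 fun i =>
      (Measure.quasiMeasurePreserving_eval (μ := fun _ : Fin N => ν) i).ae hfg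
  rw [e1, e2]
  convert key using 3
  exact integral_congr_ae (e3.mono fun z hz => by simp only [hz])

/-- Centred Gaussian laws are Lipschitz in their standard deviation. -/
lemma abs_integral_gaussian_scale_sub_le {h h' : ℝ → ℝ} (hd : ∀ x, HasDerivAt h (h' x) x)
    (hb : ∀ x, |h' x| ≤ 1) (s t : ℝ) :
    |∫ x, h (s * x) ∂gaussianReal 0 1 - ∫ x, h (t * x) ∂gaussianReal 0 1| ≤ |s - t| := by
  have hcont : Continuous h := continuous_iff_continuousAt.2 fun x => (hd x).continuousAt
  have hlip : ∀ x y, |h x - h y| ≤ |x - y| := by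
    intro x y
    simpa using Convex.norm_image_sub_le_of_norm_hasDerivWithin_le (f := h) (f' := h') (C := 1)
      (s := Set.univ) (x := y) (y := x) (fun z _ => (hd z).hasDerivWithinAt)
      (fun z _ => hb z) convex_univ trivial trivial
  have gi : Integrable (fun x : ℝ => x) (gaussianReal 0 1) :=
    (memLp_id_gaussianReal 1).integrable (by norm_num)
  have hgi : ∀ s : ℝ, Integrable (fun x => h (s * x)) (gaussianReal 0 1) := by
    intro s
    refine Integrable.mono' ((gi.abs.const_mul |s|).add (integrable_const |h 0|))
      (hcont.comp (continuous_const.mul continuous_id)).aestronglyMeasurable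
      (ae_of_all _ fun x => ?_)
    have := hlip (s * x) 0
    rw [sub_zero, abs_mul] at this
    have h3 : |h (s * x)| ≤ |h (s * x) - h 0| + |h 0| := by
      simpa using abs_add_le (h (s * x) - h 0) (h 0)
    simp only [Real.norm_eq_abs, Pi.add_apply]
    linarith
  rw [← integral_sub (hgi s) (hgi t)]
  rw [← Real.norm_eq_abs]
  refine (norm_integral_le_of_norm_le (gi.abs.const_mul |s - t|)
    (ae_of_all _ fun x => ?_)).trans ?_
  · rw [Real.norm_eq_abs, ← abs_mul, sub_mul]; exact hlip _ _
  · rw [integral_const_mul]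
    exact mul_le_of_le_one_right (abs_nonneg _) integral_abs_gaussianReal_le

end NormalApproximation

/-! ### Sample averages of stable functionals -/

section Stability

variable {E : Type*} [MeasurableSpace E] {N : ℕ}

lemma integrable_of_measurable_of_bound {Ω : Type*} [MeasurableSpace Ω] {P : Measure Ω}
    [IsFiniteMeasure P] {g : Ω → ℝ} (hg : Measurable g) {C : ℝ} (hC : ∀ z, |g z| ≤ C) :
    Integrable g P :=
  Integrable.of_bound hg.aestronglyMeasurable C (ae_of_all _ hC)

/-- Given the coordinates other than `j`, the factor `A` is constant and `Ψ` has mean zero. -/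
lemma integral_mul_eq_zero_of_update {μ : Measure E} [IsProbabilityMeasure μ] (j : Fin N)
    {A Ψ : (Fin N → E) → ℝ} (hA : Measurable A) (hΨ : Measurable Ψ) {K K' : ℝ}
    (hK : ∀ v, |A v| ≤ K) (hK' : ∀ v, |Ψ v| ≤ K')
    (hA' : ∀ v y, A (Function.update v j y) = A v)
    (h0 : ∀ v, ∫ y, Ψ (Function.update v j y) ∂μ = 0) :
    ∫ v, A v * Ψ v ∂(Measure.pi fun _ : Fin N => μ) = 0 := by
  have hi : Integrable (fun v => A v * Ψ v) (Measure.pi fun _ : Fin N => μ) :=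
    integrable_of_measurable_of_bound (hA.mul hΨ) (C := K * K') fun v => by
      rw [abs_mul]
      exact mul_le_mul (hK v) (hK' v) (abs_nonneg _) ((abs_nonneg _).trans (hK v))
  rw [integral_pi_eq_integral_update j hi]
  simp [hA', integral_const_mul, h0]

lemma sq_integral_le_integral_sq {Ω : Type*} [MeasurableSpace Ω] {P : Measure Ω}
    [IsProbabilityMeasure P] {g : Ω → ℝ} (hg : Measurable g) {C : ℝ} (hC : ∀ z, |g z| ≤ C) :
    (∫ z, g z ∂P) ^ 2 ≤ ∫ z, g z ^ 2 ∂P := by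
  have h := variance_nonneg g P
  have hg2 : MemLp g 2 P := MemLp.of_bound hg.aestronglyMeasurable C (ae_of_all _ hC)
  rw [variance_eq_sub hg2] at h
  simpa using h

lemma integral_sub_integral_sq_le {Ω : Type*} [MeasurableSpace Ω] {P : Measure Ω}
    [IsProbabilityMeasure P] {g : Ω → ℝ} (hg : Measurable g) :
    ∫ z, (g z - ∫ y, g y ∂P) ^ 2 ∂P ≤ ∫ z, g z ^ 2 ∂P := by
  have h := variance_le_expectation_sq (μ := P) hg.aestronglyMeasurable
  rwa [variance_eq_integral hg.aemeasurable] at h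

/-- If replacing one observation changes `F v x` by at most `ε * b v x`, then the average of
`F v` over the sample `v` is close to its mean. -/
lemma integral_abs_average_sub_le {μ : Measure E} [IsProbabilityMeasure μ] (hN : 0 < N)
    {F b : (Fin N → E) → E → ℝ} (hF : Measurable (Function.uncurry F))
    (hb : Measurable (Function.uncurry b)) {K K' ε C B V : ℝ} (hK : ∀ v x, |F v x| ≤ K)
    (hK' : ∀ v x, |b v x| ≤ K') (hb0 : ∀ v x, 0 ≤ b v x) (hε : 0 ≤ ε) (hC : 0 ≤ C)
    (h1 : ∀ v j y x, |F v x - F (Function.update v j y) x| ≤ ε * b v x)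
    (h2 : ∀ v j y x, b (Function.update v j y) x ≤ C * b v x)
    (h3 : ∀ v, ∫ x, b v x ∂μ ≤ B) (h4 : ∀ v, ∫ x, F v x ^ 2 ∂μ ≤ V) :
    ∫ v, |1 / (N : ℝ) * ∑ i, (F v (v i) - ∫ x, F v x ∂μ)| ∂(Measure.pi fun _ : Fin N => μ)
      ≤ √(V / N) + 2 * (ε * (C * B + B)) := by
  have hNr : (0 : ℝ) < N := by exact_mod_cast hN
  obtain ⟨x₀⟩ : Nonempty E := nonempty_of_isProbabilityMeasure μ
  set π := Measure.pi fun _ : Fin N => μ with hπ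
  have hFv : ∀ v, Measurable (F v) := fun v => hF.comp measurable_prodMk_left
  have hbv : ∀ v, Measurable (b v) := fun v => hb.comp measurable_prodMk_left
  have iF : ∀ v, Integrable (F v) μ := fun v => integrable_of_measurable_of_bound (hFv v) (hK v)
  have ib : ∀ v, Integrable (b v) μ := fun v => integrable_of_measurable_of_bound (hbv v) (hK' v)
  have hB : 0 ≤ B := (integral_nonneg (hb0 fun _ => x₀)).trans (h3 _)
  have hV : 0 ≤ V := (integral_nonneg fun x => sq_nonneg _).trans (h4 fun _ => x₀)
  have hK0 : 0 ≤ K := (abs_nonneg _).trans (hK (fun _ => x₀) x₀)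
  have hup : ∀ (i : Fin N) (y : E), Measurable fun v : Fin N → E => Function.update v i y :=
    fun i y => measurable_update_left
  have hFm : Measurable fun v => ∫ x, F v x ∂μ :=
    hF.stronglyMeasurable.integral_prod_right.measurable
  have hFabs : ∀ v, |∫ x, F v x ∂μ| ≤ K := fun v =>
    abs_integral_le_of_forall (ae_of_all _ (hK v))
  -- In the first argument of `F` the observation `i` is replaced by a fixed point, so `v i` is
  -- fresh for the functional and `Φ i` is centred given the other observations.
  set Φ : Fin N → (Fin N → E) → ℝ := fun i v =>
    F (Function.update v i x₀) (v i) - ∫ x, F (Function.update v i x₀) x ∂μ with hΦ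
  have hΦm : ∀ i, Measurable (Φ i) := fun i =>
    (hF.comp ((hup i x₀).prodMk (measurable_pi_apply i))).sub (hFm.comp (hup i x₀))
  have hΦb : ∀ i v, |Φ i v| ≤ 2 * K := fun i v => by
    have e1 := hK (Function.update v i x₀) (v i)
    have e2 := hFabs (Function.update v i x₀)
    exact (abs_sub _ _).trans (by linarith)
  have hΦu : ∀ i v y, Φ i (Function.update v i y)
      = F (Function.update v i x₀) y - ∫ x, F (Function.update v i x₀) x ∂μ := by
    intro i v y; simp [hΦ]
  have hΦ0 : ∀ i v, ∫ y, Φ i (Function.update v i y) ∂μ = 0 := by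
    intro i v
    simp only [hΦu]
    rw [integral_sub (iF _) (integrable_const _)]; simp
  -- change of the mean
  have hmean : ∀ v j y, |∫ x, F v x ∂μ - ∫ x, F (Function.update v j y) x ∂μ| ≤ ε * B := by
    intro v j y
    rw [← integral_sub (iF _) (iF _), ← Real.norm_eq_abs]
    refine (norm_integral_le_of_norm_le ((ib v).const_mul ε) (ae_of_all _ (h1 v j y))).trans ?_
    rw [integral_const_mul]
    exact mul_le_mul_of_nonneg_left (h3 v) hε
  have hb2 : ∀ v j y x, b v x ≤ C * b (Function.update v j y) x := by
    intro v j y x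
    have := h2 (Function.update v j y) j (v j) x
    simpa using this
  -- off-diagonal terms
  have cross : ∀ i j, i ≠ j → ∫ v, Φ i v * Φ j v ∂π ≤ (ε * (C * B + B)) ^ 2 := by
    intro i j hij
    -- Freezing `v j` in `Φ i`, or `v i` in `Φ j`, or both, produces products of mean zero. Hence `Φ
    -- i * Φ j` has the same integral as a product of two increments, each of order `ε`.
    set Φij : (Fin N → E) → ℝ := fun v => Φ i (Function.update v j x₀) with hΦij
    set Φji : (Fin N → E) → ℝ := fun v => Φ j (Function.update v i x₀) with hΦji
    have mij : Measurable Φij := (hΦm i).comp (hup j x₀)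
    have mji : Measurable Φji := (hΦm j).comp (hup i x₀)
    have bij : ∀ v, |Φij v| ≤ 2 * K := fun v => hΦb i _
    have bji : ∀ v, |Φji v| ≤ 2 * K := fun v => hΦb j _
    have z1 : ∫ v, Φij v * Φ j v ∂π = 0 :=
      integral_mul_eq_zero_of_update j mij (hΦm j) bij (hΦb j) (fun v y => by simp [hΦij])
        (hΦ0 j)
    have z2 : ∫ v, Φji v * Φ i v ∂π = 0 :=
      integral_mul_eq_zero_of_update i mji (hΦm i) bji (hΦb i) (fun v y => by simp [hΦji])
        (hΦ0 i)
    have z3 : ∫ v, Φij v * Φji v ∂π = 0 :=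
      integral_mul_eq_zero_of_update j mij mji bij bji (fun v y => by simp [hΦij])
        (fun v => by
          simp only [hΦji]
          simp_rw [fun y => Function.update_comm hij.symm y x₀ v]
          exact hΦ0 j _)
    have ip : ∀ {A A' : (Fin N → E) → ℝ}, Measurable A → Measurable A' → (∀ v, |A v| ≤ 2 * K) →
        (∀ v, |A' v| ≤ 2 * K) → Integrable (fun v => A v * A' v) π :=
      fun hA hA' ha ha' => integrable_of_measurable_of_bound (hA.mul hA') (C := 2 * K * (2 * K))
        fun v => by
          rw [abs_mul]; exact mul_le_mul (ha v) (ha' v) (abs_nonneg _) (by positivity)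
    have i0 := ip (hΦm i) (hΦm j) (hΦb i) (hΦb j)
    have i1 := ip mij (hΦm j) bij (hΦb j)
    have i2 := ip mji (hΦm i) bji (hΦb i)
    have i3 := ip mij mji bij bji
    have e : ∫ v, Φ i v * Φ j v ∂π = ∫ v, (Φ i v - Φij v) * (Φ j v - Φji v) ∂π := by
      have : ∀ v, (Φ i v - Φij v) * (Φ j v - Φji v)
          = Φ i v * Φ j v - Φij v * Φ j v - Φji v * Φ i v + Φij v * Φji v := fun v => by ring
      simp_rw [this]
      have i4 : Integrable (fun v => Φ i v * Φ j v - Φij v * Φ j v) π := i0.sub i1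
      have i5 : Integrable (fun v => Φ i v * Φ j v - Φij v * Φ j v - Φji v * Φ i v) π :=
        i4.sub i2
      rw [integral_add i5 i3, integral_sub i4 i2, integral_sub i0 i1, z1, z2, z3]
      ring
    rw [e]
    -- Through `h2` both increments are bounded in terms of the same doubly frozen sample. It
    -- depends on neither `v i` nor `v j`, so the two bounds can be integrated one coordinate at a
    -- time.
    set w : (Fin N → E) → (Fin N → E) := fun v =>
      Function.update (Function.update v i x₀) j x₀ with hw
    have hwm : Measurable w := (hup j x₀).comp (hup i x₀)
    have hwi : ∀ v y, w (Function.update v i y) = w v := fun v y => by simp [hw]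
    have hwj : ∀ v y, w (Function.update v j y) = w v := fun v y => by
      simp only [hw]
      rw [Function.update_comm hij.symm, Function.update_idem]
    have d1 : ∀ v, |Φ i v - Φij v| ≤ ε * (C * b (w v) (v i) + B) := by
      intro v
      have e1 : Φij v = F (w v) (v i) - ∫ x, F (w v) x ∂μ := by
        simp only [hΦij, hΦ, hw]
        rw [Function.update_of_ne hij, Function.update_comm hij.symm]
      have e2 := h1 (Function.update v i x₀) j x₀ (v i)
      have e3 := hmean (Function.update v i x₀) j x₀
      have e4 := hb2 (Function.update v i x₀) j x₀ (v i)
      rw [e1]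
      simp only [hΦ]
      calc _ = |(F (Function.update v i x₀) (v i) - F (w v) (v i))
            - (∫ x, F (Function.update v i x₀) x ∂μ - ∫ x, F (w v) x ∂μ)| := by ring_nf
        _ ≤ _ := abs_sub _ _
        _ ≤ ε * b (Function.update v i x₀) (v i) + ε * B := add_le_add e2 e3
        _ ≤ _ := by rw [mul_add]; gcongr
    have d2 : ∀ v, |Φ j v - Φji v| ≤ ε * (C * b (w v) (v j) + B) := by
      intro v
      have hw' : w v = Function.update (Function.update v j x₀) i x₀ := by
        simp only [hw]; rw [Function.update_comm hij.symm]
      have e1 : Φji v = F (w v) (v j) - ∫ x, F (w v) x ∂μ := by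
        simp only [hΦji, hΦ, hw]
        rw [Function.update_of_ne hij.symm]
      have e2 := h1 (Function.update v j x₀) i x₀ (v j)
      have e3 := hmean (Function.update v j x₀) i x₀
      have e4 := hb2 (Function.update v j x₀) i x₀ (v j)
      rw [← hw'] at e2 e3 e4
      rw [e1]
      simp only [hΦ]
      calc _ = |(F (Function.update v j x₀) (v j) - F (w v) (v j))
            - (∫ x, F (Function.update v j x₀) x ∂μ - ∫ x, F (w v) x ∂μ)| := by ring_nf
        _ ≤ _ := abs_sub _ _
        _ ≤ ε * b (Function.update v j x₀) (v j) + ε * B := add_le_add e2 e3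
        _ ≤ _ := by rw [mul_add]; gcongr
    set β : Fin N → (Fin N → E) → ℝ := fun k v => C * b (w v) (v k) + B with hβ
    have hβm : ∀ k, Measurable (β k) := fun k =>
      ((hb.comp (hwm.prodMk (measurable_pi_apply k))).const_mul C).add_const B
    have hβ0 : ∀ k v, 0 ≤ β k v := fun k v => by
      have := hb0 (w v) (v k); simp only [hβ]; positivity
    have hβb : ∀ k v, |β k v| ≤ C * K' + B := fun k v => by
      rw [abs_of_nonneg (hβ0 k v)]
      simp only [hβ]
      gcongr
      exact (le_abs_self _).trans (hK' _ _)
    have hK'0 : 0 ≤ C * K' + B := (abs_nonneg _).trans (hβb i fun _ => x₀)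
    have hint : ∀ v, ∫ y, (C * b (w v) y + B) ∂μ ≤ C * B + B := fun v => by
      rw [integral_add ((ib _).const_mul C) (integrable_const _), integral_const_mul]
      simp only [integral_const, probReal_univ, one_smul]
      gcongr
      exact h3 _
    have iβ : Integrable (fun v => β i v * β j v) π :=
      integrable_of_measurable_of_bound ((hβm i).mul (hβm j))
        (C := (C * K' + B) * (C * K' + B)) fun v => by
          rw [abs_mul]; exact mul_le_mul (hβb i v) (hβb j v) (abs_nonneg _) hK'0
    have iβj : Integrable (β j) π := integrable_of_measurable_of_bound (hβm j) (hβb j)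
    have s1 : ∫ v, β j v ∂π ≤ C * B + B := by
      rw [integral_pi_eq_integral_update j iβj]
      have : ∀ v, ∫ y, β j (Function.update v j y) ∂μ ≤ C * B + B := fun v => by
        simp only [hβ, hwj, Function.update_self]
        exact hint v
      refine (integral_mono_of_nonneg (ae_of_all _ fun v => integral_nonneg fun y => hβ0 j _)
        (integrable_const _) (ae_of_all _ this)).trans (by simp)
    have s2 : ∫ v, β i v * β j v ∂π ≤ ∫ v, (C * B + B) * β j v ∂π := by
      rw [integral_pi_eq_integral_update i iβ]
      have : ∀ v, ∫ y, β i (Function.update v i y) * β j (Function.update v i y) ∂μ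
          ≤ (C * B + B) * β j v := fun v => by
        simp only [hβ, hwi, Function.update_self, Function.update_of_ne hij.symm]
        rw [integral_mul_const]
        exact mul_le_mul_of_nonneg_right (hint v) (hβ0 j v)
      exact integral_mono_of_nonneg (ae_of_all _ fun v => integral_nonneg fun y =>
        mul_nonneg (hβ0 i _) (hβ0 j _)) (iβj.const_mul _) (ae_of_all _ this)
    have s3 : ∫ v, (Φ i v - Φij v) * (Φ j v - Φji v) ∂π ≤ ∫ v, ε ^ 2 * (β i v * β j v) ∂π := by
      have i6 : Integrable (fun v => (Φ i v - Φij v) * (Φ j v - Φji v)) π :=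
        integrable_of_measurable_of_bound (((hΦm i).sub mij).mul ((hΦm j).sub mji))
          (C := 4 * K * (4 * K)) fun v => by
            rw [abs_mul]
            refine mul_le_mul ((abs_sub _ _).trans ?_) ((abs_sub _ _).trans ?_) (abs_nonneg _)
              (by positivity)
            · linarith [hΦb i v, bij v]
            · linarith [hΦb j v, bji v]
      refine integral_mono i6 (iβ.const_mul _) fun v => ?_
      refine (le_abs_self _).trans ?_
      rw [abs_mul]
      refine (mul_le_mul (d1 v) (d2 v) (abs_nonneg _) (mul_nonneg hε (hβ0 i v))).trans ?_
      simp only [hβ]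
      apply le_of_eq; ring
    refine s3.trans ?_
    rw [integral_const_mul]
    rw [integral_const_mul] at s2
    have hBB : 0 ≤ C * B + B := by positivity
    calc _ ≤ ε ^ 2 * ((C * B + B) * (C * B + B)) := by
          gcongr
          exact s2.trans (mul_le_mul_of_nonneg_left s1 hBB)
      _ = _ := by ring
  have diag : ∀ i, ∫ v, Φ i v * Φ i v ∂π ≤ V := by
    intro i
    have ii : Integrable (fun v => Φ i v * Φ i v) π :=
      integrable_of_measurable_of_bound ((hΦm i).mul (hΦm i)) (C := 2 * K * (2 * K)) fun v => by
        rw [abs_mul]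
        exact mul_le_mul (hΦb i v) (hΦb i v) (abs_nonneg _) (by positivity)
    rw [integral_pi_eq_integral_update i ii]
    simp only [hΦu]
    have : ∀ v, ∫ y, (F (Function.update v i x₀) y - ∫ x, F (Function.update v i x₀) x ∂μ)
        * (F (Function.update v i x₀) y - ∫ x, F (Function.update v i x₀) x ∂μ) ∂μ ≤ V := by
      intro v
      simp_rw [← sq]
      exact (integral_sub_integral_sq_le (hFv _)).trans (h4 _)
    refine (integral_mono_of_nonneg (ae_of_all _ fun v => integral_nonneg fun y =>
      mul_self_nonneg _) (integrable_const _) (ae_of_all _ this)).trans (by simp)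
  -- Second moment bound: `N` diagonal terms of size `V` and fewer than `N ^ 2` off-diagonal ones,
  -- all divided by `N ^ 2`; then `√(a + b ^ 2) ≤ √a + b`.
  have main : ∫ v, |1 / (N : ℝ) * ∑ i, Φ i v| ∂π ≤ √(V / N) + ε * (C * B + B) := by
    have hm : Measurable fun v => 1 / (N : ℝ) * ∑ i, Φ i v :=
      (Finset.measurable_sum _ fun i _ => hΦm i).const_mul _
    have hbd : ∀ v, |(1 / (N : ℝ) * ∑ i, Φ i v)| ≤ 2 * K := fun v => by
      rw [abs_mul, abs_of_pos (by positivity)]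
      have : |∑ i, Φ i v| ≤ N * (2 * K) :=
        (Finset.abs_sum_le_sum_abs _ _).trans
          ((Finset.sum_le_sum fun i _ => hΦb i v).trans (by simp))
      rw [one_div, inv_mul_le_iff₀ hNr]
      exact this
    have q := sq_integral_le_integral_sq (P := π) hm.abs (C := 2 * K) (by simpa using hbd)
    simp only [sq_abs] at q
    have q2 : ∫ v, (1 / (N : ℝ) * ∑ i, Φ i v) ^ 2 ∂π ≤ V / N + (ε * (C * B + B)) ^ 2 := by
      have e : ∀ v, (1 / (N : ℝ) * ∑ i, Φ i v) ^ 2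
          = 1 / (N : ℝ) ^ 2 * ∑ i, ∑ j, Φ i v * Φ j v := fun v => by
        rw [mul_pow, sq (∑ i, Φ i v), Finset.sum_mul_sum]; ring
      have ii : ∀ i j, Integrable (fun v => Φ i v * Φ j v) π := fun i j =>
        integrable_of_measurable_of_bound ((hΦm i).mul (hΦm j)) (C := 2 * K * (2 * K)) fun v => by
          rw [abs_mul]
          exact mul_le_mul (hΦb i v) (hΦb j v) (abs_nonneg _) (by positivity)
      simp_rw [e]
      rw [integral_const_mul, integral_finsetSum _ fun i _ => integrable_finsetSum _
        fun j _ => ii i j]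
      simp_rw [integral_finsetSum _ fun j _ => ii _ j]
      have : ∀ i, ∑ j, ∫ v, Φ i v * Φ j v ∂π ≤ V + N * (ε * (C * B + B)) ^ 2 := by
        intro i
        rw [← Finset.add_sum_erase _ _ (Finset.mem_univ i)]
        refine add_le_add (diag i) ?_
        refine (Finset.sum_le_sum fun j hj => cross i j (Finset.ne_of_mem_erase hj).symm).trans ?_
        rw [Finset.sum_const, nsmul_eq_mul]
        refine mul_le_mul_of_nonneg_right ?_ (sq_nonneg _)
        exact_mod_cast (Finset.card_erase_le).trans (by simp)
      refine (mul_le_mul_of_nonneg_left (Finset.sum_le_sum fun i _ => this i)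
        (by positivity)).trans (le_of_eq ?_)
      simp only [Finset.sum_const, Finset.card_univ, Fintype.card_fin, nsmul_eq_mul]
      field_simp
    have hBB : 0 ≤ ε * (C * B + B) := by positivity
    refine abs_le_of_sq_le_sq' ?_ (by positivity) |>.2
    refine (q.trans q2).trans ?_
    have := Real.sq_sqrt (show 0 ≤ V / N by positivity)
    nlinarith [Real.sqrt_nonneg (V / N), mul_nonneg (Real.sqrt_nonneg (V / N)) hBB]
  -- Undoing the freezing costs `ε * (C * B + B)` once more, hence the factor 2 in the conclusion.
  have rest : ∀ i, ∫ v, |F v (v i) - ∫ x, F v x ∂μ - Φ i v| ∂π ≤ ε * (C * B + B) := by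
    intro i
    have hb' : ∀ v, |F v (v i) - ∫ x, F v x ∂μ - Φ i v|
        ≤ ε * (C * b (Function.update v i x₀) (v i) + B) := by
      intro v
      have e2 := h1 v i x₀ (v i)
      have e3 := hmean v i x₀
      have e4 := hb2 v i x₀ (v i)
      simp only [hΦ]
      calc _ = |(F v (v i) - F (Function.update v i x₀) (v i))
            - (∫ x, F v x ∂μ - ∫ x, F (Function.update v i x₀) x ∂μ)| := by ring_nf
        _ ≤ _ := abs_sub _ _
        _ ≤ ε * b v (v i) + ε * B := add_le_add e2 e3
        _ ≤ _ := by rw [mul_add]; gcongr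
    have hm : Measurable fun v => C * b (Function.update v i x₀) (v i) + B :=
      ((hb.comp ((hup i x₀).prodMk (measurable_pi_apply i))).const_mul C).add_const B
    have h0' : ∀ v : Fin N → E, 0 ≤ C * b (Function.update v i x₀) (v i) + B := fun v => by
      have := hb0 (Function.update v i x₀) (v i); positivity
    have ii : Integrable (fun v => C * b (Function.update v i x₀) (v i) + B) π :=
      integrable_of_measurable_of_bound hm (C := C * K' + B) fun v => by
        rw [abs_of_nonneg (h0' v)]
        gcongr
        exact (le_abs_self _).trans (hK' _ _)
    refine (integral_mono_of_nonneg (ae_of_all _ fun v => abs_nonneg _) (ii.const_mul ε)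
      (ae_of_all _ hb')).trans ?_
    rw [integral_const_mul, integral_pi_eq_integral_update i ii]
    refine mul_le_mul_of_nonneg_left ?_ hε
    have : ∀ v : Fin N → E, ∫ y, (C * b (Function.update (Function.update v i y) i x₀)
        (Function.update v i y i) + B) ∂μ ≤ C * B + B := fun v => by
      simp only [Function.update_idem, Function.update_self]
      rw [integral_add ((ib _).const_mul C) (integrable_const _), integral_const_mul]
      simp only [integral_const, probReal_univ, one_smul]
      gcongr
      exact h3 _
    refine (integral_mono_of_nonneg (ae_of_all _ fun v => integral_nonneg fun y => h0' _)
      (integrable_const _) (ae_of_all _ this)).trans (by simp)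
  have hFi : ∀ i, Measurable fun v : Fin N → E => F v (v i) := fun i =>
    hF.comp (measurable_id.prodMk (measurable_pi_apply i))
  have iA : Integrable (fun v => |1 / (N : ℝ) * ∑ i, Φ i v|) π := by
    refine integrable_of_measurable_of_bound
      ((Finset.measurable_sum _ fun i _ => hΦm i).const_mul _).abs (C := 1 / N * (N * (2 * K)))
      fun v => ?_
    rw [abs_abs, abs_mul, abs_of_pos (by positivity)]
    gcongr
    exact (Finset.abs_sum_le_sum_abs _ _).trans
          ((Finset.sum_le_sum fun i _ => hΦb i v).trans (by simp))
  have iR : ∀ i, Integrable (fun v => |F v (v i) - ∫ x, F v x ∂μ - Φ i v|) π := fun i =>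
    integrable_of_measurable_of_bound (((hFi i).sub hFm).sub (hΦm i)).abs (C := 4 * K) fun v => by
      rw [abs_abs]
      refine (abs_sub _ _).trans ?_
      have := abs_sub (F v (v i)) (∫ x, F v x ∂μ)
      linarith [hK v (v i), hFabs v, hΦb i v]
  have iS : Integrable (fun v => 1 / (N : ℝ) * ∑ i, |F v (v i) - ∫ x, F v x ∂μ - Φ i v|) π :=
    (integrable_finsetSum _ fun i _ => iR i).const_mul _
  calc _ ≤ ∫ v, (|1 / (N : ℝ) * ∑ i, Φ i v|
        + 1 / (N : ℝ) * ∑ i, |F v (v i) - ∫ x, F v x ∂μ - Φ i v|) ∂π := by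
        refine integral_mono_of_nonneg (ae_of_all _ fun v => abs_nonneg _) (iA.add iS)
          (ae_of_all _ fun v => ?_)
        have : 1 / (N : ℝ) * ∑ i, (F v (v i) - ∫ x, F v x ∂μ)
            = 1 / (N : ℝ) * ∑ i, Φ i v
              + 1 / (N : ℝ) * ∑ i, (F v (v i) - ∫ x, F v x ∂μ - Φ i v) := by
          rw [← mul_add, ← Finset.sum_add_distrib]
          congr 1
          exact Finset.sum_congr rfl fun i _ => by ring
        simp only
        rw [this]
        refine (abs_add_le _ _).trans (add_le_add le_rfl ?_)
        rw [abs_mul, abs_of_pos (by positivity : 0 < 1 / (N : ℝ))]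
        gcongr
        exact Finset.abs_sum_le_sum_abs _ _
    _ = ∫ v, |1 / (N : ℝ) * ∑ i, Φ i v| ∂π
        + 1 / (N : ℝ) * ∑ i, ∫ v, |F v (v i) - ∫ x, F v x ∂μ - Φ i v| ∂π := by
        rw [integral_add iA iS, integral_const_mul, integral_finsetSum _ fun i _ => iR i]
    _ ≤ (√(V / N) + ε * (C * B + B)) + 1 / (N : ℝ) * ∑ _i : Fin N, ε * (C * B + B) := by
        gcongr with i _
        exact rest i
    _ = _ := by
        simp only [Finset.sum_const, Finset.card_univ, Fintype.card_fin, nsmul_eq_mul]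
        field_simp
        ring

end Stability

/-! ### Sample standard deviations of stable functionals -/

/-- The standard deviation of `f` on the sample `v`. -/
noncomputable def sampleStdDev {E : Type*} {N : ℕ} (f : E → ℝ) (v : Fin N → E) : ℝ :=
  √(1 / (N : ℝ) * ∑ i, (f (v i) - 1 / (N : ℝ) * ∑ j, f (v j)) ^ 2)

lemma sub_le_of_sq_sub_sq_le {s t c : ℝ} (ht : 0 ≤ t) (hc : 0 ≤ c)
    (h : s ^ 2 - t ^ 2 ≤ c * (s + t)) : s - t ≤ c := by
  by_contra! hlt
  nlinarith [mul_pos (show 0 < s + t by nlinarith) (sub_pos.2 hlt)]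

/-- If `t + s` is at least half of `s + η`, the quotient is at least `|t - s| / 2` in absolute
value. Otherwise `s < η`, and `|t - s| ≤ t + s < η`. In this form an error on the variance,
normalised by `s + η`, is an error on the standard deviation without loss of a square root. -/
lemma abs_sub_le_of_sq {s t η : ℝ} (hs : 0 ≤ s) (ht : 0 ≤ t) (hη : 0 < η) :
    |t - s| ≤ η + 2 * |(t ^ 2 - s ^ 2) / (s + η)| := by
  have hd : 0 < s + η := by linarith
  rw [abs_div, abs_of_pos hd]
  by_cases h : (s + η) / 2 ≤ t + s
  · have e : |t ^ 2 - s ^ 2| = |t - s| * (t + s) := by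
      rw [← abs_of_nonneg (add_nonneg ht hs), ← abs_mul]; congr 1; ring
    have : |t - s| ≤ 2 * (|t ^ 2 - s ^ 2| / (s + η)) := by
      rw [e, mul_div_assoc', le_div_iff₀ hd]
      nlinarith [abs_nonneg (t - s)]
    linarith
  · push Not at h
    have : 0 ≤ |t ^ 2 - s ^ 2| / (s + η) := by positivity
    have : |t - s| ≤ η := abs_le.2 ⟨by linarith, by linarith⟩
    linarith

/-- Effect of a perturbation on a normalised square. -/
lemma normalized_square_perturbation {H H' s s' ε : ℝ} (hε : 0 < ε) (hs : 0 ≤ s) (hs' : 0 ≤ s')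
    (hH : |H - H'| ≤ 2 * ε) (hss : |s - s'| ≤ 2 * ε) :
    |H ^ 2 / (s + 4 * ε) - H' ^ 2 / (s' + 4 * ε)| ≤ 8 * ε * (1 + (H / (s + 4 * ε)) ^ 2) ∧
    1 + (H' / (s' + 4 * ε)) ^ 2 ≤ 8 * (1 + (H / (s + 4 * ε)) ^ 2) := by
  have hD : 0 < s + 4 * ε := by linarith
  have hD' : 0 < s' + 4 * ε := by linarith
  -- The shift `4 * ε` ensures that a move of `s` by `2 * ε` changes the denominator by at most a
  -- factor 2.
  set D := s + 4 * ε with hDd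
  set D' := s' + 4 * ε with hDd'
  obtain ⟨a, ha⟩ : ∃ a, a = |H| / D := ⟨_, rfl⟩
  obtain ⟨a', ha'⟩ : ∃ a', a' = |H'| / D' := ⟨_, rfl⟩
  have ha0 : 0 ≤ a := ha ▸ by positivity
  have ha0' : 0 ≤ a' := ha' ▸ by positivity
  have hHa : |H| = a * D := by rw [ha]; field_simp
  have hHa' : |H'| = a' * D' := by rw [ha']; field_simp
  have hHH : |H'| ≤ |H| + 2 * ε := by
    have := abs_sub_abs_le_abs_sub H' H
    rw [abs_sub_comm] at this
    linarith
  have hss' := abs_le.1 hss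
  have hDD : D ≤ 2 * D' := by linarith
  have hDε : 4 * ε ≤ D := by linarith
  have hDε' : 4 * ε ≤ D' := by linarith
  have q1 : a' ≤ 2 * a + 1 := by
    by_contra! hlt
    nlinarith
  have e1 : (H / D) ^ 2 = a ^ 2 := by rw [ha, div_pow, div_pow, sq_abs]
  have e2 : (H' / D') ^ 2 = a' ^ 2 := by rw [ha', div_pow, div_pow, sq_abs]
  rw [e1, e2]
  constructor
  · have e3 : H ^ 2 / D - H' ^ 2 / D'
        = (H - H') * ((H + H') / D) + a' * (|H'| / D) * (D' - D) := by
      rw [ha']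
      field_simp
      rw [sq_abs]; ring
    have e4 : |H'| / D ≤ a + 1 / 2 := by
      rw [div_le_iff₀ hD, add_mul, ← hHa]; linarith
    have e5 : |(H + H') / D| ≤ 2 * a + 1 / 2 := by
      rw [abs_div, abs_of_pos hD]
      have : |H + H'| / D ≤ |H| / D + |H'| / D := by
        rw [← add_div]; gcongr; exact abs_add_le _ _
      rw [← ha] at this
      linarith
    have e6 : |D' - D| ≤ 2 * ε := by
      rw [abs_sub_comm, hDd, hDd']
      convert hss using 2
      ring
    rw [e3]
    refine (abs_add_le _ _).trans ?_
    rw [abs_mul, abs_mul, abs_mul, abs_of_nonneg ha0', abs_of_nonneg (by positivity :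
      0 ≤ |H'| / D)]
    have t1 : |H - H'| * |(H + H') / D| ≤ 2 * ε * (2 * a + 1 / 2) :=
      mul_le_mul hH e5 (abs_nonneg _) (by positivity)
    have t2 : a' * (|H'| / D) * |D' - D| ≤ (2 * a + 1) * (a + 1 / 2) * (2 * ε) := by
      gcongr
    nlinarith [mul_nonneg hε.le (sq_nonneg (a - 1))]
  · nlinarith [sq_nonneg (a - 1)]

section

variable {E : Type*} [MeasurableSpace E] {N : ℕ}

lemma measurable_stdDev {S : Type*} [MeasurableSpace S] {μ : Measure E} [SFinite μ]
    {G : S → E → ℝ} (hG : Measurable (Function.uncurry G)) :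
    Measurable fun v => stdDev μ (G v) := by
  have hm : Measurable fun v => ∫ x, G v x ∂μ :=
    hG.stronglyMeasurable.integral_prod_right.measurable
  have : Measurable (Function.uncurry fun v x => (G v x - ∫ y, G v y ∂μ) ^ 2) :=
    (hG.sub (hm.comp measurable_fst)).pow_const 2
  exact this.stronglyMeasurable.integral_prod_right.measurable.sqrt

lemma measurable_sampleStdDev {S : Type*} [MeasurableSpace S] {G : S → E → ℝ}
    (hG : Measurable (Function.uncurry G)) :
    Measurable fun q : S × (Fin N → E) => sampleStdDev (G q.1) q.2 := by
  have hi : ∀ i, Measurable fun q : S × (Fin N → E) => G q.1 (q.2 i) := fun i =>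
    hG.comp (measurable_fst.prodMk ((measurable_pi_apply i).comp measurable_snd))
  exact ((Finset.measurable_sum _ fun i _ => ((hi i).sub
    ((Finset.measurable_sum _ fun j _ => hi j).const_mul _)).pow_const 2).const_mul _).sqrt

lemma sq_stdDev (μ : Measure E) (f : E → ℝ) :
    stdDev μ f ^ 2 = ∫ x, (f x - ∫ y, f y ∂μ) ^ 2 ∂μ :=
  Real.sq_sqrt (integral_nonneg fun x => sq_nonneg _)

lemma integral_abs_sub_le_stdDev {μ : Measure E} [IsProbabilityMeasure μ] {f : E → ℝ}
    (hf : Measurable f) {M : ℝ} (hM : ∀ x, |f x| ≤ M) :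
    ∫ x, |f x - ∫ y, f y ∂μ| ∂μ ≤ stdDev μ f := by
  refine Real.le_sqrt_of_sq_le ?_
  have := sq_integral_le_integral_sq (P := μ) (hf.sub_const (∫ y, f y ∂μ)).abs
    (C := M + |∫ y, f y ∂μ|) (fun x => by
      rw [abs_abs]; exact (abs_sub _ _).trans (by linarith [hM x]))
  simpa only [sq_abs] using this

/-- The difference of the variances is at most `2 * ε` times the sum of the mean absolute
deviations, hence at most `2 * ε` times the sum of the standard deviations, which is then divided
out. -/
lemma stdDev_sub_le {μ : Measure E} [IsProbabilityMeasure μ] {f g : E → ℝ}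
    (hf : Measurable f) (hg : Measurable g) {M ε : ℝ} (hM : ∀ x, |f x| ≤ M)
    (hM' : ∀ x, |g x| ≤ M) (hε : ∀ x, |f x - g x| ≤ ε) :
    stdDev μ f - stdDev μ g ≤ 2 * ε ∧
      ∀ x, |(f x - ∫ y, f y ∂μ) - (g x - ∫ y, g y ∂μ)| ≤ 2 * ε := by
  have hfi := integrable_of_measurable_of_bound (P := μ) hf hM
  have hgi := integrable_of_measurable_of_bound (P := μ) hg hM'
  have hmean : |∫ y, f y ∂μ - ∫ y, g y ∂μ| ≤ ε := by
    rw [← integral_sub hfi hgi]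
    exact abs_integral_le_of_forall (ae_of_all _ hε)
  have hH : ∀ x, |(f x - ∫ y, f y ∂μ) - (g x - ∫ y, g y ∂μ)| ≤ 2 * ε := fun x => by
    rw [sub_sub_sub_comm]
    exact (abs_sub _ _).trans (by linarith [hε x])
  refine ⟨?_, hH⟩
  have hε0 : 0 ≤ ε := (abs_nonneg _).trans hmean
  refine sub_le_of_sq_sub_sq_le (Real.sqrt_nonneg _) (by positivity) ?_
  rw [sq_stdDev, sq_stdDev]
  have hM0 : 0 ≤ M := by
    obtain ⟨x⟩ : Nonempty E := nonempty_of_isProbabilityMeasure μ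
    exact (abs_nonneg _).trans (hM x)
  have i1 : ∀ {k : E → ℝ}, Measurable k → (∀ x, |k x| ≤ M) →
      Integrable (fun x => |k x - ∫ y, k y ∂μ|) μ ∧
      Integrable (fun x => (k x - ∫ y, k y ∂μ) ^ 2) μ := fun {k} hk hkM => by
    have hb : ∀ x, |k x - ∫ y, k y ∂μ| ≤ 2 * M := fun x =>
      (abs_sub _ _).trans (by
        have := abs_integral_le_of_forall (μ := μ) (ae_of_all _ hkM)
        linarith [hkM x])
    exact ⟨integrable_of_measurable_of_bound (hk.sub_const _).abs (C := 2 * M) (by simpa using hb),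
      integrable_of_measurable_of_bound ((hk.sub_const _).pow_const 2) (C := (2 * M) ^ 2)
        fun x => by rw [abs_pow]; exact pow_le_pow_left₀ (abs_nonneg _) (hb x) 2⟩
  rw [← integral_sub (i1 hf hM).2 (i1 hg hM').2]
  have : ∫ x, ((f x - ∫ y, f y ∂μ) ^ 2 - (g x - ∫ y, g y ∂μ) ^ 2) ∂μ
      ≤ ∫ x, 2 * ε * (|f x - ∫ y, f y ∂μ| + |g x - ∫ y, g y ∂μ|) ∂μ := by
    refine integral_mono ((i1 hf hM).2.sub (i1 hg hM').2)
      (((i1 hf hM).1.add (i1 hg hM').1).const_mul _) fun x => ?_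
    rw [sq_sub_sq]
    refine (le_abs_self _).trans ?_
    rw [abs_mul, mul_comm]
    exact mul_le_mul (hH x) (abs_add_le _ _) (abs_nonneg _) (by positivity)
  refine this.trans ?_
  rw [integral_const_mul, integral_add (i1 hf hM).1 (i1 hg hM').1]
  gcongr
  · exact integral_abs_sub_le_stdDev hf hM
  · exact integral_abs_sub_le_stdDev hg hM'

/-- If `G v` changes by at most `ε` when one observation of `v` is replaced, then the standard
deviation of `G v` on the sample `v` is close to its standard deviation. -/
lemma integral_abs_sampleStdDev_sub_stdDev_le {μ : Measure E} [IsProbabilityMeasure μ]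
    (hN : 0 < N) {G : (Fin N → E) → E → ℝ} (hG : Measurable (Function.uncurry G)) {M ε : ℝ}
    (hM : ∀ v x, |G v x| ≤ M) (hε : 0 < ε)
    (hst : ∀ v j y x, |G v x - G (Function.update v j y) x| ≤ ε) :
    ∫ v, |sampleStdDev (G v) v - stdDev μ (G v)| ∂(Measure.pi fun _ : Fin N => μ)
      ≤ 5 * M / √(N : ℝ) + 584 * ε := by
  have hNr : (0 : ℝ) < N := by exact_mod_cast hN
  set π := Measure.pi fun _ : Fin N => μ with hπ
  have hGv : ∀ v, Measurable (G v) := fun v => hG.comp measurable_prodMk_left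
  have hM0 : 0 ≤ M := by
    obtain ⟨x⟩ : Nonempty E := nonempty_of_isProbabilityMeasure μ
    exact (abs_nonneg _).trans (hM (fun _ => x) x)
  have hm : Measurable fun v => ∫ x, G v x ∂μ :=
    hG.stronglyMeasurable.integral_prod_right.measurable
  have hs : Measurable fun v => stdDev μ (G v) := measurable_stdDev hG
  have hs0 : ∀ v, 0 ≤ stdDev μ (G v) := fun v => Real.sqrt_nonneg _
  set H : (Fin N → E) → E → ℝ := fun v x => G v x - ∫ y, G v y ∂μ with hH
  have hHm : Measurable (Function.uncurry H) := hG.sub (hm.comp measurable_fst)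
  have hHM : ∀ v x, |H v x| ≤ 2 * M := fun v x => (abs_sub _ _).trans (by
    have := abs_integral_le_of_forall (μ := μ) (ae_of_all _ (hM v))
    linarith [hM v x])
  have hsd : ∀ v j y, |stdDev μ (G v) - stdDev μ (G (Function.update v j y))| ≤ 2 * ε :=
    fun v j y => abs_sub_le_iff.2
      ⟨(stdDev_sub_le (hGv _) (hGv _) (hM _) (hM _) (hst v j y)).1,
       (stdDev_sub_le (hGv _) (hGv _) (hM _) (hM _)
        (fun x => by rw [abs_sub_comm]; exact hst v j y x)).1⟩
  have hHd : ∀ v j y x, |H v x - H (Function.update v j y) x| ≤ 2 * ε := fun v j y =>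
    (stdDev_sub_le (hGv _) (hGv _) (hM _) (hM _) (hst v j y)).2
  set D : (Fin N → E) → ℝ := fun v => stdDev μ (G v) + 4 * ε with hD
  have hD4 : ∀ v, 4 * ε ≤ D v := fun v => by simp only [hD]; linarith [hs0 v]
  have hDpos : ∀ v, 0 < D v := fun v => lt_of_lt_of_le (by positivity) (hD4 v)
  have hDm : Measurable D := hs.add_const _
  -- Division by `D` keeps the second moment of `F v` below `(2 * M) ^ 2` and the mean of `b v`
  -- below 2, however small the standard deviation is.
  set F : (Fin N → E) → E → ℝ := fun v x => H v x ^ 2 / D v with hF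
  set b : (Fin N → E) → E → ℝ := fun v x => 1 + (H v x / D v) ^ 2 with hb
  have hFm : Measurable (Function.uncurry F) := (hHm.pow_const 2).div (hDm.comp measurable_fst)
  have hbm : Measurable (Function.uncurry b) :=
    ((hHm.div (hDm.comp measurable_fst)).pow_const 2).const_add 1
  have hquot : ∀ v x, |H v x / D v| ≤ 2 * M / (4 * ε) := fun v x => by
    rw [abs_div, abs_of_pos (hDpos v)]
    exact div_le_div₀ (by positivity) (hHM v x) (by positivity) (hD4 v)
  have hFb : ∀ v x, |F v x| ≤ 2 * M * (2 * M / (4 * ε)) := fun v x => by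
    have : F v x = H v x * (H v x / D v) := by simp only [hF]; ring
    rw [this, abs_mul]
    exact mul_le_mul (hHM v x) (hquot v x) (abs_nonneg _) (by positivity)
  have hbb : ∀ v x, |b v x| ≤ 1 + (2 * M / (4 * ε)) ^ 2 := fun v x => by
    rw [abs_of_nonneg (by positivity)]
    simp only [hb]
    rw [← sq_abs (H v x / D v)]
    have := hquot v x
    gcongr
  have hq2 : ∀ v, ∫ x, (H v x / D v) ^ 2 ∂μ ≤ 1 := fun v => by
    simp_rw [div_pow]
    rw [integral_div, div_le_one (by have := hDpos v; positivity), ← sq_stdDev]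
    exact pow_le_pow_left₀ (hs0 v) (by simp only [hD]; linarith) 2
  have hHv : ∀ v, Measurable (H v) := fun v => (hGv v).sub_const _
  have iq : ∀ v, Integrable (fun x => (H v x / D v) ^ 2) μ := fun v =>
    integrable_of_measurable_of_bound (((hHv v).div_const _).pow_const 2)
      (C := (2 * M / (4 * ε)) ^ 2) fun x => by
        rw [abs_pow]; exact pow_le_pow_left₀ (abs_nonneg _) (hquot v x) 2
  -- Applied to `G`, the concentration bound controls the sample mean with error `M / √N + 4 * ε`.
  -- Applied to `F` next, it controls the normalised second moment with error `2 * M / √N + 288 *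
  -- ε`.
  have first := integral_abs_average_sub_le (μ := μ) hN hG (b := fun _ _ => 1) measurable_const
    (K' := 1) (ε := ε) (C := 1) (B := 1) (V := M ^ 2) hM (by simp) (by simp) hε.le zero_le_one
    (fun v j y x => by simpa using hst v j y x) (by simp) (by simp)
    (fun v => by
      refine (integral_mono_of_nonneg (ae_of_all _ fun x => sq_nonneg _)
        (integrable_const (M ^ 2)) (ae_of_all _ fun x => ?_)).trans (by simp)
      simp only
      rw [← sq_abs]
      exact pow_le_pow_left₀ (abs_nonneg _) (hM v x) 2)
  have second := integral_abs_average_sub_le (μ := μ) hN hFm hbm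
    (ε := 8 * ε) (C := 8) (B := 2) (V := (2 * M) ^ 2) hFb hbb (fun v x => by positivity)
    (by positivity) (by norm_num)
    (fun v j y x => (normalized_square_perturbation hε (hs0 v) (hs0 _)
      (hHd v j y x) (hsd v j y)).1)
    (fun v j y x => (normalized_square_perturbation hε (hs0 v) (hs0 _)
      (hHd v j y x) (hsd v j y)).2)
    (fun v => by
      simp only [hb]
      rw [integral_add (integrable_const _) (iq v)]
      have := hq2 v
      simp only [integral_const, probReal_univ, one_smul]
      linarith)
    (fun v => by
      refine (integral_mono_of_nonneg (ae_of_all _ fun x => sq_nonneg _)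
        ((iq v).const_mul ((2 * M) ^ 2)) (ae_of_all _ fun x => ?_)).trans ?_
      · have : F v x = H v x * (H v x / D v) := by simp only [hF]; ring
        simp only
        rw [this, mul_pow]
        refine mul_le_mul_of_nonneg_right ?_ (sq_nonneg _)
        rw [← sq_abs]
        exact pow_le_pow_left₀ (abs_nonneg _) (hHM v x) 2
      · rw [integral_const_mul]
        exact mul_le_of_le_one_right (by positivity) (hq2 v))
  have hsq : √(M ^ 2 / N) = M / √(N : ℝ) := by
    rw [Real.sqrt_div (sq_nonneg _), Real.sqrt_sq hM0]
  have hsq2 : √((2 * M) ^ 2 / N) = 2 * (M / √(N : ℝ)) := by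
    rw [Real.sqrt_div (sq_nonneg _), Real.sqrt_sq (by positivity), mul_div_assoc]
  rw [hsq] at first
  rw [hsq2] at second
  -- The sample variance is `t ^ 2 - q ^ 2`, with `q` the sample mean and `t ^ 2` the sample second
  -- moment of `H v`. So `t` is within `|q|` of the sample deviation, and it is compared with the
  -- true one by `abs_sub_le_of_sq` with `η = 4 * ε`. In mean this gives `4 + 4 + 2 * 288 = 584`
  -- times `ε`.
  have hpt : ∀ v, |sampleStdDev (G v) v - stdDev μ (G v)|
      ≤ |1 / (N : ℝ) * ∑ i, (G v (v i) - ∫ x, G v x ∂μ)|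
        + (4 * ε + 2 * |1 / (N : ℝ) * ∑ i, (F v (v i) - ∫ x, F v x ∂μ)|) := by
    intro v
    set q := 1 / (N : ℝ) * ∑ i, H v (v i) with hqd
    set t := √(1 / (N : ℝ) * ∑ i, H v (v i) ^ 2) with ht
    have ht2 : t ^ 2 = 1 / (N : ℝ) * ∑ i, H v (v i) ^ 2 := Real.sq_sqrt (by positivity)
    have e1 : (1 / (N : ℝ) * ∑ i, (F v (v i) - ∫ x, F v x ∂μ))
        = (t ^ 2 - stdDev μ (G v) ^ 2) / (stdDev μ (G v) + 4 * ε) := by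
      simp only [hF]
      rw [integral_div, ← sq_stdDev, Finset.sum_sub_distrib, ← Finset.sum_div, ht2]
      simp only [Finset.sum_const, Finset.card_univ, Fintype.card_fin, nsmul_eq_mul]
      have := hDpos v
      simp only [hD] at this ⊢
      field_simp
    rw [e1]
    have e2 := abs_sub_le_of_sq (hs0 v) (Real.sqrt_nonneg _ : 0 ≤ t) (η := 4 * ε) (by positivity)
    have hsum : 1 / (N : ℝ) * ∑ j, G v (v j) = q + ∫ x, G v x ∂μ := by
      simp only [hqd, hH]
      rw [Finset.sum_sub_distrib]
      simp only [Finset.sum_const, Finset.card_univ, Fintype.card_fin, nsmul_eq_mul]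
      field_simp
      ring
    have e3 : sampleStdDev (G v) v ^ 2 = t ^ 2 - q ^ 2 := by
      rw [sampleStdDev, Real.sq_sqrt (by positivity), ht2, hsum]
      have : ∀ i, (G v (v i) - (q + ∫ x, G v x ∂μ)) ^ 2
          = H v (v i) ^ 2 - 2 * q * H v (v i) + q ^ 2 := fun i => by simp only [hH]; ring
      simp_rw [this]
      rw [Finset.sum_add_distrib, Finset.sum_sub_distrib, ← Finset.mul_sum]
      simp only [Finset.sum_const, Finset.card_univ, Fintype.card_fin, nsmul_eq_mul]
      have : ∑ i, H v (v i) = N * q := by rw [hqd]; field_simp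
      rw [this]
      field_simp
      ring
    have e4 : |sampleStdDev (G v) v - t| ≤ |q| := by
      have h1 : 0 ≤ sampleStdDev (G v) v := Real.sqrt_nonneg _
      have h2 : 0 ≤ t := Real.sqrt_nonneg _
      have h3 : sampleStdDev (G v) v ≤ t := abs_le_of_sq_le_sq' (by nlinarith) h2 |>.2
      have h4 : t ≤ sampleStdDev (G v) v + |q| :=
        abs_le_of_sq_le_sq' (by
          have := mul_nonneg h1 (abs_nonneg q)
          nlinarith [sq_abs q]) (by positivity) |>.2
      rw [abs_sub_comm, abs_of_nonneg (by linarith)]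
      linarith
    calc _ ≤ |sampleStdDev (G v) v - t| + |t - stdDev μ (G v)| := abs_sub_le _ _ _
      _ ≤ _ := add_le_add e4 e2
  have iavg : ∀ {A : (Fin N → E) → E → ℝ} {K : ℝ}, Measurable (Function.uncurry A) →
      (∀ v x, |A v x| ≤ K) →
      Integrable (fun v => |1 / (N : ℝ) * ∑ i, (A v (v i) - ∫ x, A v x ∂μ)|) π := by
    intro A K hA hAK
    have hAi : ∀ i, Measurable fun v : Fin N → E => A v (v i) := fun i =>
      hA.comp (measurable_id.prodMk (measurable_pi_apply i))
    have hAm : Measurable fun v => ∫ x, A v x ∂μ :=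
      hA.stronglyMeasurable.integral_prod_right.measurable
    refine integrable_of_measurable_of_bound
      ((Finset.measurable_sum _ fun i _ => (hAi i).sub hAm).const_mul _).abs
      (C := 1 / N * (N * (2 * K))) fun v => ?_
    rw [abs_abs, abs_mul, abs_of_pos (by positivity)]
    gcongr
    refine (Finset.abs_sum_le_sum_abs _ _).trans ?_
    have hAb : ∀ i, |A v (v i) - ∫ x, A v x ∂μ| ≤ 2 * K := fun i => by
      have := abs_integral_le_of_forall (μ := μ) (ae_of_all _ (hAK v))
      exact (abs_sub _ _).trans (by linarith [hAK v (v i)])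
    exact (Finset.sum_le_sum fun i _ => hAb i).trans (by simp)
  have j1 := iavg hG hM
  have j2 := iavg hFm hFb
  have j3 : Integrable (fun v => 4 * ε
      + 2 * |1 / (N : ℝ) * ∑ i, (F v (v i) - ∫ x, F v x ∂μ)|) π :=
    (integrable_const _).add (j2.const_mul 2)
  refine (integral_mono_of_nonneg (ae_of_all _ fun v => abs_nonneg _) (j1.add j3)
    (ae_of_all _ hpt)).trans ?_
  simp only [Pi.add_apply]
  rw [integral_add j1 j3, integral_add (integrable_const _) (j2.const_mul 2), integral_const,
    integral_const_mul]
  simp only [probReal_univ, one_smul]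
  have : 5 * M / √(N : ℝ) = 5 * (M / √(N : ℝ)) := mul_div_assoc _ _ _
  rw [this]
  linarith

end

/-! ### Stability of the stacked predictor -/

/-- The softmax map is stable in the `ℓ¹` norm. -/
lemma sum_abs_softmax_sub_le {ι : Type*} [Fintype ι] [Nonempty ι] {a a' : ι → ℝ} {q : ℝ}
    (h : ∀ k, |a k - a' k| ≤ q) :
    ∑ k, |Real.exp (a k) / ∑ k', Real.exp (a k') - Real.exp (a' k) / ∑ k', Real.exp (a' k')|
      ≤ Real.exp (2 * q) - 1 := by
  have hS : ∀ c : ι → ℝ, 0 < ∑ k, Real.exp (c k) := fun c =>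
    Finset.sum_pos (fun k _ => Real.exp_pos _) Finset.univ_nonempty
  have hle : ∀ c c' : ι → ℝ, (∀ k, |c k - c' k| ≤ q) → ∀ k, Real.exp (c k) ≤
      Real.exp q * Real.exp (c' k) := fun c c' hc k => by
    rw [← Real.exp_add]
    exact Real.exp_le_exp.2 (by linarith [(abs_le.1 (hc k)).2])
  have hsum : ∀ c c' : ι → ℝ, (∀ k, |c k - c' k| ≤ q) → ∑ k, Real.exp (c k) ≤
      Real.exp q * ∑ k, Real.exp (c' k) := fun c c' hc => by
    rw [Finset.mul_sum]; exact Finset.sum_le_sum fun k _ => hle c c' hc k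
  have hq : 0 ≤ q := (abs_nonneg _).trans (h (Classical.arbitrary ι))
  -- Numerator and normalising sum each change by a factor at most `exp q`.
  have hw : ∀ c c' : ι → ℝ, (∀ k, |c k - c' k| ≤ q) → ∀ k,
      Real.exp (c k) / ∑ k', Real.exp (c k')
        ≤ Real.exp (2 * q) * (Real.exp (c' k) / ∑ k', Real.exp (c' k')) := fun c c' hc k => by
    have h1 := hle c c' hc k
    have h2 := hsum c' c (fun k => by rw [abs_sub_comm]; exact hc k)
    rw [mul_div_assoc', div_le_div_iff₀ (hS c) (hS c')]
    calc Real.exp (c k) * ∑ k', Real.exp (c' k')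
        ≤ (Real.exp q * Real.exp (c' k)) * (Real.exp q * ∑ k', Real.exp (c k')) := by
          gcongr
      _ = Real.exp (2 * q) * Real.exp (c' k) * ∑ k', Real.exp (c k') := by
          rw [two_mul, Real.exp_add]; ring
  have hE : 1 ≤ Real.exp (2 * q) := Real.one_le_exp (by linarith)
  -- The bound is proportional to the weight itself, and the weights sum to one; so the number of
  -- base estimators does not appear.
  have hterm : ∀ k, |Real.exp (a k) / ∑ k', Real.exp (a k')
      - Real.exp (a' k) / ∑ k', Real.exp (a' k')|
      ≤ (Real.exp (2 * q) - 1) * (Real.exp (a k) / ∑ k', Real.exp (a k')) := by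
    intro k
    have h1 := hw a a' h k
    have h2 := hw a' a (fun k => by rw [abs_sub_comm]; exact h k) k
    have h3 : 0 ≤ Real.exp (a k) / ∑ k', Real.exp (a k') :=
      div_nonneg (Real.exp_pos _).le (hS a).le
    have h4 : 0 ≤ Real.exp (a' k) / ∑ k', Real.exp (a' k') :=
      div_nonneg (Real.exp_pos _).le (hS a').le
    set w := Real.exp (a k) / ∑ k', Real.exp (a k')
    set w' := Real.exp (a' k) / ∑ k', Real.exp (a' k')
    refine abs_le.2 ⟨by linarith, ?_⟩
    by_cases hww : w ≤ w'
    · nlinarith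
    · push Not at hww
      nlinarith
  refine (Finset.sum_le_sum fun k _ => hterm k).trans (le_of_eq ?_)
  rw [← Finset.mul_sum, ← Finset.sum_div, div_self (hS a).ne', mul_one]

section

variable {d d' m N p : ℕ} {L : (Fin d → ℝ) → (Fin d' → ℝ) → ℝ}
  {θ : Fin p → (Fin m → Fin d → ℝ) → (Fin d → ℝ) → (Fin d' → ℝ)} {β : ℝ}

/-- The loss of the stacked predictor. -/
noncomputable def stackedLoss (L : (Fin d → ℝ) → (Fin d' → ℝ) → ℝ)
    (θ : Fin p → (Fin m → Fin d → ℝ) → (Fin d → ℝ) → (Fin d' → ℝ)) (β : ℝ)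
    (u : Fin m → Fin d → ℝ) (v : Fin N → Fin d → ℝ) (x : Fin d → ℝ) : ℝ :=
  L x (stackedPredictor L θ β u v x)

/-- The points at which the base estimators fitted on `u`, their losses, and the partial
derivatives of the loss on their convex hull are bounded by `T` and `Λ`. -/
def goodPoints (L : (Fin d → ℝ) → (Fin d' → ℝ) → ℝ)
    (θ : Fin p → (Fin m → Fin d → ℝ) → (Fin d → ℝ) → (Fin d' → ℝ)) (T Λ : ℝ)
    (u : Fin m → Fin d → ℝ) : Set (Fin d → ℝ) :=
  {x | (∀ k l, |θ k u x l| ≤ T) ∧ (∀ k, |L x (θ k u x)| ≤ Λ) ∧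
    ∀ l, ∀ w ∈ stdSimplex ℝ (Fin p), |partialLoss L l x (∑ k, w k • θ k u x)| ≤ Λ}

lemma weight_mem_stdSimplex (hp : 0 < p) (u : Fin m → Fin d → ℝ) (v : Fin N → Fin d → ℝ) :
    weight L θ β u v ∈ stdSimplex ℝ (Fin p) := by
  have : Nonempty (Fin p) := ⟨⟨0, hp⟩⟩
  have hS : 0 < ∑ k, Real.exp (-β * meanLoss L (θ k u) v) :=
    Finset.sum_pos (fun k _ => Real.exp_pos _) Finset.univ_nonempty
  refine ⟨fun k => div_nonneg (Real.exp_pos _).le hS.le, ?_⟩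
  simp only [weight]
  rw [← Finset.sum_div, div_self hS.ne']

/-- The segment between the two combinations stays in the convex hull of the base predictions, where
each of the `d'` partial derivatives is at most `Λ`. Each coordinate of the displacement is at most
`T` times the `ℓ¹` distance of the weights. -/
lemma abs_loss_sub_le {T Λ : ℝ} {u : Fin m → Fin d → ℝ} {x : Fin d → ℝ}
    (hL : Differentiable ℝ (L x)) (hx : x ∈ goodPoints L θ T Λ u) {w w' : Fin p → ℝ}
    (hw : w ∈ stdSimplex ℝ (Fin p)) (hw' : w' ∈ stdSimplex ℝ (Fin p)) :
    |L x (∑ k, w k • θ k u x) - L x (∑ k, w' k • θ k u x)|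
      ≤ Λ * d' * T * ∑ k, |w k - w' k| := by
  set y := ∑ k, w' k • θ k u x with hy
  set z := ∑ k, (w k - w' k) • θ k u x with hz
  have hyz : ∑ k, w k • θ k u x = y + (1 : ℝ) • z := by
    rw [one_smul, hy, hz, ← Finset.sum_add_distrib]
    refine Finset.sum_congr rfl fun k _ => ?_
    rw [sub_smul]; abel
  have hder : ∀ t : ℝ, HasDerivAt (fun t : ℝ => L x (y + t • z))
      (fderiv ℝ (L x) (y + t • z) z) t := fun t => by
    have h1 : HasDerivAt (fun t : ℝ => y + t • z) z t := by
      simpa using ((hasDerivAt_id t).smul_const z).const_add y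
    exact (hL _).hasFDerivAt.comp_hasDerivAt t h1
  have hzl : ∀ l, |z l| ≤ T * ∑ k, |w k - w' k| := fun l => by
    rw [hz, Finset.sum_apply, Finset.mul_sum]
    refine (Finset.abs_sum_le_sum_abs _ _).trans (Finset.sum_le_sum fun k _ => ?_)
    simp only [Pi.smul_apply, smul_eq_mul]
    rw [abs_mul, mul_comm]
    exact mul_le_mul_of_nonneg_right (hx.1 k l) (abs_nonneg _)
  have hbd : ∀ t ∈ Set.Icc (0 : ℝ) 1, ‖fderiv ℝ (L x) (y + t • z) z‖
      ≤ Λ * d' * T * ∑ k, |w k - w' k| := by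
    intro t ht
    have hmem : (fun k => (1 - t) * w' k + t * w k) ∈ stdSimplex ℝ (Fin p) := by
      have := convex_stdSimplex ℝ (Fin p) hw' hw (by linarith [ht.2] : 0 ≤ 1 - t) ht.1 (by ring)
      exact this
    have hyt : y + t • z = ∑ k, ((1 - t) * w' k + t * w k) • θ k u x := by
      rw [hy, hz, Finset.smul_sum, ← Finset.sum_add_distrib]
      refine Finset.sum_congr rfl fun k _ => ?_
      rw [smul_smul, ← add_smul]; congr 1; ring
    have hz' : z = ∑ l, z l • (Pi.single l (1 : ℝ) : Fin d' → ℝ) := by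
      conv_lhs => rw [pi_eq_sum_univ' z]
    rw [hz', map_sum]
    refine (norm_sum_le _ _).trans ?_
    have : ∀ l, ‖(fderiv ℝ (L x) (y + t • z)) (z l • (Pi.single l (1 : ℝ) : Fin d' → ℝ))‖
        ≤ T * (∑ k, |w k - w' k|) * Λ := fun l => by
      rw [map_smul, norm_smul, Real.norm_eq_abs, Real.norm_eq_abs]
      refine mul_le_mul (hzl l) ?_ (abs_nonneg _) ((abs_nonneg _).trans (hzl l))
      rw [hyt]
      exact hx.2.2 l _ hmem
    rw [← hz']
    refine (Finset.sum_le_sum fun l _ => this l).trans (le_of_eq ?_)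
    simp only [Finset.sum_const, Finset.card_univ, Fintype.card_fin, nsmul_eq_mul]
    ring
  have := (convex_Icc (0 : ℝ) 1).norm_image_sub_le_of_norm_hasDerivWithin_le
    (fun t _ => (hder t).hasDerivWithinAt) hbd (x := 0) (y := 1) (by simp) (by simp)
  rw [hyz]
  simpa using this

/-- Comparison with a vertex of the simplex, that is, with a single base estimator. The `ℓ¹`
distance in the simplex is at most 2, and the loss at the vertex is at most `Λ ≤ Λ * d' * T`. -/
lemma abs_loss_le {T Λ : ℝ} {u : Fin m → Fin d → ℝ} {x : Fin d → ℝ} (hp : 0 < p) (hd' : 0 < d')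
    (hL : Differentiable ℝ (L x)) (hx : x ∈ goodPoints L θ T Λ u) (hΛ : 0 ≤ Λ) (hT : 1 ≤ T)
    {w : Fin p → ℝ} (hw : w ∈ stdSimplex ℝ (Fin p)) :
    |L x (∑ k, w k • θ k u x)| ≤ 3 * (Λ * d' * T) := by
  set k₀ : Fin p := ⟨0, hp⟩
  have h1 := abs_loss_sub_le hL hx hw (single_mem_stdSimplex ℝ k₀)
  have h2 : ∑ k, (Pi.single k₀ (1 : ℝ) : Fin p → ℝ) k • θ k u x = θ k₀ u x := by
    rw [Finset.sum_eq_single k₀] <;> simp +contextual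
  rw [h2] at h1
  have h3 : ∑ k, |w k - (Pi.single k₀ (1 : ℝ) : Fin p → ℝ) k| ≤ 2 := by
    refine (Finset.sum_le_sum fun k _ => abs_sub _ _).trans ?_
    rw [Finset.sum_add_distrib]
    have e1 : ∑ k, |w k| = 1 := by
      rw [← hw.2]; exact Finset.sum_congr rfl fun k _ => abs_of_nonneg (hw.1 k)
    have e2 : ∑ k, |(Pi.single k₀ (1 : ℝ) : Fin p → ℝ) k| = 1 := by
      rw [Finset.sum_eq_single k₀] <;> simp +contextual
    linarith
  have h4 : 1 ≤ (d' : ℝ) := by exact_mod_cast hd'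
  have h5 : Λ ≤ Λ * d' * T := by
    calc Λ = Λ * 1 * 1 := by ring
      _ ≤ Λ * d' * T := by gcongr
  have h6 : |L x (∑ k, w k • θ k u x)|
      ≤ |L x (∑ k, w k • θ k u x) - L x (θ k₀ u x)| + |L x (θ k₀ u x)| := by
    simpa using abs_add_le (L x (∑ k, w k • θ k u x) - L x (θ k₀ u x)) (L x (θ k₀ u x))
  have h7 := hx.2.1 k₀
  have h8 : Λ * d' * T * ∑ k, |w k - (Pi.single k₀ (1 : ℝ) : Fin p → ℝ) k|
      ≤ Λ * d' * T * 2 := mul_le_mul_of_nonneg_left h3 (hΛ.trans h5)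
  linarith

/-- Only one summand of each mean loss changes, by at most `2 * Λ`, so the softmax exponents move by
at most `2 * β * Λ / N`; softmax stability doubles this. -/
lemma sum_abs_weight_update_sub_le {T Λ : ℝ} {u : Fin m → Fin d → ℝ} {v : Fin N → Fin d → ℝ}
    (hN : 0 < N) (hp : 0 < p) (hβ : 0 ≤ β) (hv : ∀ i, v i ∈ goodPoints L θ T Λ u) (j : Fin N)
    {y : Fin d → ℝ} (hy : y ∈ goodPoints L θ T Λ u) :
    ∑ k, |weight L θ β u v k - weight L θ β u (Function.update v j y) k|
      ≤ Real.exp (4 * (β / N * Λ)) - 1 := by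
  have : Nonempty (Fin p) := ⟨⟨0, hp⟩⟩
  have hNr : (0 : ℝ) < N := by exact_mod_cast hN
  have h := sum_abs_softmax_sub_le (a := fun k => -β * meanLoss L (θ k u) v)
    (a' := fun k => -β * meanLoss L (θ k u) (Function.update v j y)) (q := 2 * (β / N * Λ))
    (fun k => by
      have e : -β * meanLoss L (θ k u) v - -β * meanLoss L (θ k u) (Function.update v j y)
          = β / N * (L y (θ k u y) - L (v j) (θ k u (v j))) := by
        simp only [meanLoss]
        rw [← Finset.add_sum_erase _ _ (Finset.mem_univ j),
          ← Finset.add_sum_erase _ (fun i => L (Function.update v j y i) _) (Finset.mem_univ j)]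
        have : ∑ i ∈ Finset.univ.erase j, L (Function.update v j y i)
            (θ k u (Function.update v j y i))
            = ∑ i ∈ Finset.univ.erase j, L (v i) (θ k u (v i)) :=
          Finset.sum_congr rfl fun i hi => by
            rw [Function.update_of_ne (Finset.ne_of_mem_erase hi)]
        rw [this, Function.update_self]
        ring
      rw [e, abs_mul, abs_of_nonneg (by positivity), mul_left_comm]
      refine mul_le_mul_of_nonneg_left ((abs_sub _ _).trans ?_) (by positivity)
      linarith [hy.2.1 k, (hv j).2.1 k])
  rw [show 4 * (β / N * Λ) = 2 * (2 * (β / N * Λ)) by ring]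
  exact h

lemma measurable_stackedPredictor
    (hL : Continuous fun q : (Fin d → ℝ) × (Fin d' → ℝ) => L q.1 q.2)
    (hθ : ∀ k, Measurable fun q : (Fin m → Fin d → ℝ) × (Fin d → ℝ) => θ k q.1 q.2) :
    Measurable fun q : ((Fin m → Fin d → ℝ) × (Fin N → Fin d → ℝ)) × (Fin d → ℝ) =>
      stackedPredictor L θ β q.1.1 q.1.2 q.2 := by
  have hml : ∀ k, Measurable fun q : ((Fin m → Fin d → ℝ) × (Fin N → Fin d → ℝ)) × (Fin d → ℝ) =>
      Real.exp (-β * meanLoss L (θ k q.1.1) q.1.2) := fun k => by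
    refine Measurable.exp (Measurable.const_mul ?_ _)
    refine Measurable.const_mul (Finset.measurable_sum _ fun i _ => ?_) _
    have hvi : Measurable fun q : ((Fin m → Fin d → ℝ) × (Fin N → Fin d → ℝ)) × (Fin d → ℝ) =>
        q.1.2 i := (measurable_pi_apply i).comp (measurable_snd.comp measurable_fst)
    exact hL.measurable.comp (hvi.prodMk
      ((hθ k).comp ((measurable_fst.comp measurable_fst).prodMk hvi)))
  refine Finset.measurable_sum _ fun k _ => Measurable.fun_smul ?_ ?_
  · exact (hml k).div (Finset.measurable_sum _ fun k' _ => hml k')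
  · exact (hθ k).comp ((measurable_fst.comp measurable_fst).prodMk measurable_snd)

lemma measurable_stackedLoss
    (hL : Continuous fun q : (Fin d → ℝ) × (Fin d' → ℝ) => L q.1 q.2)
    (hθ : ∀ k, Measurable fun q : (Fin m → Fin d → ℝ) × (Fin d → ℝ) => θ k q.1 q.2) :
    Measurable fun q : ((Fin m → Fin d → ℝ) × (Fin N → Fin d → ℝ)) × (Fin d → ℝ) =>
      stackedLoss L θ β q.1.1 q.1.2 q.2 :=
  hL.measurable.comp (measurable_snd.prodMk (measurable_stackedPredictor hL hθ))

/-- The standard deviation of the stacked loss on the held-out sample is close to its standard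
deviation. -/
lemma integral_abs_sampleStdDev_stackedLoss_sub_le {μ : Measure (Fin d → ℝ)}
    [IsProbabilityMeasure μ] (hN : 0 < N) (hp : 0 < p) (hd' : 0 < d') (hβ : 0 < β)
    (hL : Continuous fun q : (Fin d → ℝ) × (Fin d' → ℝ) => L q.1 q.2)
    (hLd : ∀ x, Differentiable ℝ (L x))
    (hθ : ∀ k, Measurable fun q : (Fin m → Fin d → ℝ) × (Fin d → ℝ) => θ k q.1 q.2)
    {T Λ : ℝ} (hT : 1 ≤ T) (hΛ : 1 ≤ Λ) {u : Fin m → Fin d → ℝ}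
    (hu : ∀ᵐ x ∂μ, x ∈ goodPoints L θ T Λ u) :
    ∫ v, |sampleStdDev (stackedLoss L θ β u v) v - stdDev μ (stackedLoss L θ β u v)|
        ∂(Measure.pi fun _ : Fin N => μ)
      ≤ 5 * (3 * (Λ * d' * T)) / √(N : ℝ)
        + 584 * (Λ * d' * T * (Real.exp (4 * (β / N * Λ)) - 1)) := by
  have hNr : (0 : ℝ) < N := by exact_mod_cast hN
  have hdr : (0 : ℝ) < d' := by exact_mod_cast hd'
  obtain ⟨t, ht1, ht2, ht3⟩ := exists_measurable_superset_of_null (ae_iff.1 hu)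
  have hS : ∀ᵐ x ∂μ, x ∉ t := measure_eq_zero_iff_ae_notMem.1 ht3
  have hgood : ∀ x, x ∉ t → x ∈ goodPoints L θ T Λ u := fun x hx => by
    by_contra h; exact hx (ht1 h)
  obtain ⟨x₀, hx₀⟩ := hS.exists
  classical
  -- Points of a measurable null set containing all bad ones are sent to one good point. The bounds
  -- then hold for every sample and every replacement, while almost every sample is left unchanged.
  set ρ : (Fin d → ℝ) → (Fin d → ℝ) := fun x => if x ∈ t then x₀ else x with hρ
  have hρm : Measurable ρ := Measurable.ite ht2 measurable_const measurable_id
  have hρg : ∀ x, ρ x ∈ goodPoints L θ T Λ u := fun x => by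
    by_cases h : x ∈ t
    · simpa [hρ, h] using hgood x₀ hx₀
    · simpa [hρ, h] using hgood x h
  have hρx : ∀ x, x ∉ t → ρ x = x := fun x hx => by simp [hρ, hx]
  have key := integral_abs_sampleStdDev_sub_stdDev_le (μ := μ) hN
    (G := fun v x => stackedLoss L θ β u (ρ ∘ v) (ρ x)) (M := 3 * (Λ * d' * T))
    (ε := Λ * d' * T * (Real.exp (4 * (β / N * Λ)) - 1))
    (by
      have h1 : Measurable fun q : (Fin N → Fin d → ℝ) × (Fin d → ℝ) =>
          ((u, ρ ∘ q.1), ρ q.2) := by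
        refine (measurable_const.prodMk ?_).prodMk (hρm.comp measurable_snd)
        exact measurable_pi_lambda _ fun i =>
          hρm.comp ((measurable_pi_apply i).comp measurable_fst)
      exact (measurable_stackedLoss (β := β) hL hθ).comp h1)
    (fun v x => abs_loss_le hp hd' (hLd _) (hρg x) (by linarith) hT
      (weight_mem_stdSimplex hp _ _))
    (by
      have : 0 < Real.exp (4 * (β / N * Λ)) - 1 := by
        rw [sub_pos, Real.one_lt_exp_iff]; positivity
      positivity)
    (fun v j y x => by
      refine (abs_loss_sub_le (hLd _) (hρg x) (weight_mem_stdSimplex hp _ _) (weight_mem_stdSimplex hp _ _)).trans ?_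
      rw [Function.comp_update]
      refine mul_le_mul_of_nonneg_left ?_ (by positivity)
      exact sum_abs_weight_update_sub_le hN hp hβ.le (fun i => hρg _) j (hρg y))
  refine le_of_eq_of_le (integral_congr_ae ?_) key
  have hv : ∀ᵐ v ∂(Measure.pi fun _ : Fin N => μ), ∀ i, v i ∉ t := ae_all_iff.2 fun i =>
    (Measure.quasiMeasurePreserving_eval (μ := fun _ : Fin N => μ) i).ae hS
  filter_upwards [hv] with v hv
  have e0 : ρ ∘ v = v := funext fun i => hρx _ (hv i)
  have e1 : (fun x => stackedLoss L θ β u v (ρ x)) =ᵐ[μ] stackedLoss L θ β u v :=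
    hS.mono fun x hx => by simp only [hρx x hx]
  simp only [e0]
  congr 2
  · simp only [sampleStdDev, hρx _ (hv _)]
  · have e2 := integral_congr_ae e1
    unfold stdDev
    rw [e2]
    congr 1
    exact integral_congr_ae (e1.mono fun x hx => by simp only [hx])

end

/-! ### Conditional laws -/

section CondLaw

variable {Ω S : Type*} [MeasurableSpace Ω] [MeasurableSpace S] {P : Measure Ω}
  [IsFiniteMeasure P]

/-- The conditional law of `F (X, Z)` given `X` is the image of the conditional law of `Z`. -/
lemma condDistrib_comp_prodMk {E : Type*} [MeasurableSpace E] [StandardBorelSpace E] [Nonempty E]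
    {X : Ω → S} {Z : Ω → E} (hX : Measurable X) (hZ : Measurable Z) {F : S × E → ℝ}
    (hF : Measurable F) :
    ∀ᵐ ω ∂P, condDistrib (fun ω => F (X ω, Z ω)) X P (X ω)
      = (condDistrib Z X P (X ω)).map fun z => F (X ω, z) := by
  have hκ : ∀ a, ((Kernel.id ×ₖ condDistrib Z X P).map F) a
      = (condDistrib Z X P a).map fun z => F (a, z) := fun a => by
    rw [Kernel.map_apply _ hF, Kernel.prod_apply, Kernel.id_apply, Measure.dirac_prod,
      Measure.map_map hF measurable_prodMk_left]
    rfl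
  -- By uniqueness of disintegrations, it suffices that the image kernel disintegrates the joint law
  -- of `X` and `F (X, Z)`.
  have h := condDistrib_ae_eq_of_measure_eq_compProd (μ := P) X
    (hF.comp (hX.prodMk hZ)).aemeasurable (κ := (Kernel.id ×ₖ condDistrib Z X P).map F) (by
      ext s hs
      have hs' : MeasurableSet ((fun q : S × E => (q.1, F q)) ⁻¹' s) :=
        (measurable_fst.prodMk hF) hs
      rw [Measure.compProd_apply hs, Measure.map_apply (hX.prodMk (hF.comp (hX.prodMk hZ))) hs]
      have : ∀ a, ((Kernel.id ×ₖ condDistrib Z X P).map F) a (Prod.mk a ⁻¹' s)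
          = condDistrib Z X P a (Prod.mk a ⁻¹' ((fun q : S × E => (q.1, F q)) ⁻¹' s)) := fun a => by
        rw [hκ, Measure.map_apply (f := fun z => F (a, z)) (hF.comp measurable_prodMk_left) (measurable_prodMk_left hs)]
        rfl
      simp_rw [this]
      rw [← Measure.compProd_apply hs', compProd_map_condDistrib hZ.aemeasurable,
        Measure.map_apply (hX.prodMk hZ) hs']
      rfl)
  filter_upwards [ae_of_ae_map hX.aemeasurable h] with ω hω
  rw [← hκ, ← hω]
  rfl

/-- The conditional law of a variable independent of the conditioning one is its law. -/
lemma condDistrib_ae_eq_map_of_indepFun {E : Type*} [MeasurableSpace E] [StandardBorelSpace E]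
    [Nonempty E] {X : Ω → S} {Y : Ω → E} (hX : Measurable X) (hY : Measurable Y)
    (hXY : IndepFun Y X P) :
    condDistrib Y X P =ᵐ[P.map X] Kernel.const S (P.map Y) := by
  refine condDistrib_ae_eq_of_measure_eq_compProd X hY.aemeasurable ?_
  rw [Measure.compProd_const]
  exact (indepFun_iff_map_prod_eq_prod_map_map hX.aemeasurable hY.aemeasurable).1 hXY.symm

/-- A conditional probability as a value of the conditional law. -/
lemma condExp_indicator_ae_eq_condDistrib {V : Ω → ℝ} {X : Ω → S} (hX : Measurable X)
    (hV : Measurable V) {t : S → ℝ} (ht : Measurable t) :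
    P⟦{ω | t (X ω) ≤ |V ω|} | MeasurableSpace.comap X inferInstance⟧
      =ᵐ[P] fun ω => (condDistrib V X P (X ω)).real {c | t (X ω) ≤ |c|} := by
  have hs : MeasurableSet {q : S × ℝ | t q.1 ≤ |q.2|} :=
    measurableSet_le (ht.comp measurable_fst) measurable_snd.abs
  have h := condExp_prod_ae_eq_integral_condDistrib (μ := P) hX hV.aemeasurable
    (f := {q : S × ℝ | t q.1 ≤ |q.2|}.indicator fun _ => (1 : ℝ))
    (stronglyMeasurable_const.indicator hs)
    (((integrable_const (1 : ℝ)).indicator ((hX.prodMk hV) hs)).congr (ae_of_all _ fun ω => rfl))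
  have e : (fun ω => {q : S × ℝ | t q.1 ≤ |q.2|}.indicator (fun _ => (1 : ℝ)) (X ω, V ω))
      = {ω | t (X ω) ≤ |V ω|}.indicator fun _ => (1 : ℝ) := rfl
  rw [e] at h
  refine h.trans (ae_of_all _ fun ω => ?_)
  have e2 : (fun y => {q : S × ℝ | t q.1 ≤ |q.2|}.indicator (fun _ => (1 : ℝ)) (X ω, y))
      = {c | t (X ω) ≤ |c|}.indicator fun _ => (1 : ℝ) := rfl
  simp only [e2]
  have hm : MeasurableSet {c : ℝ | t (X ω) ≤ |c|} :=
    measurableSet_le measurable_const measurable_id.abs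
  rw [integral_indicator hm]
  simp

end CondLaw

/-- If `F x y` is a bounded function of two independent arguments, and every section
`ω ↦ F (X ω) y` is measurable with respect to a σ-algebra coarser than that of `X`, then averaging
over `Y` gives the conditional expectation with respect to that σ-algebra. -/
lemma condExp_ae_eq_integral_of_section {Ω S E : Type*} {𝒢 mΩ : MeasurableSpace Ω}
    [mS : MeasurableSpace S] [MeasurableSpace E] [StandardBorelSpace E] [Nonempty E]
    {P : Measure Ω} [IsProbabilityMeasure P] {X : Ω → S} {Y : Ω → E} (hX : Measurable X)
    (hY : Measurable Y) (hXY : IndepFun Y X P) {F : S × E → ℝ} (hF : Measurable F) {K : ℝ}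
    (hK : ∀ q, |F q| ≤ K)
    (h𝒢 : 𝒢 ≤ MeasurableSpace.comap X mS)
    (hsec : ∀ y, Measurable[𝒢] fun ω => F (X ω, y)) :
    P[fun ω => F (X ω, Y ω) | 𝒢] =ᵐ[P] fun ω => ∫ y, F (X ω, y) ∂P.map Y := by
  have hle : MeasurableSpace.comap X mS ≤ mΩ := hX.comap_le
  have : IsProbabilityMeasure (P.map Y) := Measure.isProbabilityMeasure_map hY.aemeasurable
  set W : Ω → ℝ := fun ω => ∫ y, F (X ω, y) ∂P.map Y with hW
  have hWm0 : Measurable fun s => ∫ y, F (s, y) ∂P.map Y :=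
    hF.stronglyMeasurable.integral_prod_right'.measurable
  have hWm : Measurable W := hWm0.comp hX
  have hWb : ∀ ω, |W ω| ≤ K := fun ω => abs_integral_le_of_forall (ae_of_all _ fun y => hK _)
  have iW : Integrable W P := integrable_of_measurable_of_bound hWm hWb
  have iF : Integrable (fun ω => F (X ω, Y ω)) P :=
    integrable_of_measurable_of_bound (hF.comp (hX.prodMk hY)) fun ω => hK _
  have h1 : P[fun ω => F (X ω, Y ω) | MeasurableSpace.comap X mS] =ᵐ[P] W := by
    refine (condExp_prod_ae_eq_integral_condDistrib hX hY.aemeasurable hF.stronglyMeasurable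
      iF).trans ?_
    filter_upwards [ae_of_ae_map hX.aemeasurable
      (condDistrib_ae_eq_map_of_indepFun hX hY hXY)] with ω hω
    rw [hω]; rfl
  have h2 : P[fun ω => F (X ω, Y ω) | 𝒢] =ᵐ[P] P[W | 𝒢] :=
    (condExp_condExp_of_le h𝒢 hle).symm.trans (condExp_congr_ae h1)
  refine h2.trans ?_
  -- It remains to see that `W` is `𝒢`-measurable up to null sets. Measurable sections do not make
  -- the integrand jointly measurable over `𝒢`, so an `L²` argument is used. `V` is orthogonal to
  -- every bounded `𝒢`-measurable function, hence to every section, hence by Fubini to their average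
  -- `W`; so `∫ V ^ 2 = 0`.
  set V : Ω → ℝ := fun ω => W ω - (P[W | 𝒢]) ω with hV
  have hCb : ∀ᵐ ω ∂P, |(P[W | 𝒢]) ω| ≤ K := by
    exact ae_bdd_abs_condExp_of_ae_bdd_abs (ae_of_all _ hWb)
  have hCm : Measurable[𝒢] (P[W | 𝒢]) := stronglyMeasurable_condExp.measurable
  have h𝒢' := h𝒢.trans hle
  have hVm : Measurable V := hWm.sub (hCm.mono h𝒢' le_rfl)
  have hVb : ∀ᵐ ω ∂P, |V ω| ≤ 2 * K := by
    filter_upwards [hCb] with ω hω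
    exact (abs_sub _ _).trans (by linarith [hWb ω])
  have iV : Integrable V P := iW.sub integrable_condExp
  have hV0 : P[V | 𝒢] =ᵐ[P] 0 := by
    have e1 : P[V | 𝒢] =ᵐ[P] P[W | 𝒢] - P[P[W | 𝒢] | 𝒢] := condExp_sub iW integrable_condExp 𝒢
    have e2 : P[P[W | 𝒢] | 𝒢] = P[W | 𝒢] :=
      condExp_of_stronglyMeasurable h𝒢' stronglyMeasurable_condExp integrable_condExp
    rw [e2, sub_self] at e1
    exact e1
  have orth : ∀ U : Ω → ℝ, Measurable[𝒢] U → (∀ᵐ ω ∂P, |U ω| ≤ K) → ∫ ω, U ω * V ω ∂P = 0 := by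
    intro U hU hUb
    have hUm : Measurable U := hU.mono h𝒢' le_rfl
    have iUV : Integrable (U * V) P := by
      refine Integrable.of_bound (C := K * (2 * K)) (hUm.mul hVm).aestronglyMeasurable ?_
      filter_upwards [hUb, hVb] with ω h3 h4
      simp only [Pi.mul_apply, Real.norm_eq_abs, abs_mul]
      exact mul_le_mul h3 h4 (abs_nonneg _) ((abs_nonneg _).trans h3)
    have e1 := condExp_mul_of_stronglyMeasurable_left (m := 𝒢) (μ := P) hU.stronglyMeasurable
      iUV iV
    have e2 : ∫ ω, (U * V) ω ∂P = ∫ ω, (P[U * V | 𝒢]) ω ∂P := (integral_condExp h𝒢').symm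
    have e3 : ∫ ω, (P[U * V | 𝒢]) ω ∂P = ∫ _, (0 : ℝ) ∂P := by
      refine integral_congr_ae ?_
      filter_upwards [e1, hV0] with ω h5 h6
      rw [h5]; simp [h6]
    simpa using e2.trans e3
  have hWV : ∫ ω, W ω * V ω ∂P = 0 := by
    have iFV : Integrable (Function.uncurry fun ω y => F (X ω, y) * V ω) (P.prod (P.map Y)) := by
      have hm : Measurable (Function.uncurry fun (ω : Ω) (y : E) => F (X ω, y) * V ω) :=
        (hF.comp ((hX.comp measurable_fst).prodMk measurable_snd)).mul (hVm.comp measurable_fst)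
      refine Integrable.of_bound (C := K * (2 * K)) hm.aestronglyMeasurable ?_
      have : ∀ᵐ q ∂(P.prod (P.map Y)), |V q.1| ≤ 2 * K :=
        Measure.quasiMeasurePreserving_fst.ae hVb
      filter_upwards [this] with q hq
      simp only [Function.uncurry, Real.norm_eq_abs, abs_mul]
      exact mul_le_mul (hK _) hq (abs_nonneg _) ((abs_nonneg _).trans (hK (X q.1, q.2)))
    calc ∫ ω, W ω * V ω ∂P = ∫ ω, ∫ y, F (X ω, y) * V ω ∂P.map Y ∂P := by
          congr 1; ext ω; rw [integral_mul_const]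
      _ = ∫ y, ∫ ω, F (X ω, y) * V ω ∂P ∂P.map Y := integral_integral_swap iFV
      _ = 0 := by
          simp_rw [fun y => orth _ (hsec y) (ae_of_all _ fun ω => hK _)]
          simp
  have hCV : ∫ ω, (P[W | 𝒢]) ω * V ω ∂P = 0 := orth _ hCm hCb
  have iVV : ∀ {U : Ω → ℝ}, Measurable U → (∀ᵐ ω ∂P, |U ω| ≤ K) →
      Integrable (fun ω => U ω * V ω) P := fun {U} hU hUb => by
    refine Integrable.of_bound (C := K * (2 * K)) (hU.mul hVm).aestronglyMeasurable ?_
    filter_upwards [hUb, hVb] with ω h3 h4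
    rw [Real.norm_eq_abs, abs_mul]
    exact mul_le_mul h3 h4 (abs_nonneg _) ((abs_nonneg _).trans h3)
  have j1 := iVV hWm (ae_of_all _ hWb)
  have j2 := iVV (hCm.mono h𝒢' le_rfl) hCb
  have hV2 : ∫ ω, V ω ^ 2 ∂P = 0 := by
    have : ∀ ω, V ω ^ 2 = W ω * V ω - (P[W | 𝒢]) ω * V ω := fun ω => by
      simp only [hV]; ring
    simp_rw [this]
    rw [integral_sub j1 j2, hWV, hCV, sub_zero]
  have iV2 : Integrable (fun ω => V ω ^ 2) P := by
    refine (j1.sub j2).congr (ae_of_all _ fun ω => ?_)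
    simp only [hV, Pi.sub_apply]; ring
  have := (integral_eq_zero_iff_of_nonneg (fun ω => sq_nonneg _) iV2).1 hV2
  filter_upwards [this] with ω hω
  have : V ω = 0 := by simpa using hω
  simp only [hV] at this
  linarith

/-! ### Smooth test functions -/

/-- The derivatives are continuous on the compact interval `[0, 1]`, and outside it the transition
is locally constant. -/
lemma exists_bound_iteratedDeriv_smoothTransition :
    ∃ K : ℝ, 0 < K ∧ ∀ i : ℕ, 1 ≤ i → i ≤ 3 → ∀ x : ℝ,
      |iteratedDeriv i Real.smoothTransition x| ≤ K := by
  have hcd : ∀ n : ℕ∞, ContDiff ℝ n Real.smoothTransition := fun n =>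
    Real.smoothTransition.contDiff
  have hb : ∀ i : ℕ, ∃ K : ℝ, ∀ x ∈ Set.Icc (0 : ℝ) 1,
      ‖iteratedDeriv i Real.smoothTransition x‖ ≤ K := fun i =>
    isCompact_Icc.exists_bound_of_continuousOn
      ((hcd i).continuous_iteratedDeriv i le_rfl).continuousOn
  choose K hK using hb
  have hz : ∀ i, 1 ≤ i → ∀ x, x ∉ Set.Icc (0 : ℝ) 1 →
      iteratedDeriv i Real.smoothTransition x = 0 := by
    intro i hi x hx
    have hconst : ∃ c : ℝ, Real.smoothTransition =ᶠ[𝓝 x] fun _ => c := by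
      rw [Set.mem_Icc, not_and_or, not_le, not_le] at hx
      rcases hx with hx | hx
      · exact ⟨0, (eventually_lt_nhds hx).mono fun y hy =>
          Real.smoothTransition.zero_of_nonpos hy.le⟩
      · exact ⟨1, (eventually_gt_nhds hx).mono fun y hy =>
          Real.smoothTransition.one_of_one_le hy.le⟩
    obtain ⟨c, hc⟩ := hconst
    rw [hc.iteratedDeriv_eq, iteratedDeriv_const, if_neg (by omega)]
  refine ⟨|K 1| + |K 2| + |K 3| + 1, by positivity, fun i h1 h3 x => ?_⟩
  by_cases hx : x ∈ Set.Icc (0 : ℝ) 1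
  · have := hK i x hx
    rw [Real.norm_eq_abs] at this
    have h4 := le_abs_self (K i)
    have := abs_nonneg (K 1); have := abs_nonneg (K 2); have := abs_nonneg (K 3)
    interval_cases i <;> linarith
  · rw [hz i h1 x hx, abs_zero]; positivity

/-- A smooth function between the indicators of `t + δ ≤ |x|` and `t ≤ |x|`. -/
noncomputable def smoothTail (t δ x : ℝ) : ℝ :=
  Real.smoothTransition (δ⁻¹ * x + -(δ⁻¹ * t)) + Real.smoothTransition (-δ⁻¹ * x + -(δ⁻¹ * t))

lemma smoothTail_nonneg (t δ x : ℝ) : 0 ≤ smoothTail t δ x :=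
  add_nonneg (Real.smoothTransition.nonneg _) (Real.smoothTransition.nonneg _)

/-- For `t ≥ 0` the two transitions are nonzero only on `x > t` and on `x < -t`, which are disjoint,
so their sum never exceeds one. -/
lemma smoothTail_le_indicator {t δ : ℝ} (ht : 0 ≤ t) (hδ : 0 < δ) (x : ℝ) :
    smoothTail t δ x ≤ {c : ℝ | t ≤ |c|}.indicator (fun _ => 1) x := by
  have hδ' : 0 < δ⁻¹ := inv_pos.2 hδ
  have hle1 := Real.smoothTransition.le_one
  by_cases h : t ≤ |x|
  · rw [Set.indicator_of_mem (by exact h)]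
    unfold smoothTail
    rcases le_total 0 x with hx | hx
    · rw [Real.smoothTransition.zero_of_nonpos (x := -δ⁻¹ * x + -(δ⁻¹ * t)), add_zero]
      · exact hle1 _
      · have := mul_nonneg hδ'.le hx; have := mul_nonneg hδ'.le ht; linarith
    · rw [Real.smoothTransition.zero_of_nonpos (x := δ⁻¹ * x + -(δ⁻¹ * t)), zero_add]
      · exact hle1 _
      · have := mul_nonneg hδ'.le (neg_nonneg.2 hx); have := mul_nonneg hδ'.le ht; linarith
  · rw [Set.indicator_of_notMem (by exact h)]
    have hx := abs_lt.1 (not_le.1 h)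
    unfold smoothTail
    rw [Real.smoothTransition.zero_of_nonpos, Real.smoothTransition.zero_of_nonpos, add_zero]
    · have := mul_nonneg hδ'.le (by linarith : 0 ≤ x + t); linarith
    · have := mul_nonneg hδ'.le (by linarith : 0 ≤ t - x); linarith

lemma indicator_le_smoothTail {t δ : ℝ} (hδ : 0 < δ) (x : ℝ) :
    {c : ℝ | t + δ ≤ |c|}.indicator (fun _ => 1) x ≤ smoothTail t δ x := by
  have hδ' : 0 < δ⁻¹ := inv_pos.2 hδ
  by_cases hx : t + δ ≤ |x|
  swap
  · rw [Set.indicator_of_notMem (by exact hx)]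
    exact smoothTail_nonneg _ _ _
  rw [Set.indicator_of_mem (by exact hx)]
  have hone : ∀ y, t + δ ≤ y → 1 ≤ δ⁻¹ * y + -(δ⁻¹ * t) := fun y hy => by
    have := mul_le_mul_of_nonneg_left hy hδ'.le
    rw [mul_add, inv_mul_cancel₀ hδ.ne'] at this
    linarith
  have hn := Real.smoothTransition.nonneg
  unfold smoothTail
  rcases le_total 0 x with h0 | h0
  · rw [abs_of_nonneg h0] at hx
    rw [Real.smoothTransition.one_of_one_le (hone x hx)]
    linarith [hn (-δ⁻¹ * x + -(δ⁻¹ * t))]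
  · rw [abs_of_nonpos h0] at hx
    have := hone _ hx
    rw [mul_neg, ← neg_mul] at this
    rw [Real.smoothTransition.one_of_one_le this]
    linarith [hn (δ⁻¹ * x + -(δ⁻¹ * t))]

lemma contDiff_smoothTail (t δ : ℝ) : ContDiff ℝ 3 (smoothTail t δ) := by
  have h : ContDiff ℝ 3 Real.smoothTransition := Real.smoothTransition.contDiff (n := 3)
  unfold smoothTail
  exact (h.comp (by fun_prop)).add (h.comp (by fun_prop))

/-- The functions `smoothTail t δ` are multiples of test functions, uniformly in `t`. -/
lemma exists_smoothTail_mem_testFunctions {δ : ℝ} (hδ : 0 < δ) :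
    ∃ K : ℝ, 0 < K ∧ ∀ t, (fun x => K⁻¹ * smoothTail t δ x) ∈ testFunctions := by
  obtain ⟨K₀, hK₀, hK⟩ := exists_bound_iteratedDeriv_smoothTransition
  -- The `i`-th derivative of a rescaled transition carries a factor `δ⁻¹ ^ i`, at most `c ^ 3` for
  -- `i ≤ 3`; the factor 2 counts the two halves. The level `t` enters only as a translation.
  set c := max 1 δ⁻¹ with hc
  have hc1 : 1 ≤ c := le_max_left _ _
  have hδ' : 0 < δ⁻¹ := inv_pos.2 hδ
  have hKpos : 0 < 2 * (c ^ 3 * K₀) := by positivity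
  refine ⟨2 * (c ^ 3 * K₀), hKpos, fun t =>
    ⟨contDiff_const.mul (contDiff_smoothTail t δ), fun i h1 h3 x => ?_⟩⟩
  have hcd : ContDiff ℝ i Real.smoothTransition := by
    have := Real.smoothTransition.contDiff (n := (i : ℕ∞))
    exact_mod_cast this
  have hcomp : ∀ a b : ℝ, |a| ≤ c → ContDiff ℝ i (fun x => Real.smoothTransition (a * x + b)) ∧
      |iteratedDeriv i (fun x => Real.smoothTransition (a * x + b)) x| ≤ c ^ 3 * K₀ := by
    intro a b ha
    have hcd' : ContDiff ℝ i (fun z => Real.smoothTransition (z + b)) :=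
      hcd.comp (contDiff_id.add contDiff_const)
    refine ⟨hcd.comp ((contDiff_const.mul contDiff_id).add contDiff_const), ?_⟩
    have e := iteratedDeriv_comp_const_mul hcd' a
    have e2 := iteratedDeriv_comp_add_const i Real.smoothTransition b
    rw [congrFun e x, e2, abs_mul, abs_pow]
    gcongr
    · exact (pow_le_pow_left₀ (abs_nonneg _) ha i).trans (pow_le_pow_right₀ hc1 h3)
    · exact hK i h1 h3 _
  obtain ⟨d1, b1⟩ := hcomp δ⁻¹ (-(δ⁻¹ * t)) (by rw [abs_of_pos hδ']; exact le_max_right _ _)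
  obtain ⟨d2, b2⟩ := hcomp (-δ⁻¹) (-(δ⁻¹ * t))
    (by rw [abs_neg, abs_of_pos hδ']; exact le_max_right _ _)
  rw [iteratedDeriv_const_mul_field, abs_mul, abs_of_pos (inv_pos.2 hKpos), inv_mul_le_iff₀ hKpos,
    mul_one]
  have e : iteratedDeriv i (smoothTail t δ) x
      = iteratedDeriv i (fun x => Real.smoothTransition (δ⁻¹ * x + -(δ⁻¹ * t))) x
        + iteratedDeriv i (fun x => Real.smoothTransition (-δ⁻¹ * x + -(δ⁻¹ * t))) x := by
    rw [← iteratedDeriv_fun_add d1.contDiffAt d2.contDiffAt]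
    rfl
  rw [e]
  refine (abs_add_le _ _).trans ?_
  linarith

/-! ### Laws of the samples -/

section Laws

variable {Ω : Type*} [MeasurableSpace Ω] {P : Measure Ω} [IsProbabilityMeasure P] {d m n : ℕ}
  {X : ℕ → Ω → (Fin d → ℝ)}

lemma measurable_row (hXm : ∀ i, i < n → Measurable (X i)) : Measurable (row X n) :=
  measurable_pi_lambda _ fun i => hXm i i.2

lemma measurable_heldOut (hXm : ∀ i, i < n → Measurable (X i)) : Measurable (heldOut X m n) :=
  measurable_pi_lambda _ fun j => hXm _ (by have := j.2; omega)

/-- All factors are expressed by the law of the last observation, the one in which `estimatorBound`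
and `lossBound` are formulated. -/
lemma measurePreserving_row_heldOut (hmn : m < n) (hXm : ∀ i, i < n → Measurable (X i))
    (hXi : iIndepFun (fun i : Fin n => X i) P)
    (hXd : ∀ i j, i < n → j < n → IdentDistrib (X i) (X j) P P) :
    MeasurePreserving (fun ω => (row X m ω, heldOut X m n ω)) P
      ((Measure.pi fun _ : Fin m => P.map (X (n - 1))).prod
        (Measure.pi fun _ : Fin (n - m) => P.map (X (n - 1)))) := by
  have : IsProbabilityMeasure (P.map (X (n - 1))) :=
    Measure.isProbabilityMeasure_map (hXm _ (by omega)).aemeasurable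
  have hrow : Measurable (row X m) := measurable_row fun i hi => hXm i (hi.trans hmn)
  have hheld : Measurable (heldOut X m n) := measurable_heldOut hXm
  set g : Fin m ⊕ Fin (n - m) → Fin n :=
    Sum.elim (fun i => ⟨i, by omega⟩) fun j => ⟨m + j, by omega⟩ with hg
  have hginj : Function.Injective g := by
    rintro (i | i) (j | j) h <;> simp only [hg, Sum.elim_inl, Sum.elim_inr, Fin.mk.injEq] at h
    · exact congrArg _ (Fin.ext h)
    · omega
    · omega
    · exact congrArg _ (Fin.ext (by omega))
  have hind := hXi.precomp hginj
  have hlaw : P.map (fun ω (s : Fin m ⊕ Fin (n - m)) => X (g s) ω)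
      = Measure.pi fun _ => P.map (X (n - 1)) := by
    have h := hind.map_fun_eq_pi_map fun s => (hXm _ (g s).2).aemeasurable
    refine h.trans ?_
    congr 1
    ext1 s
    exact (hXd _ _ (g s).2 (by omega)).map_eq
  refine ⟨hrow.prodMk hheld, ?_⟩
  have hsum := measurePreserving_sumPiEquivProdPi
    (fun _ : Fin m ⊕ Fin (n - m) => P.map (X (n - 1)))
  rw [← hsum.map_eq, ← hlaw, Measure.map_map hsum.measurable
    (measurable_pi_lambda _ fun s => hXm _ (g s).2)]
  rfl

lemma measurePreserving_row_copy (hmn : m < n) (hXm : ∀ i, i < n → Measurable (X i))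
    (hXi : iIndepFun (fun i : Fin n => X i) P)
    (hXd : ∀ i j, i < n → j < n → IdentDistrib (X i) (X j) P P)
    {Y : Ω → Fin (n - m) → Fin d → ℝ} (hY : IsIndepCopy P X m n Y) :
    MeasurePreserving (fun ω => (row X m ω, Y ω)) P
      ((Measure.pi fun _ : Fin m => P.map (X (n - 1))).prod
        (Measure.pi fun _ : Fin (n - m) => P.map (X (n - 1)))) := by
  have : IsProbabilityMeasure (P.map (X (n - 1))) :=
    Measure.isProbabilityMeasure_map (hXm _ (by omega)).aemeasurable
  have hrow : Measurable (row X m) := measurable_row fun i hi => hXm i (hi.trans hmn)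
  have h := measurePreserving_row_heldOut hmn hXm hXi hXd
  have h1 : P.map (row X m) = Measure.pi fun _ : Fin m => P.map (X (n - 1)) :=
    (measurePreserving_fst.comp h).map_eq
  have h2 : P.map (heldOut X m n) = Measure.pi fun _ : Fin (n - m) => P.map (X (n - 1)) :=
    (measurePreserving_snd.comp h).map_eq
  have hhead : Measurable fun (r : Fin n → Fin d → ℝ) (i : Fin m) => r (Fin.castLE hmn.le i) :=
    measurable_pi_lambda _ fun i => measurable_pi_apply _
  have hind : IndepFun (row X m) Y P := (hY.2.2.comp measurable_id hhead).symm
  refine ⟨hrow.prodMk hY.1, ?_⟩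
  rw [(indepFun_iff_map_prod_eq_prod_map_map hrow.aemeasurable hY.1.aemeasurable).1 hind,
    hY.2.1.map_eq, h1, h2]

end Laws

/-! ### The essential bounds -/

section Bounds

variable {Ω : Type*} [MeasurableSpace Ω] {P : Measure Ω} [IsProbabilityMeasure P]
  {d d' m n p : ℕ} {X : ℕ → Ω → (Fin d → ℝ)} {L : (Fin d → ℝ) → (Fin d' → ℝ) → ℝ}
  {θ : Fin p → (Fin m → Fin d → ℝ) → (Fin d → ℝ) → (Fin d' → ℝ)}

lemma continuous_partialLoss (hL : ContDiff ℝ ((⊤ : ℕ∞) : WithTop ℕ∞)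
      (fun q : (Fin d → ℝ) × (Fin d' → ℝ) => L q.1 q.2)) (l : Fin d') :
    Continuous fun q : (Fin d → ℝ) × (Fin d' → ℝ) => partialLoss L l q.1 q.2 := by
  have hL' : ContDiff ℝ 1 (Function.uncurry fun (q : (Fin d → ℝ) × (Fin d' → ℝ)) => L q.1) := by
    have h : ContDiff ℝ ((⊤ : ℕ∞) : WithTop ℕ∞)
        fun w : ((Fin d → ℝ) × (Fin d' → ℝ)) × (Fin d' → ℝ) => L w.1.1 w.2 :=
      hL.comp (g := fun q : (Fin d → ℝ) × (Fin d' → ℝ) => L q.1 q.2)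
        ((contDiff_fst.comp contDiff_fst).prodMk contDiff_snd)
    exact h.of_le (by exact_mod_cast le_top)
  have h := ContDiff.fderiv (n := 0) hL' (contDiff_snd (E := Fin d → ℝ) (F := Fin d' → ℝ))
    (by norm_num)
  exact h.continuous.clm_apply continuous_const

lemma differentiable_loss (hL : ContDiff ℝ ((⊤ : ℕ∞) : WithTop ℕ∞)
      (fun q : (Fin d → ℝ) × (Fin d' → ℝ) => L q.1 q.2)) (x : Fin d → ℝ) :
    Differentiable ℝ (L x) := by
  have h : ContDiff ℝ ((⊤ : ℕ∞) : WithTop ℕ∞) (fun y : Fin d' → ℝ => L x y) :=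
    hL.comp (contDiff_const.prodMk contDiff_id)
  exact h.differentiable (by simp)

lemma abs_le_toReal_of_enorm_le {a : ℝ} {b : ℝ≥0∞} (hb : b ≠ ∞) (h : ‖a‖ₑ ≤ b) :
    |a| ≤ b.toReal := by
  rw [← Real.norm_eq_abs, ← toReal_enorm]
  exact ENNReal.toReal_mono hb h

/-- Since `m ≤ n - 1`, the last observation is independent of the training part, so the essential
bounds on `Ω` become almost sure bounds for a product law. Transfer needs measurable sets: the bound
on the derivatives is transferred for a countable dense set of weights and extended to the simplex
by continuity. -/
lemma ae_mem_goodPoints (hmn : m < n) (hXm : ∀ i, i < n → Measurable (X i))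
    (hXi : iIndepFun (fun i : Fin n => X i) P)
    (hXd : ∀ i j, i < n → j < n → IdentDistrib (X i) (X j) P P)
    (hL : ContDiff ℝ ((⊤ : ℕ∞) : WithTop ℕ∞)
      (fun q : (Fin d → ℝ) × (Fin d' → ℝ) => L q.1 q.2))
    (hθ : ∀ k, Measurable fun q : (Fin m → Fin d → ℝ) × (Fin d → ℝ) => θ k q.1 q.2)
    (hT : estimatorBound P θ X n ≠ ∞) (hLb : lossBound P L θ X n ≠ ∞) :
    ∀ᵐ q ∂((Measure.pi fun _ : Fin m => P.map (X (n - 1))).prod (P.map (X (n - 1)))),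
      q.2 ∈ goodPoints L θ (estimatorBound P θ X n).toReal (lossBound P L θ X n).toReal q.1 := by
  set T := (estimatorBound P θ X n).toReal with hTd
  set Λ := (lossBound P L θ X n).toReal with hΛd
  have hμ : IsProbabilityMeasure (P.map (X (n - 1))) :=
    Measure.isProbabilityMeasure_map (hXm _ (by omega)).aemeasurable
  have hmp : MeasurePreserving (fun ω => (row X m ω, X (n - 1) ω)) P
      ((Measure.pi fun _ : Fin m => P.map (X (n - 1))).prod (P.map (X (n - 1)))) := by
    have h1 := measurePreserving_row_heldOut hmn hXm hXi hXd
    have h2 := (MeasurePreserving.id (Measure.pi fun _ : Fin m => P.map (X (n - 1)))).prod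
      (measurePreserving_eval (fun _ : Fin (n - m) => P.map (X (n - 1)))
        (⟨n - 1 - m, by omega⟩ : Fin (n - m)))
    convert h2.comp h1 using 1
    ext1 ω
    simp only [Function.comp, Prod.map, id, heldOut, Function.eval]
    congr 2
    omega
  have transfer : ∀ S : Set ((Fin m → Fin d → ℝ) × (Fin d → ℝ)), MeasurableSet S →
      (∀ᵐ ω ∂P, (row X m ω, X (n - 1) ω) ∈ S) →
      ∀ᵐ q ∂((Measure.pi fun _ : Fin m => P.map (X (n - 1))).prod (P.map (X (n - 1)))), q ∈ S := by
    intro S hS h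
    rw [← hmp.map_eq]
    exact (ae_map_iff hmp.aemeasurable hS).2 h
  have m1 : ∀ k l, Measurable fun q : (Fin m → Fin d → ℝ) × (Fin d → ℝ) => θ k q.1 q.2 l :=
    fun k l => (measurable_pi_apply l).comp (hθ k)
  have a1 : ∀ k l, ∀ᵐ q ∂((Measure.pi fun _ : Fin m => P.map (X (n - 1))).prod
      (P.map (X (n - 1)))), |θ k q.1 q.2 l| ≤ T := fun k l => by
    refine transfer {q | |θ k q.1 q.2 l| ≤ T} (measurableSet_le (m1 k l).abs measurable_const) ?_
    filter_upwards [ENNReal.ae_le_essSup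
      (fun ω => ⨆ k : Fin p, ‖θ k (row X m ω) (X (n - 1) ω) l‖ₑ) (μ := P)] with ω hω
    refine abs_le_toReal_of_enorm_le hT ?_
    refine (le_iSup (fun k : Fin p => ‖θ k (row X m ω) (X (n - 1) ω) l‖ₑ) k).trans
      (hω.trans ?_)
    exact le_sup_of_le_left (le_iSup (fun l : Fin d' => essSup (fun ω => ⨆ k : Fin p,
      ‖θ k (row X m ω) (X (n - 1) ω) l‖ₑ) P) l)
  have a2 : ∀ k, ∀ᵐ q ∂((Measure.pi fun _ : Fin m => P.map (X (n - 1))).prod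
      (P.map (X (n - 1)))), |L q.2 (θ k q.1 q.2)| ≤ Λ := fun k => by
    have hm : Measurable fun q : (Fin m → Fin d → ℝ) × (Fin d → ℝ) => L q.2 (θ k q.1 q.2) :=
      hL.continuous.measurable.comp (measurable_snd.prodMk (hθ k))
    refine transfer {q | |L q.2 (θ k q.1 q.2)| ≤ Λ} (measurableSet_le hm.abs measurable_const) ?_
    filter_upwards [ENNReal.ae_le_essSup
      (fun ω => ⨆ k : Fin p, ‖L (X (n - 1) ω) (θ k (row X m ω) (X (n - 1) ω))‖ₑ) (μ := P)]
      with ω hω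
    refine abs_le_toReal_of_enorm_le hLb ?_
    refine (le_iSup (fun k : Fin p => ‖L (X (n - 1) ω) (θ k (row X m ω) (X (n - 1) ω))‖ₑ)
      k).trans (hω.trans ?_)
    exact le_sup_of_le_left le_sup_left
  have cont : ∀ (l : Fin d') (u : Fin m → Fin d → ℝ) (x : Fin d → ℝ),
      Continuous fun w : Fin p → ℝ => partialLoss L l x (∑ k, w k • θ k u x) := fun l u x => by
    have h1 : Continuous fun w : Fin p → ℝ => ∑ k, w k • θ k u x := by fun_prop
    exact (continuous_partialLoss hL l).comp (continuous_const.prodMk h1)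
  obtain ⟨D, hDs, hDc, hDd⟩ := (TopologicalSpace.IsSeparable.of_separableSpace
    (stdSimplex ℝ (Fin p))).exists_countable_dense_subset
  have a3 : ∀ l, ∀ᵐ q ∂((Measure.pi fun _ : Fin m => P.map (X (n - 1))).prod
      (P.map (X (n - 1)))), ∀ w ∈ D, |partialLoss L l q.2 (∑ k, w k • θ k q.1 q.2)| ≤ Λ := by
    intro l
    refine (ae_ball_iff hDc).2 fun w hw => ?_
    have hm : Measurable fun q : (Fin m → Fin d → ℝ) × (Fin d → ℝ) =>
        partialLoss L l q.2 (∑ k, w k • θ k q.1 q.2) :=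
      (continuous_partialLoss hL l).measurable.comp
        (measurable_snd.prodMk (Finset.measurable_sum Finset.univ (f := fun k (q : (Fin m → Fin d → ℝ) × (Fin d → ℝ)) =>
          w k • θ k q.1 q.2) fun k _ => (hθ k).const_smul (w k)))
    refine transfer {q | |partialLoss L l q.2 (∑ k, w k • θ k q.1 q.2)| ≤ Λ}
      (measurableSet_le hm.abs measurable_const) ?_
    filter_upwards [ENNReal.ae_le_essSup (fun ω => ⨆ w ∈ stdSimplex ℝ (Fin p),
      ‖partialLoss L l (X (n - 1) ω) (∑ k, w k • θ k (row X m ω) (X (n - 1) ω))‖ₑ) (μ := P)]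
      with ω hω
    refine abs_le_toReal_of_enorm_le hLb ?_
    refine (le_iSup₂ (f := fun (w : Fin p → ℝ) (_ : w ∈ stdSimplex ℝ (Fin p)) =>
      ‖partialLoss L l (X (n - 1) ω) (∑ k, w k • θ k (row X m ω) (X (n - 1) ω))‖ₑ) w
      (hDs hw)).trans (hω.trans ?_)
    refine le_sup_of_le_left (le_sup_of_le_right ?_)
    exact le_iSup (fun l : Fin d' => essSup (fun ω => ⨆ w ∈ stdSimplex ℝ (Fin p),
      ‖partialLoss L l (X (n - 1) ω) (∑ k, w k • θ k (row X m ω) (X (n - 1) ω))‖ₑ) P) l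
  filter_upwards [ae_all_iff.2 fun k => ae_all_iff.2 (a1 k), ae_all_iff.2 a2, ae_all_iff.2 a3]
    with q h1 h2 h3
  refine ⟨h1, h2, fun l w hw => ?_⟩
  have hcl : IsClosed {w : Fin p → ℝ | |partialLoss L l q.2 (∑ k, w k • θ k q.1 q.2)| ≤ Λ} :=
    isClosed_le (cont l q.1 q.2).abs continuous_const
  exact closure_minimal (h3 l) hcl (hDd hw)

end Bounds

/-! ### Conditional laws of centered sums -/

section Empirical

variable {d N : ℕ}

lemma integral_empiricalMeasure (v : Fin N → Fin d → ℝ) (f : (Fin d → ℝ) → ℝ) :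
    ∫ x, f x ∂empiricalMeasure v = 1 / (N : ℝ) * ∑ j, f (v j) := by
  rw [empiricalMeasure, integral_smul_measure,
    integral_finsetSum_measure fun j _ => integrable_dirac (by simp)]
  simp [integral_dirac]

lemma isProbabilityMeasure_empiricalMeasure (hN : 0 < N) (v : Fin N → Fin d → ℝ) :
    IsProbabilityMeasure (empiricalMeasure v) := by
  constructor
  have : (N : ℝ≥0∞) ≠ 0 := by exact_mod_cast hN.ne'
  simp [empiricalMeasure, ENNReal.inv_mul_cancel this (ENNReal.natCast_ne_top N)]

lemma stdDev_empiricalMeasure (v : Fin N → Fin d → ℝ) (f : (Fin d → ℝ) → ℝ) :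
    stdDev (empiricalMeasure v) f = sampleStdDev f v := by
  simp only [stdDev, sampleStdDev, integral_empiricalMeasure]

end Empirical

/-- Serves both centrings, with `ν` the empirical law of the held-out points or the law of one
observation. -/
lemma scaledSum_sub_integral {E : Type*} [MeasurableSpace E] {ν : Measure E}
    [IsProbabilityMeasure ν] {f : E → ℝ} {N : ℕ} (hf : Integrable f ν) (z : Fin N → E) :
    1 / √(N : ℝ) * ∑ i, f (z i)
        - ∫ y, 1 / √(N : ℝ) * ∑ i, f (y i) ∂(Measure.pi fun _ : Fin N => ν)
      = 1 / √(N : ℝ) * ∑ i, (f (z i) - ∫ x, f x ∂ν) := by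
  have hi : ∀ i : Fin N, Integrable (fun y : Fin N → E => f (y i)) (Measure.pi fun _ => ν) :=
    fun i => (measurePreserving_eval (fun _ : Fin N => ν) i).integrable_comp_of_integrable hf
  have he : ∀ i : Fin N, ∫ y : Fin N → E, f (y i) ∂(Measure.pi fun _ => ν) = ∫ x, f x ∂ν :=
    fun i => integral_comp_eval (μ := fun _ : Fin N => ν) hf.1
  rw [integral_const_mul, integral_finsetSum _ fun i _ => hi i, Finset.sum_sub_distrib, mul_sub]
  simp only [he]

lemma abs_scaledSum_le {S : Type*} {d N : ℕ} {g : S → (Fin d → ℝ) → ℝ} {M : ℝ}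
    (hM : ∀ r x, |g r x| ≤ M) (q : S × (Fin N → Fin d → ℝ)) :
    |1 / √(N : ℝ) * ∑ i, g q.1 (q.2 i)| ≤ 1 / √(N : ℝ) * (N * M) := by
  rw [abs_mul, abs_of_nonneg (by positivity)]
  refine mul_le_mul_of_nonneg_left ?_ (by positivity)
  refine (Finset.abs_sum_le_sum_abs _ _).trans ((Finset.sum_le_sum fun i _ => hM _ _).trans ?_)
  simp

section Array

variable {Ω S : Type*} {𝒢 : MeasurableSpace Ω} [MeasurableSpace Ω] [mS : MeasurableSpace S] {P : Measure Ω}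
  [IsProbabilityMeasure P] {d N : ℕ} {R : Ω → S} {V : S → Fin N → Fin d → ℝ}
  {Z Y : Ω → Fin N → Fin d → ℝ} {μ : Measure (Fin d → ℝ)} [IsProbabilityMeasure μ]
  {g : S → (Fin d → ℝ) → ℝ} {M : ℝ}

lemma measurable_scaledSum (hg : Measurable (Function.uncurry g)) {a : S → ℝ} (ha : Measurable a) :
    Measurable fun q : S × (Fin N → Fin d → ℝ) => 1 / √(N : ℝ) * ∑ i, (g q.1 (q.2 i) - a q.1) := by
  refine measurable_const.mul (Finset.measurable_sum _ fun i _ => ?_)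
  exact (hg.comp (measurable_fst.prodMk ((measurable_pi_apply i).comp measurable_snd))).sub
    (ha.comp measurable_fst)

lemma measurable_uncurried_section (hg : Measurable (Function.uncurry g)) (r : S) :
    Measurable (g r) := hg.comp measurable_prodMk_left

/-- The bootstrap risk, centered at its conditional expectation. -/
lemma bootstrap_centering (hN : 0 < N) (hR : Measurable R) (hZ : Measurable Z)
    (hlaw : ∀ᵐ ω ∂P, condDistrib Z R P (R ω) = Measure.pi fun _ => empiricalMeasure (V (R ω)))
    (hg : Measurable (Function.uncurry g)) (hM : ∀ r x, |g r x| ≤ M) :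
    (fun ω => 1 / √(N : ℝ) * ∑ i, g (R ω) (Z ω i)
        - (P[fun ω => 1 / √(N : ℝ) * ∑ i, g (R ω) (Z ω i) | MeasurableSpace.comap R mS]) ω)
      =ᵐ[P] fun ω => 1 / √(N : ℝ)
        * ∑ i, (g (R ω) (Z ω i) - 1 / (N : ℝ) * ∑ j, g (R ω) (V (R ω) j)) := by
  have hm : Measurable fun q : S × (Fin N → Fin d → ℝ) => 1 / √(N : ℝ) * ∑ i, g q.1 (q.2 i) := by
    simpa using measurable_scaledSum (N := N) hg (a := fun _ => 0) measurable_const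
  have h := condExp_prod_ae_eq_integral_condDistrib (μ := P) hR hZ.aemeasurable
    hm.stronglyMeasurable (integrable_of_measurable_of_bound (hm.comp (hR.prodMk hZ))
      fun ω => abs_scaledSum_le hM _)
  filter_upwards [h, hlaw] with ω h1 h2
  have := isProbabilityMeasure_empiricalMeasure hN (V (R ω))
  rw [h1, h2]
  rw [scaledSum_sub_integral (integrable_of_measurable_of_bound
    (measurable_uncurried_section hg _) (hM _))]
  simp only [integral_empiricalMeasure]

/-- The risk on an independent copy, centered at its conditional expectation. -/
lemma copy_centering (hR : Measurable R) (hY : Measurable Y)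
    (hYR : IndepFun Y R P) (hlaw : P.map Y = Measure.pi fun _ => μ)
    (hg : Measurable (Function.uncurry g)) (hM : ∀ r x, |g r x| ≤ M)
    (h𝒢 : 𝒢 ≤ MeasurableSpace.comap R mS)
    (hsec : ∀ x, Measurable[𝒢] fun ω => g (R ω) x) :
    (fun ω => 1 / √(N : ℝ) * ∑ i, g (R ω) (Y ω i)
        - (P[fun ω => 1 / √(N : ℝ) * ∑ i, g (R ω) (Y ω i) | 𝒢]) ω)
      =ᵐ[P] fun ω => 1 / √(N : ℝ) * ∑ i, (g (R ω) (Y ω i) - ∫ x, g (R ω) x ∂μ) := by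
  have hm : Measurable fun q : S × (Fin N → Fin d → ℝ) => 1 / √(N : ℝ) * ∑ i, g q.1 (q.2 i) := by
    simpa using measurable_scaledSum (N := N) hg (a := fun _ => 0) measurable_const
  have h := condExp_ae_eq_integral_of_section hR hY hYR hm (fun q => abs_scaledSum_le hM q) h𝒢
    (fun y => by
      exact (Finset.measurable_sum _ fun i _ => hsec (y i)).const_mul _)
  filter_upwards [h] with ω h1
  rw [h1, hlaw]
  exact scaledSum_sub_integral (integrable_of_measurable_of_bound
    (measurable_uncurried_section hg _) (hM _)) _

/-- Comparison of the conditional laws of the two centered risks. -/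
lemma abs_integral_condDistrib_sub_le (hN : 0 < N) (hR : Measurable R) (hV : Measurable V)
    (hZ : Measurable Z)
    (hZlaw : ∀ᵐ ω ∂P, condDistrib Z R P (R ω) = Measure.pi fun _ => empiricalMeasure (V (R ω)))
    (hY : Measurable Y) (hYR : IndepFun Y R P) (hYlaw : P.map Y = Measure.pi fun _ => μ)
    (hg : Measurable (Function.uncurry g)) (hM : ∀ r x, |g r x| ≤ M)
    (h𝒢 : 𝒢 ≤ MeasurableSpace.comap R mS)
    (hsec : ∀ x, Measurable[𝒢] fun ω => g (R ω) x) :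
    ∀ᵐ ω ∂P, ∀ h ∈ testFunctions,
      |∫ x, h x ∂condDistrib (fun ω => 1 / √(N : ℝ) * ∑ i, g (R ω) (Z ω i)
          - (P[fun ω => 1 / √(N : ℝ) * ∑ i, g (R ω) (Z ω i) | MeasurableSpace.comap R mS]) ω)
            R P (R ω)
        - ∫ x, h x ∂condDistrib (fun ω => 1 / √(N : ℝ) * ∑ i, g (R ω) (Y ω i)
          - (P[fun ω => 1 / √(N : ℝ) * ∑ i, g (R ω) (Y ω i) | 𝒢]) ω) R P (R ω)|
      ≤ 112 * M / √(N : ℝ) + |sampleStdDev (g (R ω)) (V (R ω)) - stdDev μ (g (R ω))| := by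
  have haB : Measurable fun r => 1 / (N : ℝ) * ∑ j, g r (V r j) :=
    (Finset.measurable_sum _ fun j _ => hg.comp
      (measurable_id.prodMk ((measurable_pi_apply j).comp hV))).const_mul _
  have haC : Measurable fun r => ∫ x, g r x ∂μ :=
    hg.stronglyMeasurable.integral_prod_right'.measurable
  have hFB := measurable_scaledSum (N := N) hg haB
  have hFC := measurable_scaledSum (N := N) hg haC
  have hcY := ae_of_ae_map hR.aemeasurable (condDistrib_ae_eq_map_of_indepFun hR hY hYR)
  rw [condDistrib_congr_left (bootstrap_centering hN hR hZ hZlaw hg hM),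
    condDistrib_congr_left (copy_centering hR hY hYR hYlaw hg hM h𝒢 hsec)]
  -- The exceptional sets are chosen before `h` is introduced, so a single null set serves the whole
  -- uncountable class of test functions.
  filter_upwards [condDistrib_comp_prodMk hR hZ hFB, condDistrib_comp_prodMk hR hY hFC, hZlaw,
    hcY] with ω h1 h2 h3 h4 h hh
  have hprob := isProbabilityMeasure_empiricalMeasure hN (V (R ω))
  have hhc : Continuous h := hh.1.continuous
  have hd : ∀ x, HasDerivAt h (deriv h x) x := fun x =>
    ((hh.1.differentiable (by norm_num)) x).hasDerivAt
  have hb : ∀ x, |deriv h x| ≤ 1 := fun x => by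
    simpa [iteratedDeriv_one] using hh.2 1 le_rfl (by norm_num) x
  have m1 : Measurable fun z : Fin N → Fin d → ℝ =>
      1 / √(N : ℝ) * ∑ i, (g (R ω) (z i) - 1 / (N : ℝ) * ∑ j, g (R ω) (V (R ω) j)) :=
    hFB.comp measurable_prodMk_left
  have m2 : Measurable fun z : Fin N → Fin d → ℝ =>
      1 / √(N : ℝ) * ∑ i, (g (R ω) (z i) - ∫ x, g (R ω) x ∂μ) :=
    hFC.comp measurable_prodMk_left
  rw [h1, h2, h3, h4, Kernel.const_apply, hYlaw,
    integral_map m1.aemeasurable hhc.aestronglyMeasurable,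
    integral_map m2.aemeasurable hhc.aestronglyMeasurable]
  have hgm := measurable_uncurried_section hg (R ω)
  -- Triangle inequality through two Gaussian laws: `56 * M / √N` for each approximation, then the
  -- gap between the standard deviations.
  have n1 := normal_approximation (ν := empiricalMeasure (V (R ω))) hN hgm
    (ae_of_all _ (hM (R ω))) hd hb
  have n2 := normal_approximation (ν := μ) hN hgm (ae_of_all _ (hM (R ω))) hd hb
  have n3 := abs_integral_gaussian_scale_sub_le hd hb (sampleStdDev (g (R ω)) (V (R ω)))
    (stdDev μ (g (R ω)))
  simp only [integral_empiricalMeasure, stdDev_empiricalMeasure] at n1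
  rw [abs_le] at n1 n2 n3 ⊢
  have e : 112 * M / √(N : ℝ) = 56 * M / √(N : ℝ) + 56 * M / √(N : ℝ) := by ring
  rw [e]
  constructor <;> linarith [n1.1, n1.2, n2.1, n2.2, n3.1, n3.2]

end Array

lemma ae_empiricalMeasure_mem_range {d N : ℕ} (v : Fin N → Fin d → ℝ) :
    ∀ᵐ x ∂empiricalMeasure v, x ∈ Set.range v := by
  rw [ae_iff]
  simp [empiricalMeasure]

lemma abs_stdDev_le {E : Type*} [MeasurableSpace E] {ν : Measure E} [IsProbabilityMeasure ν]
    {f : E → ℝ} {M : ℝ} (hM : ∀ x, |f x| ≤ M) : |stdDev ν f| ≤ 2 * M := by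
  have h0 : 0 ≤ M := by
    have : Nonempty E := nonempty_of_isProbabilityMeasure ν
    exact (abs_nonneg _).trans (hM (Classical.arbitrary E))
  have hi : |∫ x, f x ∂ν| ≤ M := abs_integral_le_of_forall (ae_of_all _ hM)
  rw [stdDev, abs_of_nonneg (Real.sqrt_nonneg _)]
  refine Real.sqrt_le_iff.2 ⟨by linarith, (le_abs_self _).trans
    (abs_integral_le_of_forall (ae_of_all _ fun x => ?_))⟩
  rw [abs_of_nonneg (sq_nonneg _)]
  refine sq_le_sq' ?_ ?_ <;> linarith [(abs_le.1 hi).1, (abs_le.1 hi).2, (abs_le.1 (hM x)).1,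
    (abs_le.1 (hM x)).2]

/-! ### The two centered risks for one row -/

section Deterministic

variable {Ω : Type*} {d d' m n p : ℕ} {β : ℝ} {X : ℕ → Ω → (Fin d → ℝ)}
  {L : (Fin d → ℝ) → (Fin d' → ℝ) → ℝ}
  {θ : Fin p → (Fin m → Fin d → ℝ) → (Fin d → ℝ) → (Fin d' → ℝ)}

/-- The first `m` entries of a row. -/
def rowHead (hmn : m < n) (r : Fin n → Fin d → ℝ) : Fin m → Fin d → ℝ :=
  fun i => r (Fin.castLE hmn.le i)

/-- The entries of a row after the first `m`. -/
def rowTail (m : ℕ) (r : Fin n → Fin d → ℝ) : Fin (n - m) → Fin d → ℝ :=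
  fun j => r ⟨m + j, by omega⟩

lemma measurable_rowHead (hmn : m < n) : Measurable (rowHead (d := d) hmn) :=
  measurable_pi_lambda _ fun _ => measurable_pi_apply _

lemma measurable_rowTail (m : ℕ) : Measurable (rowTail (d := d) (n := n) m) :=
  measurable_pi_lambda _ fun _ => measurable_pi_apply _

lemma measurable_rowHead_rowTail (hmn : m < n) :
    Measurable fun r : Fin n → Fin d → ℝ => (rowHead hmn r, rowTail m r) := by
  have h1 : Measurable fun r : Fin n → Fin d → ℝ => rowHead hmn r := measurable_rowHead hmn
  have h2 : Measurable fun r : Fin n → Fin d → ℝ => rowTail m r := measurable_rowTail m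
  exact h1.prodMk h2

/-- The loss of the ensemble as a function of the row, cut at the level `M`. -/
noncomputable def cutLoss (L : (Fin d → ℝ) → (Fin d' → ℝ) → ℝ)
    (θ : Fin p → (Fin m → Fin d → ℝ) → (Fin d → ℝ) → (Fin d' → ℝ)) (β M : ℝ) (hmn : m < n)
    (r : Fin n → Fin d → ℝ) (x : Fin d → ℝ) : ℝ :=
  max (-M) (min (stackedLoss L θ β (rowHead hmn r) (rowTail m r) x) M)

lemma abs_cutLoss_le {M : ℝ} (hM : 0 ≤ M) (hmn : m < n) (r : Fin n → Fin d → ℝ) (x : Fin d → ℝ) :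
    |cutLoss L θ β M hmn r x| ≤ M :=
  abs_le.2 ⟨le_max_left _ _, max_le (by linarith) (min_le_right _ _)⟩

lemma measurable_cutLoss {M : ℝ} (hmn : m < n)
    (hL : Continuous fun q : (Fin d → ℝ) × (Fin d' → ℝ) => L q.1 q.2)
    (hθ : ∀ k, Measurable fun q : (Fin m → Fin d → ℝ) × (Fin d → ℝ) => θ k q.1 q.2) :
    Measurable (Function.uncurry (cutLoss L θ β M hmn)) := by
  have h0 : Measurable (Prod.snd : (Fin n → Fin d → ℝ) × (Fin d → ℝ) → Fin d → ℝ) :=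
    measurable_snd
  have h1 := ((measurable_rowHead_rowTail (d := d) hmn).comp measurable_fst).prodMk h0
  have h2 := (measurable_stackedLoss (β := β) hL hθ).comp h1
  exact measurable_const.max (h2.min measurable_const)

lemma cutLoss_eq {T Λ : ℝ} (hmn : m < n) (hp : 0 < p) (hd' : 0 < d')
    (hL : ∀ x, Differentiable ℝ (L x)) (hΛ : 0 ≤ Λ) (hT : 1 ≤ T) {ω : Ω} {x : Fin d → ℝ}
    (hx : x ∈ goodPoints L θ T Λ (row X m ω)) :
    cutLoss L θ β (3 * (Λ * d' * T)) hmn (row X n ω) x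
      = stackedLoss L θ β (row X m ω) (heldOut X m n ω) x := by
  have h : |stackedLoss L θ β (row X m ω) (heldOut X m n ω) x| ≤ 3 * (Λ * d' * T) :=
    abs_loss_le hp hd' (hL x) hx hΛ hT (weight_mem_stdSimplex hp _ _)
  have h' := abs_le.1 h
  change max _ (min (stackedLoss L θ β (row X m ω) (heldOut X m n ω) x) _) = _
  rw [min_eq_left h'.2, max_eq_right h'.1]

lemma ensembleSigma_le_rowSigma (hmn : m < n)
    (hL : Continuous fun q : (Fin d → ℝ) × (Fin d' → ℝ) => L q.1 q.2)
    (hθ : ∀ k, Measurable fun q : (Fin m → Fin d → ℝ) × (Fin d → ℝ) => θ k q.1 q.2) :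
    ensembleSigma L θ β X n ≤ rowSigma X n := by
  refine measurable_iff_comap_le.1
    ((@measurable_pi_iff _ _ _ (rowSigma X n) _ (ensemble L θ β X n)).2 fun z => ?_)
  have h1 := (measurable_stackedPredictor (N := n - m) (β := β) hL hθ).comp
    ((measurable_rowHead_rowTail hmn).prodMk (measurable_const (a := z)))
  have h2 := @Measurable.comp _ _ _ (rowSigma X n) _ _ _ _ h1 (comap_measurable (row X n))
  exact h2

/-- At a fixed `x` the cut loss depends on the row only through the value of the ensemble at `x`.
This sectionwise measurability is what the centring given the ensemble requires. -/
lemma measurable_ensembleSigma_cutLoss {M : ℝ} (hmn : m < n)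
    (hL : Continuous fun q : (Fin d → ℝ) × (Fin d' → ℝ) => L q.1 q.2) (x : Fin d → ℝ) :
    Measurable[ensembleSigma L θ β X n] fun ω => cutLoss L θ β M hmn (row X n ω) x := by
  have h1 : Measurable fun f : (Fin d → ℝ) → (Fin d' → ℝ) => max (-M) (min (L x (f x)) M) := by
    have h2 : Continuous (L x) := hL.comp (continuous_const.prodMk continuous_id)
    exact measurable_const.max ((h2.measurable.comp (measurable_pi_apply x)).min measurable_const)
  exact h1.comp (comap_measurable (ensemble L θ β X n))

end Deterministic

section Row

variable {Ω : Type*} [MeasurableSpace Ω] {P : Measure Ω}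
  {d d' m n p : ℕ} {β : ℝ} {X : ℕ → Ω → (Fin d → ℝ)} {L : (Fin d → ℝ) → (Fin d' → ℝ) → ℝ}
  {θ : Fin p → (Fin m → Fin d → ℝ) → (Fin d → ℝ) → (Fin d' → ℝ)}
  {Z Y : Ω → Fin (n - m) → Fin d → ℝ}

lemma one_le_toReal_estimatorBound (hT : estimatorBound P θ X n ≠ ∞) :
    1 ≤ (estimatorBound P θ X n).toReal := by
  simpa using ENNReal.toReal_mono hT le_sup_right

lemma one_le_toReal_lossBound (hLb : lossBound P L θ X n ≠ ∞) :
    1 ≤ (lossBound P L θ X n).toReal := by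
  simpa using ENNReal.toReal_mono hLb le_sup_right

variable [IsProbabilityMeasure P]

/-- The entries of a bootstrap sample are held-out observations. -/
lemma ae_bootstrap_mem_range (hmn : m < n) (hXm : ∀ i, i < n → Measurable (X i))
    (hZ : IsBootstrapSample P X m n Z) :
    ∀ᵐ ω ∂P, ∀ i, Z ω i ∈ Set.range (heldOut X m n ω) := by
  have hrow := measurable_row hXm
  set S : Set ((Fin n → Fin d → ℝ) × (Fin (n - m) → Fin d → ℝ)) :=
    ⋂ i, ⋃ j, {q | q.2 i = rowTail m q.1 j} with hS
  have hSm : MeasurableSet S := MeasurableSet.iInter fun i => MeasurableSet.iUnion fun j =>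
    measurableSet_eq_fun ((measurable_pi_apply i).comp measurable_snd)
      ((measurable_pi_apply j).comp ((measurable_rowTail m).comp measurable_fst))
  have h0 : P.map (fun ω => (row X n ω, Z ω)) Sᶜ = 0 := by
    rw [← compProd_map_condDistrib hZ.1.aemeasurable, Measure.compProd_apply hSm.compl,
      lintegral_map (Kernel.measurable_kernel_prodMk_left hSm.compl) hrow]
    refine (lintegral_congr_ae (g := fun _ => 0) ?_).trans lintegral_zero
    filter_upwards [hZ.2] with ω hω
    have := isProbabilityMeasure_empiricalMeasure (Nat.sub_pos_of_lt hmn) (heldOut X m n ω)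
    rw [hω]
    have h1 : ∀ᵐ z ∂Measure.pi fun _ : Fin (n - m) => empiricalMeasure (heldOut X m n ω),
        ∀ i, z i ∈ Set.range (heldOut X m n ω) := ae_all_iff.2 fun i =>
      (measurePreserving_eval (fun _ : Fin (n - m) => empiricalMeasure (heldOut X m n ω))
        i).quasiMeasurePreserving.ae (ae_empiricalMeasure_mem_range _)
    refine measure_mono_null (fun z hz => ?_) (ae_iff.1 h1)
    intro h
    refine hz (Set.mem_iInter.2 fun i => ?_)
    obtain ⟨j, hj⟩ := h i
    exact Set.mem_iUnion.2 ⟨j, hj.symm⟩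
  rw [Measure.map_apply (hrow.prodMk hZ.1) hSm.compl] at h0
  filter_upwards [measure_eq_zero_iff_ae_notMem.1 h0] with ω hω i
  have hω' : (row X n ω, Z ω) ∈ S := not_not.1 hω
  obtain ⟨j, hj⟩ := Set.mem_iUnion.1 (Set.mem_iInter.1 hω' i)
  exact ⟨j, hj.symm⟩

/-- The conditional laws of the two centered risks are close in mean. -/
lemma exists_conditional_comparison (hmn : m < n) (hp : 0 < p) (hd' : 0 < d') (hβ : 0 < β)
    (hXm : ∀ i, i < n → Measurable (X i))
    (hXi : iIndepFun (fun i : Fin n => X i) P)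
    (hXd : ∀ i j, i < n → j < n → IdentDistrib (X i) (X j) P P)
    (hL : ContDiff ℝ ((⊤ : ℕ∞) : WithTop ℕ∞)
      (fun q : (Fin d → ℝ) × (Fin d' → ℝ) => L q.1 q.2))
    (hθ : ∀ k, Measurable fun q : (Fin m → Fin d → ℝ) × (Fin d → ℝ) => θ k q.1 q.2)
    (hT : estimatorBound P θ X n ≠ ∞) (hLb : lossBound P L θ X n ≠ ∞)
    (hZ : IsBootstrapSample P X m n Z) (hY : IsIndepCopy P X m n Y) {D : ℝ}
    (hD : D = (lossBound P L θ X n).toReal * d' * (estimatorBound P θ X n).toReal) :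
    ∃ ψ : Ω → ℝ, Integrable ψ P ∧ (∀ ω, 0 ≤ ψ ω) ∧
      (∀ᵐ ω ∂P, ∀ h ∈ testFunctions,
        |∫ x, h x ∂condDistrib (bootstrapCenteredRisk P L θ β X n Z) (row X n) P (row X n ω)
          - ∫ x, h x ∂condDistrib (copyCenteredRisk P L θ β X n Y) (row X n) P (row X n ω)|
          ≤ ψ ω) ∧
      ∫ ω, ψ ω ∂P ≤ 351 * D / √((n - m : ℕ) : ℝ)
        + 584 * (D * (Real.exp (4 * (β / (n - m : ℕ) * (lossBound P L θ X n).toReal)) - 1)) := by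
  have hT1 := one_le_toReal_estimatorBound hT
  have hΛ1 := one_le_toReal_lossBound hLb
  have hgood := ae_mem_goodPoints hmn hXm hXi hXd hL hθ hT hLb
  set T := (estimatorBound P θ X n).toReal
  set Λ := (lossBound P L θ X n).toReal
  set μ := P.map (X (n - 1)) with hμ
  have hμp : IsProbabilityMeasure μ :=
    Measure.isProbabilityMeasure_map (hXm _ (by omega)).aemeasurable
  have hN : 0 < n - m := Nat.sub_pos_of_lt hmn
  have hdr : (0 : ℝ) < d' := by exact_mod_cast hd'
  have hD0 : 0 < D := by rw [hD]; positivity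
  have hLd := differentiable_loss hL
  have hrow := measurable_row hXm
  have mp1 := measurePreserving_row_heldOut hmn hXm hXi hXd
  have mp2 := measurePreserving_row_copy hmn hXm hXi hXd hY
  have hgood' : ∀ᵐ u ∂Measure.pi fun _ : Fin m => μ, ∀ᵐ x ∂μ, x ∈ goodPoints L θ T Λ u :=
    Measure.ae_ae_of_ae_prod hgood
  have mp3 : ∀ i, MeasurePreserving
      (fun q : (Fin m → Fin d → ℝ) × (Fin (n - m) → Fin d → ℝ) => (q.1, q.2 i))
      ((Measure.pi fun _ => μ).prod (Measure.pi fun _ => μ)) ((Measure.pi fun _ => μ).prod μ) :=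
    fun i => (MeasurePreserving.id _).prod (measurePreserving_eval (fun _ : Fin (n - m) => μ) i)
  -- Almost surely every point that matters is good: `μ`-almost every point, the held-out points and
  -- with them the bootstrap sample, and the copy. At such points the cut at level `M` has no
  -- effect.
  have gμ : ∀ᵐ ω ∂P, ∀ᵐ x ∂μ, x ∈ goodPoints L θ T Λ (row X m ω) :=
    (measurePreserving_fst.comp mp1).quasiMeasurePreserving.ae hgood'
  have gV : ∀ᵐ ω ∂P, ∀ i, heldOut X m n ω i ∈ goodPoints L θ T Λ (row X m ω) :=
    ae_all_iff.2 fun i => ((mp3 i).comp mp1).quasiMeasurePreserving.ae hgood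
  have gY : ∀ᵐ ω ∂P, ∀ i, Y ω i ∈ goodPoints L θ T Λ (row X m ω) :=
    ae_all_iff.2 fun i => ((mp3 i).comp mp2).quasiMeasurePreserving.ae hgood
  set M := 3 * (Λ * d' * T) with hM
  have hM0 : 0 ≤ M := by positivity
  have hMD : M = 3 * D := by rw [hM, hD]
  set g := cutLoss L θ β M hmn
  have hgm : Measurable (Function.uncurry g) := measurable_cutLoss hmn hL.continuous hθ
  have hgb : ∀ r x, |g r x| ≤ M := abs_cutLoss_le hM0 hmn
  have hgeq : ∀ {ω : Ω} {x : Fin d → ℝ}, x ∈ goodPoints L θ T Λ (row X m ω) →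
      g (row X n ω) x = stackedLoss L θ β (row X m ω) (heldOut X m n ω) x := fun hx =>
    cutLoss_eq hmn hp hd' hLd (by linarith) hT1 hx
  have hsec : ∀ x, Measurable[ensembleSigma L θ β X n] fun ω => g (row X n ω) x :=
    measurable_ensembleSigma_cutLoss hmn hL.continuous
  clear_value g
  have eZ : ensembleRisk L θ β X n Z
      =ᵐ[P] fun ω => 1 / √((n - m : ℕ) : ℝ) * ∑ i, g (row X n ω) (Z ω i) := by
    filter_upwards [gV, ae_bootstrap_mem_range hmn hXm hZ] with ω h1 h2
    refine congrArg (_ * ·) (Finset.sum_congr rfl fun i _ => ?_)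
    obtain ⟨j, hj⟩ := h2 i
    exact (hgeq (hj ▸ h1 j)).symm
  have eY : ensembleRisk L θ β X n Y
      =ᵐ[P] fun ω => 1 / √((n - m : ℕ) : ℝ) * ∑ i, g (row X n ω) (Y ω i) := by
    filter_upwards [gY] with ω h1
    exact congrArg (_ * ·) (Finset.sum_congr rfl fun i _ => (hgeq (h1 i)).symm)
  have eB : bootstrapCenteredRisk P L θ β X n Z =ᵐ[P] _ :=
    eZ.sub (condExp_congr_ae (m := rowSigma X n) eZ)
  have eC : copyCenteredRisk P L θ β X n Y =ᵐ[P] _ :=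
    eY.sub (condExp_congr_ae (m := ensembleSigma L θ β X n) eY)
  have main := abs_integral_condDistrib_sub_le (P := P) (μ := μ) (R := row X n) (V := rowTail m)
    (Z := Z) (Y := Y) (g := g) (M := M) (𝒢 := ensembleSigma L θ β X n)
    hN hrow (measurable_rowTail m) hZ.1 hZ.2 hY.1 hY.2.2
    (measurePreserving_snd.comp mp2).map_eq hgm hgb
    (ensembleSigma_le_rowSigma hmn hL.continuous hθ) hsec
  set φ : Ω → ℝ := fun ω =>
    |sampleStdDev (g (row X n ω)) (rowTail m (row X n ω)) - stdDev μ (g (row X n ω))| with hφ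
  have hφm : Measurable φ := by
    have h1 := (measurable_sampleStdDev (N := n - m) hgm).comp
      (hrow.prodMk ((measurable_rowTail m).comp hrow))
    have h2 := (measurable_stdDev (μ := μ) hgm).comp hrow
    exact (h1.sub h2).abs
  have hφb : ∀ ω, |φ ω| ≤ 2 * M + 2 * M := fun ω => by
    have := isProbabilityMeasure_empiricalMeasure hN (rowTail m (row X n ω))
    rw [hφ]
    simp only [abs_abs]
    refine (abs_sub _ _).trans (add_le_add ?_ (abs_stdDev_le (hgb _)))
    rw [← stdDev_empiricalMeasure]
    exact abs_stdDev_le (hgb _)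
  have hφi : Integrable φ P := integrable_of_measurable_of_bound hφm hφb
  refine ⟨fun ω => 112 * M / √((n - m : ℕ) : ℝ) + φ ω, (integrable_const _).add hφi,
    fun ω => by positivity, ?_, ?_⟩
  · rw [condDistrib_congr_left eB, condDistrib_congr_left eC]
    exact main
  -- The gap is carried to the product space of training and held-out parts. For a fixed training
  -- part the held-out sample is i.i.d., and the stability estimate applies.
  set Δ : (Fin m → Fin d → ℝ) × (Fin (n - m) → Fin d → ℝ) → ℝ := fun q =>
    |sampleStdDev (stackedLoss L θ β q.1 q.2) q.2 - stdDev μ (stackedLoss L θ β q.1 q.2)| with hΔ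
  have hsl : Measurable (Function.uncurry
      fun q : (Fin m → Fin d → ℝ) × (Fin (n - m) → Fin d → ℝ) => stackedLoss L θ β q.1 q.2) :=
    measurable_stackedLoss hL.continuous hθ
  have hΔm : Measurable Δ := by
    have h1 := (measurable_sampleStdDev (N := n - m) hsl).comp
      (measurable_id.prodMk measurable_snd)
    exact (h1.sub (measurable_stdDev hsl)).abs
  have eφ : φ =ᵐ[P] fun ω => Δ (row X m ω, heldOut X m n ω) := by
    filter_upwards [gμ, gV] with ω h1 h2
    have s1 : sampleStdDev (g (row X n ω)) (rowTail m (row X n ω))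
        = sampleStdDev (stackedLoss L θ β (row X m ω) (heldOut X m n ω)) (heldOut X m n ω) := by
      have h3 : ∀ i, g (row X n ω) (rowTail m (row X n ω) i)
          = stackedLoss L θ β (row X m ω) (heldOut X m n ω) (heldOut X m n ω i) :=
        fun i => hgeq (h2 i)
      simp only [sampleStdDev, h3]
    have s2 : stdDev μ (g (row X n ω))
        = stdDev μ (stackedLoss L θ β (row X m ω) (heldOut X m n ω)) := by
      have h3 : g (row X n ω) =ᵐ[μ] stackedLoss L θ β (row X m ω) (heldOut X m n ω) := by
        filter_upwards [h1] with x hx using hgeq hx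
      rw [stdDev, stdDev, integral_congr_ae h3]
      congr 1
      exact integral_congr_ae (h3.mono fun x hx => by simp only [hx])
    simp only [hφ, hΔ, s1, s2]
  have hΔi : Integrable Δ ((Measure.pi fun _ => μ).prod (Measure.pi fun _ => μ)) :=
    (mp1.integrable_comp hΔm.aestronglyMeasurable).1 (hφi.congr eφ)
  have hint : ∫ ω, φ ω ∂P ≤ 5 * M / √((n - m : ℕ) : ℝ)
      + 584 * (Λ * d' * T * (Real.exp (4 * (β / (n - m : ℕ) * Λ)) - 1)) := by
    rw [integral_congr_ae eφ, ← integral_map mp1.aemeasurable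
      (f := Δ) hΔm.aestronglyMeasurable, mp1.map_eq, integral_prod _ hΔi]
    refine (integral_mono_of_nonneg (ae_of_all _ fun u => integral_nonneg fun v => abs_nonneg _)
      (integrable_const (5 * M / √((n - m : ℕ) : ℝ)
        + 584 * (Λ * d' * T * (Real.exp (4 * (β / (n - m : ℕ) * Λ)) - 1)))) ?_).trans
      (by simp)
    filter_upwards [hgood'] with u hu
    exact integral_abs_sampleStdDev_stackedLoss_sub_le hN hp hd' hβ hL.continuous hLd hθ hT1 hΛ1 hu
  rw [integral_add (integrable_const _) hφi]
  simp only [integral_const, probReal_univ, one_smul]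
  -- With `M = 3 * D`, the constant is `351 = 3 * (112 + 5)`.
  have e : 351 * D / √((n - m : ℕ) : ℝ)
      = 112 * M / √((n - m : ℕ) : ℝ) + 5 * M / √((n - m : ℕ) : ℝ) := by rw [hMD]; ring
  rw [e, add_assoc, hD]
  linarith

end Row

/-! ### From the conditional comparison to the limits -/

/-- The smoothed tail lies between the two indicators, and `K` rescales it to a test function. A
negative `t` makes the first tail the whole line, which forces `α ≥ 1`. -/
lemma real_tail_le {κ κ' : Measure ℝ} [IsProbabilityMeasure κ] [IsProbabilityMeasure κ']
    {K δ t ψ α : ℝ} (hδ : 0 < δ) (hK : 0 < K)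
    (hmem : ∀ t, (fun x => K⁻¹ * smoothTail t δ x) ∈ testFunctions) (hψ0 : 0 ≤ ψ)
    (hψ : ∀ h ∈ testFunctions, |∫ x, h x ∂κ - ∫ x, h x ∂κ'| ≤ ψ)
    (ht : κ.real {c | t ≤ |c|} ≤ α) :
    κ'.real {c | t + δ ≤ |c|} ≤ α + K * ψ := by
  have hKψ : 0 ≤ K * ψ := by positivity
  rcases lt_or_ge t 0 with ht0 | ht0
  · have h1 : {c : ℝ | t ≤ |c|} = Set.univ :=
      Set.eq_univ_of_forall fun c => ht0.le.trans (abs_nonneg c)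
    rw [h1, probReal_univ] at ht
    linarith [measureReal_le_one (μ := κ') (s := {c : ℝ | t + δ ≤ |c|})]
  have hS : ∀ s : ℝ, MeasurableSet {c : ℝ | s ≤ |c|} := fun s =>
    measurableSet_le measurable_const measurable_id.abs
  have hSb : ∀ x, |smoothTail t δ x| ≤ 1 := fun x => by
    rw [abs_of_nonneg (smoothTail_nonneg _ _ _)]
    exact (smoothTail_le_indicator ht0 hδ x).trans
      (Set.indicator_le_self' (fun _ _ => zero_le_one) x)
  have hSm : Measurable (smoothTail t δ) := (contDiff_smoothTail t δ).continuous.measurable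
  have h1 : κ'.real {c | t + δ ≤ |c|} ≤ ∫ x, smoothTail t δ x ∂κ' := by
    rw [← integral_indicator_one (hS _)]
    exact integral_mono ((integrable_const _).indicator (hS _))
      (integrable_of_measurable_of_bound hSm hSb) fun x => indicator_le_smoothTail hδ x
  have h2 : ∫ x, smoothTail t δ x ∂κ ≤ κ.real {c | t ≤ |c|} := by
    rw [← integral_indicator_one (hS _)]
    exact integral_mono (integrable_of_measurable_of_bound hSm hSb)
      ((integrable_const _).indicator (hS _)) fun x => smoothTail_le_indicator ht0 hδ x
  have h3 := (abs_le.1 (hψ _ (hmem t))).1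
  rw [integral_const_mul, integral_const_mul, ← mul_sub] at h3
  have h4 := mul_le_mul_of_nonneg_left h3 hK.le
  rw [mul_inv_cancel_left₀ hK.ne'] at h4
  linarith

/-- Cut of a conditional comparison to coarser information. -/
lemma measure_lt_condExp_le {Ω : Type*} {𝒢 ℱ mΩ : MeasurableSpace Ω} {P : Measure Ω}
    [IsProbabilityMeasure P] (h𝒢 : 𝒢 ≤ ℱ) (hℱ : ℱ ≤ mΩ) {f ψ : Ω → ℝ} {α K ε : ℝ}
    (hψ : Integrable ψ P) (hψ0 : ∀ ω, 0 ≤ ψ ω) (hK : 0 ≤ K) (hε : 0 < ε)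
    (h : P[f | ℱ] ≤ᵐ[P] fun ω => α + K * ψ ω) :
    P {ω | α + ε < (P[f | 𝒢]) ω} ≤ ENNReal.ofReal (K * (∫ ω, ψ ω ∂P) / ε) := by
  have hm := h𝒢.trans hℱ
  have hKψ : Integrable (fun ω => K * ψ ω) P := hψ.const_mul K
  have h1 : P[f | 𝒢] ≤ᵐ[P] fun ω => α + (P[fun ω => K * ψ ω | 𝒢]) ω := by
    have h2 := condExp_mono (m := 𝒢) integrable_condExp ((integrable_const α).add hKψ) h
    have h3 := condExp_add (m := 𝒢) (integrable_const α) hKψ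
    filter_upwards [condExp_condExp_of_le (f := f) h𝒢 hℱ, h2, h3] with ω e1 e2 e3
    rw [← e1]
    refine e2.trans (le_of_eq ?_)
    refine Eq.trans e3 ?_
    simp [condExp_const hm]
  have h0 : 0 ≤ᵐ[P] P[fun ω => K * ψ ω | 𝒢] :=
    condExp_nonneg (ae_of_all _ fun ω => mul_nonneg hK (hψ0 ω))
  -- Markov's inequality for the projection of `K * ψ`, which has the same mean as `K * ψ`.
  have hM := mul_meas_ge_le_integral_of_nonneg h0 integrable_condExp ε
  rw [integral_condExp hm, integral_const_mul] at hM
  have h4 : P {ω | α + ε < (P[f | 𝒢]) ω} ≤ P {ω | ε ≤ (P[fun ω => K * ψ ω | 𝒢]) ω} := by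
    refine measure_mono_ae ?_
    filter_upwards [h1] with ω hω hlt
    have : α + ε < (P[f | 𝒢]) ω := hlt
    change ε ≤ _
    linarith
  refine h4.trans ((ENNReal.le_ofReal_iff_toReal_le (measure_ne_top _ _) ?_).2 ?_)
  · exact div_nonneg (mul_nonneg hK (integral_nonneg hψ0)) hε.le
  · rw [le_div_iff₀ hε, mul_comm]
    exact hM

lemma measureReal_le_of_condExp_le {Ω : Type*} {ℱ mΩ : MeasurableSpace Ω} {P : Measure Ω}
    [IsProbabilityMeasure P] (hℱ : ℱ ≤ mΩ) {A : Set Ω} (hA : MeasurableSet A) {ψ : Ω → ℝ}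
    {α K : ℝ} (hψ : Integrable ψ P) (h : P⟦A | ℱ⟧ ≤ᵐ[P] fun ω => α + K * ψ ω) :
    P.real A ≤ α + K * ∫ ω, ψ ω ∂P := by
  have h1 : P.real A = ∫ ω, (P⟦A | ℱ⟧) ω ∂P := by
    rw [integral_condExp hℱ]
    exact (integral_indicator_one hA).symm
  rw [h1]
  refine (integral_mono_ae integrable_condExp ((integrable_const α).add (hψ.const_mul K))
    h).trans (le_of_eq ?_)
  rw [integral_add' (integrable_const α) (hψ.const_mul K), integral_const_mul]
  simp

/-- The rate `r` dominates `β * D / √N`, so `D / √N ≤ r / b`. The exponential term is of order `D *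
β * Λ / N = (β * D / √N) * (Λ / √N)`, and `Λ ≤ D` makes it at most `r * (r / b)`. -/
lemma error_le_of_rate {b β D Λ d T N r : ℝ} (hb : 0 < b) (hbβ : b ≤ β) (hd : 1 ≤ d) (hT : 1 ≤ T)
    (hΛ : 1 ≤ Λ) (hN : 1 ≤ N) (hD : D = Λ * d * T)
    (hr : β * d / √N * Λ * T * Real.exp (β / N * Λ) = r) (hr4 : r ≤ 1 / 4) :
    351 * D / √N + 584 * (D * (Real.exp (4 * (β / N * Λ)) - 1))
      ≤ 351 * (r / b) + 584 * (8 * (r * (r / b))) := by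
  have hβ : 0 < β := hb.trans_le hbβ
  have hs1 : 1 ≤ √N := Real.one_le_sqrt.2 hN
  have hs0 : 0 < √N := by linarith
  have hss : √N * √N = N := Real.mul_self_sqrt (by linarith)
  have hD0 : 0 < D := by rw [hD]; positivity
  have hΛD : Λ ≤ D := by
    rw [hD, mul_assoc]
    exact le_mul_of_one_le_right (by linarith) (one_le_mul_of_one_le_of_one_le hd hT)
  have hq0 : 0 ≤ β / N * Λ := by positivity
  have h1 : β * (D / √N) ≤ r := by
    rw [← hr, show β * d / √N * Λ * T * Real.exp (β / N * Λ)
      = β * (D / √N) * Real.exp (β / N * Λ) by rw [hD]; ring]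
    exact le_mul_of_one_le_right (by positivity) (Real.one_le_exp hq0)
  have h2 : D / √N ≤ r / b := by
    rw [le_div_iff₀ hb, mul_comm]
    exact (mul_le_mul_of_nonneg_right hbβ (by positivity)).trans h1
  have hr0 : 0 ≤ r := le_trans (by positivity) h1
  have e : β / N * Λ = β * (Λ / √N) / √N := by
    rw [show β * (Λ / √N) / √N = β * Λ / (√N * √N) by field_simp, hss]
    ring
  have hΛs : Λ / √N ≤ D / √N := by gcongr
  have h3 : β / N * Λ ≤ r := by
    rw [e]
    exact (div_le_self (by positivity) hs1).trans
      ((mul_le_mul_of_nonneg_left hΛs hβ.le).trans h1)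
  have h4 : Real.exp (4 * (β / N * Λ)) - 1 ≤ 8 * (β / N * Λ) := by
    -- The linear bound on `exp x - 1` asks for `|x| ≤ 1`; this is what `r ≤ 1 / 4` is for.
    have h := Real.abs_exp_sub_one_le (x := 4 * (β / N * Λ))
      (by rw [abs_of_nonneg (by positivity)]; linarith)
    rw [abs_of_nonneg (show 0 ≤ 4 * (β / N * Λ) by positivity)] at h
    linarith [le_abs_self (Real.exp (4 * (β / N * Λ)) - 1)]
  have h5 : D * (β / N * Λ) ≤ r * (r / b) := by
    rw [e, show D * (β * (Λ / √N) / √N) = β * (D / √N) * (Λ / √N) by ring]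
    exact mul_le_mul h1 (hΛs.trans h2) (by positivity) hr0
  have h6 := mul_le_mul_of_nonneg_left h4 hD0.le
  have h7 : 351 * D / √N = 351 * (D / √N) := by ring
  rw [h7]
  linarith

section Row

variable {Ω : Type*} [MeasurableSpace Ω] {P : Measure Ω} [IsProbabilityMeasure P]
  {d d' m n p : ℕ} {β : ℝ} {X : ℕ → Ω → (Fin d → ℝ)} {L : (Fin d → ℝ) → (Fin d' → ℝ) → ℝ}
  {θ : Fin p → (Fin m → Fin d → ℝ) → (Fin d → ℝ) → (Fin d' → ℝ)}
  {Z Y : Ω → Fin (n - m) → Fin d → ℝ}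

lemma measurable_ensembleRisk (hmn : m < n) (hXm : ∀ i, i < n → Measurable (X i))
    (hL : Continuous fun q : (Fin d → ℝ) × (Fin d' → ℝ) => L q.1 q.2)
    (hθ : ∀ k, Measurable fun q : (Fin m → Fin d → ℝ) × (Fin d → ℝ) => θ k q.1 q.2)
    {W : Ω → Fin (n - m) → Fin d → ℝ} (hW : Measurable W) :
    Measurable (ensembleRisk L θ β X n W) := by
  have hu : Measurable (row X m) := measurable_row fun i hi => hXm i (hi.trans hmn)
  have h : ∀ i, Measurable fun ω => stackedLoss L θ β (row X m ω) (heldOut X m n ω) (W ω i) :=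
    fun i => by
      have h1 := (measurable_stackedLoss (N := n - m) (β := β) hL hθ).comp
        ((hu.prodMk (measurable_heldOut hXm)).prodMk ((measurable_pi_apply i).comp hW))
      exact h1
  have h2 := (Finset.measurable_sum Finset.univ fun i _ => h i).const_mul
    (1 / √((n - m : ℕ) : ℝ))
  exact h2

/-- The bound `ψ` is common to all test functions, so it passes to the supremum; monotonicity of the
integral asks no measurability of that supremum. -/
lemma lintegral_condTestDist_le {S : Type*} [MeasurableSpace S] {U V : Ω → ℝ} {W : Ω → S}
    {ψ : Ω → ℝ} (hψ : Integrable ψ P) (hψ0 : ∀ ω, 0 ≤ ψ ω)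
    (h : ∀ᵐ ω ∂P, ∀ h ∈ testFunctions,
      |∫ x, h x ∂condDistrib U W P (W ω) - ∫ x, h x ∂condDistrib V W P (W ω)| ≤ ψ ω) :
    ∫⁻ ω, condTestDist P U V W ω ∂P ≤ ENNReal.ofReal (∫ ω, ψ ω ∂P) := by
  rw [ofReal_integral_eq_lintegral_ofReal hψ (ae_of_all _ hψ0)]
  refine lintegral_mono_ae ?_
  filter_upwards [h] with ω hω
  exact iSup₂_le fun f hf => ENNReal.ofReal_le_ofReal ((le_abs_self _).trans (hω f hf))

lemma condExp_tail_le {S : Type*} [mS : MeasurableSpace S] {U V : Ω → ℝ} {W : Ω → S}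
    (hU : Measurable U) (hV : Measurable V) (hW : Measurable W) {ψ : Ω → ℝ}
    (hψ0 : ∀ ω, 0 ≤ ψ ω)
    (h : ∀ᵐ ω ∂P, ∀ h ∈ testFunctions,
      |∫ x, h x ∂condDistrib U W P (W ω) - ∫ x, h x ∂condDistrib V W P (W ω)| ≤ ψ ω)
    {δ K α : ℝ} (hδ : 0 < δ) (hK : 0 < K)
    (hmem : ∀ t, (fun x => K⁻¹ * smoothTail t δ x) ∈ testFunctions) {t : S → ℝ}
    (ht : Measurable t)
    (hα : P⟦{ω | t (W ω) ≤ |U ω|} | MeasurableSpace.comap W mS⟧ ≤ᵐ[P] fun _ => α) :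
    P⟦{ω | t (W ω) + δ ≤ |V ω|} | MeasurableSpace.comap W mS⟧
      ≤ᵐ[P] fun ω => α + K * ψ ω := by
  filter_upwards [h, hα, condExp_indicator_ae_eq_condDistrib hW hU ht,
    condExp_indicator_ae_eq_condDistrib hW hV (ht.add_const δ)] with ω h1 h2 h3 h4
  rw [h4]
  rw [h3] at h2
  exact real_tail_le hδ hK hmem (hψ0 ω) h1 h2

end Row

end SmoothStacking

/-! ### The limit theorem for smooth stacking. -/

theorem mainTheorem12 {Ω : Type*} [MeasurableSpace Ω] (P : Measure Ω) [IsProbabilityMeasure P]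
    (d d' m p : ℕ → ℕ) (β : ℕ → ℝ)
    (hm : Monotone m) (hp : Monotone p) (hβ : Monotone β)
    (hmn : ∀ n, 1 ≤ n → m n < n) (hd' : ∀ n, 0 < d' n) (hp0 : ∀ n, 0 < p n)
    (hβ0 : ∀ n, 0 < β n)
    -- the array of i.i.d. observations
    (X : (n : ℕ) → ℕ → Ω → (Fin (d n) → ℝ))
    (hXm : ∀ n i, i < n → Measurable (X n i))
    (hXi : ∀ n, iIndepFun (fun i : Fin n => X n i) P)
    (hXd : ∀ n i j, i < n → j < n → IdentDistrib (X n i) (X n j) P P)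
    -- the losses and the base estimators
    (L : (n : ℕ) → (Fin (d n) → ℝ) → (Fin (d' n) → ℝ) → ℝ)
    (hL : ∀ n, ContDiff ℝ ((⊤ : ℕ∞) : WithTop ℕ∞)
      (fun q : (Fin (d n) → ℝ) × (Fin (d' n) → ℝ) => L n q.1 q.2))
    (θ : (n : ℕ) → Fin (p n) → (Fin (m n) → Fin (d n) → ℝ) → (Fin (d n) → ℝ) → (Fin (d' n) → ℝ))
    (hθ : ∀ n k, Measurable
      (fun q : (Fin (m n) → Fin (d n) → ℝ) × (Fin (d n) → ℝ) => θ n k q.1 q.2))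
    (hT : ∀ n, 1 ≤ n → SmoothStacking.estimatorBound P (θ n) (X n) n ≠ ∞)
    (hLb : ∀ n, 1 ≤ n → SmoothStacking.lossBound P (L n) (θ n) (X n) n ≠ ∞)
    -- the rate condition
    (hrate : Tendsto (fun n =>
        β n * (d' n : ℝ) / √((n - m n : ℕ) : ℝ)
          * (SmoothStacking.lossBound P (L n) (θ n) (X n) n).toReal
          * (SmoothStacking.estimatorBound P (θ n) (X n) n).toReal
          * Real.exp (β n / ((n - m n : ℕ) : ℝ)
              * (SmoothStacking.lossBound P (L n) (θ n) (X n) n).toReal))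
      atTop (𝓝 0))
    -- the bootstrap samples and the independent copies
    (Z Y : (n : ℕ) → Ω → Fin (n - m n) → Fin (d n) → ℝ)
    (hZ : ∀ n, 1 ≤ n → SmoothStacking.IsBootstrapSample P (X n) (m n) n (Z n))
    (hY : ∀ n, 1 ≤ n → SmoothStacking.IsIndepCopy P (X n) (m n) n (Y n)) :
    Tendsto (fun n => ∫⁻ ω, SmoothStacking.condTestDist P
        (SmoothStacking.bootstrapCenteredRisk P (L n) (θ n) (β n) (X n) n (Z n))
        (SmoothStacking.copyCenteredRisk P (L n) (θ n) (β n) (X n) n (Y n))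
        (SmoothStacking.row (X n) n) ω ∂P) atTop (𝓝 0) ∧
    ∀ (α : ℝ) (t : (n : ℕ) → (Fin n → Fin (d n) → ℝ) → ℝ), (∀ n, Measurable (t n)) →
      (∀ n, 1 ≤ n →
        P⟦{ω | t n (SmoothStacking.row (X n) n ω) ≤
            |SmoothStacking.bootstrapCenteredRisk P (L n) (θ n) (β n) (X n) n (Z n) ω|} |
          SmoothStacking.rowSigma (X n) n⟧ ≤ᵐ[P] fun _ => α) →
      ∀ δ : ℝ, 0 < δ →
        (∀ ε : ℝ, 0 < ε → Tendsto (fun n => P {ω | α + ε <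
            (P⟦{ω' | t n (SmoothStacking.row (X n) n ω') + δ ≤
                |SmoothStacking.copyCenteredRisk P (L n) (θ n) (β n) (X n) n (Y n) ω'|} |
              SmoothStacking.ensembleSigma (L n) (θ n) (β n) (X n) n⟧) ω}) atTop (𝓝 0)) ∧
        limsup (fun n => P.real {ω | t n (SmoothStacking.row (X n) n ω) + δ ≤
            |SmoothStacking.copyCenteredRisk P (L n) (θ n) (β n) (X n) n (Y n) ω|}) atTop ≤ α := by
  have hLc : ∀ n, Continuous fun q : (Fin (d n) → ℝ) × (Fin (d' n) → ℝ) => L n q.1 q.2 :=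
    fun n => (hL n).continuous
  -- Row `0` would require `m 0 < 0`, so every estimate is made for `1 ≤ n`.
  have key := fun n (hn : 1 ≤ n) => SmoothStacking.exists_conditional_comparison (hmn n hn) (hp0 n) (hd' n)
    (hβ0 n) (hXm n) (hXi n) (hXd n) (hL n) (hθ n) (hT n hn) (hLb n hn) (hZ n hn) (hY n hn) rfl
  choose! ψ hψi hψ0 hψ hψb using key
  have hψt : Tendsto (fun n => ∫ ω, ψ n ω ∂P) atTop (𝓝 0) := by
    -- The lower bound `β 0 ≤ β n` turns control of `β n * D / √N` into control of `D / √N`.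
    have hlim := ((hrate.div_const (β 0)).const_mul 351).add
      (((hrate.mul (hrate.div_const (β 0))).const_mul 8).const_mul 584)
    simp only [zero_div, mul_zero, add_zero] at hlim
    refine tendsto_of_tendsto_of_tendsto_of_le_of_le' tendsto_const_nhds hlim ?_ ?_
    · filter_upwards [eventually_ge_atTop 1] with n hn using integral_nonneg (hψ0 n hn)
    · filter_upwards [eventually_ge_atTop 1, hrate.eventually_le_const (u := 1 / 4) (by norm_num)]
        with n hn hr
      refine (hψb n hn).trans (SmoothStacking.error_le_of_rate (hβ0 0) (hβ (Nat.zero_le n))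
        (by exact_mod_cast hd' n) (SmoothStacking.one_le_toReal_estimatorBound (hT n hn))
        (SmoothStacking.one_le_toReal_lossBound (hLb n hn))
        (by exact_mod_cast Nat.sub_pos_of_lt (hmn n hn)) rfl rfl hr)
  have hrow : ∀ n, Measurable (SmoothStacking.row (X n) n) := fun n =>
    SmoothStacking.measurable_row (hXm n)
  have hens : ∀ n, 1 ≤ n → SmoothStacking.ensembleSigma (L n) (θ n) (β n) (X n) n
      ≤ SmoothStacking.rowSigma (X n) n := fun n hn =>
    SmoothStacking.ensembleSigma_le_rowSigma (hmn n hn) (hLc n) (hθ n)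
  have hBm : ∀ n, 1 ≤ n → Measurable
      (SmoothStacking.bootstrapCenteredRisk P (L n) (θ n) (β n) (X n) n (Z n)) := fun n hn =>
    (SmoothStacking.measurable_ensembleRisk (hmn n hn) (hXm n) (hLc n) (hθ n) (hZ n hn).1).sub
      (stronglyMeasurable_condExp.mono (hrow n).comap_le).measurable
  have hCm : ∀ n, 1 ≤ n → Measurable
      (SmoothStacking.copyCenteredRisk P (L n) (θ n) (β n) (X n) n (Y n)) := fun n hn =>
    (SmoothStacking.measurable_ensembleRisk (hmn n hn) (hXm n) (hLc n) (hθ n) (hY n hn).1).sub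
      (stronglyMeasurable_condExp.mono ((hens n hn).trans (hrow n).comap_le)).measurable
  refine ⟨?_, fun α t ht hα δ hδ => ?_⟩
  · have h0 : Tendsto (fun n => ENNReal.ofReal (∫ ω, ψ n ω ∂P)) atTop (𝓝 0) := by
      simpa using ENNReal.tendsto_ofReal hψt
    refine tendsto_of_tendsto_of_tendsto_of_le_of_le' tendsto_const_nhds h0
      (Eventually.of_forall fun _ => zero_le) ?_
    filter_upwards [eventually_ge_atTop 1] with n hn using
      SmoothStacking.lintegral_condTestDist_le (hψi n hn) (hψ0 n hn) (hψ n hn)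
  obtain ⟨K, hK, hmem⟩ := SmoothStacking.exists_smoothTail_mem_testFunctions hδ
  have htail := fun n (hn : 1 ≤ n) => SmoothStacking.condExp_tail_le (hBm n hn) (hCm n hn) (hrow n)
    (hψ0 n hn) (hψ n hn) hδ hK hmem (ht n) (hα n hn)
  refine ⟨fun ε hε => ?_, ?_⟩
  · have h0 : Tendsto (fun n => ENNReal.ofReal (K * (∫ ω, ψ n ω ∂P) / ε)) atTop (𝓝 0) := by
      simpa using ENNReal.tendsto_ofReal ((hψt.const_mul K).div_const ε)
    refine tendsto_of_tendsto_of_tendsto_of_le_of_le' tendsto_const_nhds h0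
      (Eventually.of_forall fun _ => zero_le) ?_
    filter_upwards [eventually_ge_atTop 1] with n hn using
      SmoothStacking.measure_lt_condExp_le (hens n hn) (hrow n).comap_le (hψi n hn) (hψ0 n hn)
        hK.le hε (htail n hn)
  · have h0 : Tendsto (fun n => α + K * ∫ ω, ψ n ω ∂P) atTop (𝓝 α) := by
      simpa using (hψt.const_mul K).const_add α
    -- Comparing upper limits of reals needs boundedness: probabilities are nonnegative, and the
    -- upper bounds converge to `α`.
    refine (limsup_le_limsup ?_ (isCoboundedUnder_le_of_le atTop (x := 0)
      fun _ => measureReal_nonneg) h0.isBoundedUnder_le).trans h0.limsup_eq.le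
    filter_upwards [eventually_ge_atTop 1] with n hn using
      SmoothStacking.measureReal_le_of_condExp_le (hrow n).comap_le
        (measurableSet_le (((ht n).comp (hrow n)).add_const δ) (hCm n hn).abs) (hψi n hn)
        (htail n hn)
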